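/- Let $n\ge 2$, let $\mathbb K$ be a field of characteristic $0$ and let $q\in\mathbb K^\times$ not be a root of unity (this covers $\mathbb K=\mathbb C$ with $q$ generic, and $\mathbb K=\mathbb C(q)$ with $q$ a formal parameter). Let $U'_q(\widehat{\mathfrak{sl}}_n)$ be the $\mathbb K$-algebra with generators $E_i,F_i,K_i^{\pm1}$ ($i\in\mathbb Z/n$) and relations $K_iK_j=K_jK_i$, $K_iE_j=q^{a_{ij}}E_jK_i$, $K_iF_j=q^{-a_{ij}}F_jK_i$, $[E_i,F_j]=\delta_{ij}\frac{K_i-K_i^{-1}}{q-q^{-1}}$, $E_iE_j=E_jE_i$ and $F_iF_j=F_jF_i$ for $i\ne j\pm1$, and the $q$-Serre relations. Here $a_{ii}=2$; if $n>2$, then $a_{ij}=-1$ for $i=j\pm1$ and $a_{ij}=0$ otherwise, and the Serre relations are $X_i^2X_{i\pm1}-(q+q^{-1})X_iX_{i\pm1}X_i+X_{i\pm1}X_i^2=0$ for $X=E,F$; if $n=2$, then $a_{ij}=-2$ for $i\neq j$ and they are $X_i^3X_{i\pm1}-[3]X_i^2X_{i\pm1}X_i+[3]X_iX_{i\pm1}X_i^2-X_{i\pm1}X_i^3=0$,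 with $[3]=\frac{q^3-q^{-3}}{q-q^{-1}}$. Let $V(z)=\mathbb K^n\otimes\mathbb K[z,z^{-1}]$, with basis $u_{j-an}=z^av_j$ ($a\in\mathbb Z$, $1\le j\le n$) and operators $K_iu_l=q^{\delta(l\equiv i)-\delta(l\equiv i+1)}u_l$, $E_iu_l=\delta(l-1\equiv i)u_{l-1}$, $F_iu_l=\delta(l\equiv i)u_{l+1}$ (congruences mod $n$). On $V(z)\otimes V(z)$, write $z^{a}v_{i}\otimes z^{b}v_{j}=(v_i\otimes v_j)\cdot\mathbf z$ with $\mathbf z=z_1^az_2^b$, put $\mathbf z^\sigma=z_1^bz_2^a$, and let $$((v_i\otimes v_j)\cdot\mathbf z)\,T=\begin{cases}-q(v_j\otimes v_i)\cdot\mathbf z^\sigma-(q^2-1)(v_i\otimes v_j)\cdot\frac{z_2\mathbf z^\sigma-z_1\mathbf z}{z_1-z_2}&(i<j),\\ -(v_i\otimes v_i)\cdot\mathbf z^\sigma-(q^2-1)(v_i\otimes v_i)\cdot\frac{z_1(\mathbf z^\sigma-\mathbf z)}{z_1-z_2}&(i=j),\\ -q(v_j\otimes v_i)\cdot\mathbf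 z^\sigma-(q^2-1)(v_i\otimes v_j)\cdot\frac{z_1(\mathbf z^\sigma-\mathbf z)}{z_1-z_2}&(i>j).\end{cases}$$ For $m\in\mathbb Z$ let $U_{(m)}$ be the span of the semi-infinite tensors $u_{m_1}\otimes u_{m_2}\otimes\cdots$ with $m_k=m-k+1$ for $k\gg1$, let $T_k$ be $T$ acting in the factors $k,k+1$, and let $F_{(m)}=U_{(m)}/\sum_{k\ge1}\operatorname{Ker}(T_k+1)$. Write $u_{m_1}\wedge u_{m_2}\wedge\cdots$ for the image of $u_{m_1}\otimes u_{m_2}\otimes\cdots$, and $|m\rangle=u_m\wedge u_{m-1}\wedge\cdots$. **(1)** There is exactly one family of $U'_q(\widehat{\mathfrak{sl}}_n)$-module structures on the spaces $F_{(m)}$, $m\in\mathbb Z$, such that, for all $m$ and $i$, $E_i|m\rangle=0$; $F_i|m\rangle=u_{m+1}\wedge|m-1\rangle$ if $i\equiv m$ and $0$ otherwise; $K_i|m\rangle=q|m\rangle$ if $i\equiv m$ and $|m\rangle$ otherwise; and, for $v\in V(z)$ and $x\in F_{(m-1)}$, $K_i(v\wedge x)=K_iv\wedge K_ix$, $E_i(v\wedge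 x)=E_iv\wedge K_ix+v\wedge E_ix$, $F_i(v\wedge x)=F_iv\wedge x+K_i^{-1}v\wedge F_ix$. **(2)** For each $m\in\mathbb Z$ there is exactly one $U'_q(\widehat{\mathfrak{sl}}_n)$-module structure (the $q$-deformed Fock space of Hayashi and Misra–Miwa of charge $m$) on the vector space with basis all Young diagrams $\mu$, the box in row $r$ and column $c$ having color $m+c-r \bmod n$, such that $$K_i\mu=q^{A_i(\mu)-R_i(\mu)}\mu,\qquad F_i\mu=\sum_b q^{R_i^{\uparrow}(\mu,b)-A_i^{\uparrow}(\mu,b)}\,(\mu\cup\{b\}),\qquad E_i\mu=\sum_b q^{A_i^{\downarrow}(\mu,b)-R_i^{\downarrow}(\mu,b)}\,(\mu\setminus\{b\}).$$ The sums are over the addable, respectively removable, boxes $b$ of $\mu$ of color $i$; $A_i(\mu)$ and $R_i(\mu)$ are the numbers of addable and removable boxes of $\mu$ of color $i$, and $\uparrow$ (respectively $\downarrow$) means that only boxes in rows strictly above (respectively below) the row of $b$ are counted. (Row 1 is the top, longest row.) **(3)** For each $m\in\mathbb Z$, the $U'_q(\widehat{\mathfrak{sl}}_n)$-modules of (1)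 and (2) are isomorphic. More precisely, there are a bijection between the sequences $m_1>m_2>m_3>\cdots$ with $m_k=m-k+1$ for $k\gg1$ and the Young diagrams, where the diagram $\mu$ corresponding to $(m_k)$ has $k$-th row of length $\mu_k=m_k-m+k-1$, and an isomorphism of $U'_q(\widehat{\mathfrak{sl}}_n)$-modules from $F_{(m)}$ onto the Fock space of charge $m$ that maps every normally ordered wedge $u_{m_1}\wedge u_{m_2}\wedge\cdots$ to the corresponding Young diagram. -/

import Mathlib

namespace QWedge

noncomputable section

/-! ### The quantum affine algebra `U'_q(sl_n^)` by generators and relations -/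

/-- The Chevalley generators; indices are read modulo `n`. -/
inductive Gen (n : ℕ) : Type
  | E (i : ZMod n) : Gen n
  | F (i : ZMod n) : Gen n
  | K (i : ZMod n) : Gen n
  | Kinv (i : ZMod n) : Gen n

/-- The affine Cartan integers `a_{ij}` (used for `n ≥ 2`). -/
def cartan (n : ℕ) (i j : ZMod n) : ℤ :=
  if i = j then 2
  else if n = 2 then -2
  else if i = j + 1 ∨ i = j - 1 then -1
  else 0

/-- The `q`-integer `[k] = (q^k - q^{-k}) / (q - q⁻¹)`. -/
def qInt {𝕜 : Type*} [Field 𝕜] (q : 𝕜) (k : ℕ) : 𝕜 :=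
  (q ^ k - (q⁻¹) ^ k) / (q - q⁻¹)

/-- The quadratic-exponent (`n > 2`) `q`-Serre expression `a²b - (q+q⁻¹) aba + ba²`. -/
def serre2 {𝕜 A : Type*} [Field 𝕜] [Ring A] [Algebra 𝕜 A] (q : 𝕜) (a b : A) : A :=
  a ^ 2 * b - (q + q⁻¹) • (a * b * a) + b * a ^ 2

/-- The `q`-Serre expression for `n = 2`: `a³b - [3] a²ba + [3] aba² - ba³`. -/
def serre3 {𝕜 A : Type*} [Field 𝕜] [Ring A] [Algebra 𝕜 A] (q : 𝕜) (a b : A) : A :=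
  a ^ 3 * b - qInt q 3 • (a ^ 2 * b * a) + qInt q 3 • (a * b * a ^ 2) - b * a ^ 3

section Relations

variable {𝕜 : Type*} [Field 𝕜] {n : ℕ}

/-- The generators inside the free algebra. -/
def fE (i : ZMod n) : FreeAlgebra 𝕜 (Gen n) := FreeAlgebra.ι 𝕜 (Gen.E i)
/-- The generators inside the free algebra. -/
def fF (i : ZMod n) : FreeAlgebra 𝕜 (Gen n) := FreeAlgebra.ι 𝕜 (Gen.F i)
/-- The generators inside the free algebra. -/
def fK (i : ZMod n) : FreeAlgebra 𝕜 (Gen n) := FreeAlgebra.ι 𝕜 (Gen.K i)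
/-- The generators inside the free algebra. -/
def fKinv (i : ZMod n) : FreeAlgebra 𝕜 (Gen n) := FreeAlgebra.ι 𝕜 (Gen.Kinv i)

/-- The defining relations of `U'_q(sl_n^)`. -/
inductive Rel (q : 𝕜) (n : ℕ) : FreeAlgebra 𝕜 (Gen n) → FreeAlgebra 𝕜 (Gen n) → Prop
  | K_mul_Kinv (i : ZMod n) : Rel q n (fK i * fKinv i) 1
  | Kinv_mul_K (i : ZMod n) : Rel q n (fKinv i * fK i) 1
  | K_comm (i j : ZMod n) : Rel q n (fK i * fK j) (fK j * fK i)
  | K_E (i j : ZMod n) : Rel q n (fK i * fE j) (q ^ cartan n i j • (fE j * fK i))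
  | K_F (i j : ZMod n) : Rel q n (fK i * fF j) (q ^ (-cartan n i j) • (fF j * fK i))
  | E_F_self (i : ZMod n) :
      Rel q n (fE i * fF i - fF i * fE i) ((q - q⁻¹)⁻¹ • (fK i - fKinv i))
  | E_F_ne (i j : ZMod n) (h : i ≠ j) : Rel q n (fE i * fF j - fF j * fE i) 0
  | E_comm (i j : ZMod n) (h₁ : i ≠ j + 1) (h₂ : i ≠ j - 1) : Rel q n (fE i * fE j) (fE j * fE i)
  | F_comm (i j : ZMod n) (h₁ : i ≠ j + 1) (h₂ : i ≠ j - 1) : Rel q n (fF i * fF j) (fF j * fF i)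
  | E_serre2 (i j : ZMod n) (hn : 2 < n) (h : j = i + 1 ∨ j = i - 1) :
      Rel q n (serre2 q (fE i) (fE j)) 0
  | F_serre2 (i j : ZMod n) (hn : 2 < n) (h : j = i + 1 ∨ j = i - 1) :
      Rel q n (serre2 q (fF i) (fF j)) 0
  | E_serre3 (i j : ZMod n) (hn : n = 2) (h : j = i + 1 ∨ j = i - 1) :
      Rel q n (serre3 q (fE i) (fE j)) 0
  | F_serre3 (i j : ZMod n) (hn : n = 2) (h : j = i + 1 ∨ j = i - 1) :
      Rel q n (serre3 q (fF i) (fF j)) 0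

/-- The algebra `U'_q(sl_n^)` over the field `𝕜`. -/
abbrev U (q : 𝕜) (n : ℕ) : Type _ := RingQuot (Rel q n)

/-- The image of a Chevalley generator in `U'_q(sl_n^)`. -/
def gen (q : 𝕜) (n : ℕ) (g : Gen n) : U q n :=
  RingQuot.mkAlgHom 𝕜 (Rel q n) (FreeAlgebra.ι 𝕜 g)

end Relations

/-! ### The evaluation module `V(z)`

The basis of `V(z)` is indexed by the integers: `u_{j - a n} = z^a v_j` with `1 ≤ j ≤ n`. -/

/-- `V(z)`, with basis `u_l = Finsupp.single l 1`, `l ∈ ℤ`. -/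
abbrev V (𝕜 : Type*) [Field 𝕜] : Type _ := ℤ →₀ 𝕜

/-- The index `j ∈ {1, …, n}` with `u_l = z^a v_j`. -/
def vIdx (n : ℕ) (l : ℤ) : ℤ := (l - 1) % n + 1

/-- The exponent `a` with `u_l = z^a v_j`. -/
def zExp (n : ℕ) (l : ℤ) : ℤ := -((l - 1) / n)

theorem vIdx_sub_zExp_mul (n : ℕ) (l : ℤ) : vIdx n l - zExp n l * n = l := by
  have := Int.emod_add_mul_ediv (l - 1) n
  unfold vIdx zExp
  linarith

section Evaluation

variable {𝕜 : Type*} [Field 𝕜]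

/-- The exponent of `q` in `K_i u_l = q^{δ(l ≡ i) - δ(l ≡ i+1)} u_l`. -/
def wt (n : ℕ) (i : ZMod n) (l : ℤ) : ℤ :=
  (if (l : ZMod n) = i then 1 else 0) - (if (l : ZMod n) = i + 1 then 1 else 0)

/-- `E_i u_l = δ(l - 1 ≡ i) u_{l-1}`. -/
def evE (n : ℕ) (i : ZMod n) : V 𝕜 →ₗ[𝕜] V 𝕜 :=
  Finsupp.linearCombination 𝕜 fun l : ℤ =>
    if ((l - 1 : ℤ) : ZMod n) = i then Finsupp.single (l - 1) (1 : 𝕜) else 0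

/-- `F_i u_l = δ(l ≡ i) u_{l+1}`. -/
def evF (n : ℕ) (i : ZMod n) : V 𝕜 →ₗ[𝕜] V 𝕜 :=
  Finsupp.linearCombination 𝕜 fun l : ℤ =>
    if (l : ZMod n) = i then Finsupp.single (l + 1) (1 : 𝕜) else 0

/-- `K_i u_l = q^{δ(l ≡ i) - δ(l ≡ i+1)} u_l`. -/
def evK (q : 𝕜) (n : ℕ) (i : ZMod n) : V 𝕜 →ₗ[𝕜] V 𝕜 :=
  Finsupp.linearCombination 𝕜 fun l : ℤ => Finsupp.single l (q ^ wt n i l)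

/-- The inverse of `K_i` on `V(z)`. -/
def evKinv (q : 𝕜) (n : ℕ) (i : ZMod n) : V 𝕜 →ₗ[𝕜] V 𝕜 :=
  Finsupp.linearCombination 𝕜 fun l : ℤ => Finsupp.single l (q ^ (-wt n i l))

end Evaluation

/-! ### The Hecke operator `T` on `V(z) ⊗ V(z)`

`V(z) ⊗ V(z)` has basis `u_l ⊗ u_m = Finsupp.single (l, m) 1`. -/

section Hecke

variable {𝕜 : Type*} [Field 𝕜]

/-- The Laurent monomial `z₁^a z₂^b`. -/
def zMon (𝕜 : Type*) [Field 𝕜] (a b : ℤ) : AddMonoidAlgebra 𝕜 (ℤ × ℤ) :=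
  AddMonoidAlgebra.single (a, b) 1

theorem zMon_mul (a b c d : ℤ) : zMon 𝕜 a b * zMon 𝕜 c d = zMon 𝕜 (a + c) (b + d) := by
  simp [zMon, AddMonoidAlgebra.single_mul_single]

/-- The Laurent polynomial `(z₁^b z₂^a - z₁^a z₂^b) / (z₁ - z₂)`, see `divDiff_spec`. -/
def divDiff (𝕜 : Type*) [Field 𝕜] (a b : ℤ) : AddMonoidAlgebra 𝕜 (ℤ × ℤ) :=
  if a ≤ b then ∑ k ∈ Finset.range (b - a).toNat, zMon 𝕜 (b - 1 - k) (a + k)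
  else -∑ k ∈ Finset.range (a - b).toNat, zMon 𝕜 (a - 1 - k) (b + k)

theorem divDiff_aux (a : ℤ) (d : ℕ) :
    (zMon 𝕜 1 0 - zMon 𝕜 0 1) * ∑ k ∈ Finset.range d, zMon 𝕜 (a + d - 1 - k) (a + k) =
      zMon 𝕜 (a + d) a - zMon 𝕜 a (a + d) := by
  have h : ∀ k : ℕ, (zMon 𝕜 1 0 - zMon 𝕜 0 1) * zMon 𝕜 (a + d - 1 - k) (a + k) =
      zMon 𝕜 (a + d - k) (a + k) - zMon 𝕜 (a + d - (k + 1 : ℕ)) (a + (k + 1 : ℕ)) := by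
    intro k
    rw [sub_mul, zMon_mul, zMon_mul]
    congr 2 <;> push_cast <;> ring
  rw [Finset.mul_sum, Finset.sum_congr rfl fun k _ => h k,
    Finset.sum_range_sub' (fun k : ℕ => zMon 𝕜 (a + d - k) (a + k))]
  simp

theorem divDiff_spec (a b : ℤ) :
    (zMon 𝕜 1 0 - zMon 𝕜 0 1) * divDiff 𝕜 a b = zMon 𝕜 b a - zMon 𝕜 a b := by
  unfold divDiff
  split_ifs with h
  · obtain ⟨d, rfl⟩ := Int.le.dest h
    simpa using divDiff_aux (𝕜 := 𝕜) a d
  · obtain ⟨d, rfl⟩ := Int.le.dest (le_of_not_ge h)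
    have := divDiff_aux (𝕜 := 𝕜) b d
    rw [mul_neg, show (b + d - b).toNat = d by simp, this, neg_sub]

/-- The linear map `z₁^a z₂^b ↦ (v_i ⊗ v_j) z₁^a z₂^b = u_{i - a n} ⊗ u_{j - b n}`. -/
def place (𝕜 : Type*) [Field 𝕜] (n : ℕ) (i j : ℤ) :
    AddMonoidAlgebra 𝕜 (ℤ × ℤ) →ₗ[𝕜] (ℤ × ℤ →₀ 𝕜) :=
  Finsupp.lmapDomain 𝕜 𝕜 (fun p : ℤ × ℤ => (i - p.1 * n, j - p.2 * n)) ∘ₗ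
    (AddMonoidAlgebra.coeffLinearEquiv 𝕜).toLinearMap

/-- `(u_l ⊗ u_m) · T`.  With `u_l ⊗ u_m = (v_i ⊗ v_j) z₁^a z₂^b`, the three cases are
`i < j`, `i = j` and `i > j`.  Note that `u_m ⊗ u_l` is `(v_j ⊗ v_i) z₁^b z₂^a`, that
`divDiff (a+1) b = (z₂ z₁^b z₂^a - z₁ z₁^a z₂^b) / (z₁ - z₂)`, and that
`z₁ * divDiff a b = z₁ (z₁^b z₂^a - z₁^a z₂^b) / (z₁ - z₂)`. -/
def heckePair (q : 𝕜) (n : ℕ) (l m : ℤ) : ℤ × ℤ →₀ 𝕜 :=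
  if vIdx n l < vIdx n m then
    -q • Finsupp.single (m, l) (1 : 𝕜)
      - (q ^ 2 - 1) • place 𝕜 n (vIdx n l) (vIdx n m) (divDiff 𝕜 (zExp n l + 1) (zExp n m))
  else if vIdx n l = vIdx n m then
    -Finsupp.single (m, l) (1 : 𝕜)
      - (q ^ 2 - 1) • place 𝕜 n (vIdx n l) (vIdx n m)
          (zMon 𝕜 1 0 * divDiff 𝕜 (zExp n l) (zExp n m))
  else
    -q • Finsupp.single (m, l) (1 : 𝕜)
      - (q ^ 2 - 1) • place 𝕜 n (vIdx n l) (vIdx n m)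
          (zMon 𝕜 1 0 * divDiff 𝕜 (zExp n l) (zExp n m))

end Hecke

/-! ### Semi-infinite tensors and semi-infinite `q`-wedges -/

/-- Index set of the pure tensors `u_{s 0} ⊗ u_{s 1} ⊗ u_{s 2} ⊗ ⋯` in `U_(m)`: sequences
with `s k = m - k` for all large `k` (positions are counted from `0`). -/
def Seq (m : ℤ) : Type := {s : ℕ → ℤ // ∃ N : ℕ, ∀ k : ℕ, N ≤ k → s k = m - k}

namespace Seq

/-- Replace the entries in positions `i` and `i + 1`. -/
def replace {m : ℤ} (s : Seq m) (i : ℕ) (p : ℤ × ℤ) : Seq m :=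
  ⟨Function.update (Function.update s.1 i p.1) (i + 1) p.2, by
    obtain ⟨N, hN⟩ := s.2
    refine ⟨max N (i + 2), fun k hk => ?_⟩
    have h1 : k ≠ i + 1 := by omega
    have h2 : k ≠ i := by omega
    rw [Function.update_of_ne h1, Function.update_of_ne h2]
    exact hN k (by omega)⟩

/-- The sequence `l, s 0, s 1, …`. -/
def cons {m : ℤ} (l : ℤ) (s : Seq (m - 1)) : Seq m :=
  ⟨fun k => Nat.casesOn k l s.1, by
    obtain ⟨N, hN⟩ := s.2
    refine ⟨N + 1, fun k hk => ?_⟩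
    cases k with
    | zero => omega
    | succ k =>
      change s.1 k = _
      rw [hN k (by omega)]
      push_cast
      ring⟩

/-- The sequence `m, m - 1, m - 2, …`. -/
def vac (m : ℤ) : Seq m := ⟨fun k => m - k, 0, fun _ _ => rfl⟩

theorem cons_replace {m : ℤ} (l : ℤ) (s : Seq (m - 1)) (i : ℕ) (p : ℤ × ℤ) :
    cons l (s.replace i p) = (cons l s : Seq m).replace (i + 1) p := by
  apply Subtype.ext
  funext k
  cases k with
  | zero => simp [cons, replace]
  | succ k => simp [cons, replace, Function.update_apply]

end Seq

section Wedge

variable {𝕜 : Type*} [Field 𝕜]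

/-- The space `U_(m)` of semi-infinite tensors, with the pure tensors as basis. -/
abbrev Tens (𝕜 : Type*) [Field 𝕜] (m : ℤ) : Type _ := Seq m →₀ 𝕜

/-- The operator `T_{i+1}` on `U_(m)`: it acts as `T` in the factors in positions `i, i + 1`
(counted from `0`). -/
def heckeT (q : 𝕜) (n : ℕ) (m : ℤ) (i : ℕ) : Tens 𝕜 m →ₗ[𝕜] Tens 𝕜 m :=
  Finsupp.linearCombination 𝕜 fun s : Seq m =>
    Finsupp.mapDomain (fun p => s.replace i p) (heckePair q n (s.1 i) (s.1 (i + 1)))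

/-- The subspace `∑_i Ker (T_i + 1)` of `U_(m)`. -/
def wedgeRel (q : 𝕜) (n : ℕ) (m : ℤ) : Submodule 𝕜 (Tens 𝕜 m) :=
  ⨆ i : ℕ, LinearMap.ker (heckeT q n m i + LinearMap.id)

/-- The semi-infinite `q`-wedge space `F_(m) = U_(m) / ∑_i Ker (T_i + 1)`. -/
abbrev Fock (q : 𝕜) (n : ℕ) (m : ℤ) : Type _ := Tens 𝕜 m ⧸ wedgeRel q n m

/-- The semi-infinite `q`-wedge `u_{s 0} ∧ u_{s 1} ∧ u_{s 2} ∧ ⋯`. -/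
def pureWedge (q : 𝕜) (n : ℕ) {m : ℤ} (s : Seq m) : Fock q n m :=
  (wedgeRel q n m).mkQ (Finsupp.single s 1)

/-- The vacuum `|m⟩ = u_m ∧ u_{m-1} ∧ u_{m-2} ∧ ⋯`. -/
def vacuum (q : 𝕜) (n : ℕ) (m : ℤ) : Fock q n m := pureWedge q n (Seq.vac m)

/-- `x ↦ u_l ⊗ x` on semi-infinite tensors. -/
def tensCons (𝕜 : Type*) [Field 𝕜] (m l : ℤ) : Tens 𝕜 (m - 1) →ₗ[𝕜] Tens 𝕜 m :=
  Finsupp.lmapDomain 𝕜 𝕜 (Seq.cons l)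

theorem heckeT_tensCons (q : 𝕜) (n : ℕ) (m l : ℤ) (i : ℕ) (x : Tens 𝕜 (m - 1)) :
    heckeT q n m (i + 1) (tensCons 𝕜 m l x) = tensCons 𝕜 m l (heckeT q n (m - 1) i x) := by
  induction x using Finsupp.induction_linear with
  | zero => simp
  | add f g hf hg => simp only [map_add, hf, hg]
  | single s a =>
    have h1 : (Seq.cons l s : Seq m).1 (i + 1) = s.1 i := rfl
    have h2 : (Seq.cons l s : Seq m).1 (i + 1 + 1) = s.1 (i + 1) := rfl
    simp only [heckeT, tensCons, Finsupp.lmapDomain_apply, Finsupp.mapDomain_single,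
      Finsupp.linearCombination_single, h1, h2, Finsupp.mapDomain_smul]
    rw [← Finsupp.mapDomain_comp]
    congr 2
    funext p
    exact (Seq.cons_replace l s i p).symm

theorem wedgeRel_le_comap (q : 𝕜) (n : ℕ) (m l : ℤ) :
    wedgeRel q n (m - 1) ≤ (wedgeRel q n m).comap (tensCons 𝕜 m l) := by
  refine iSup_le fun i x hx => ?_
  refine Submodule.mem_iSup_of_mem (i + 1) ?_
  rw [LinearMap.mem_ker] at hx ⊢
  simp only [LinearMap.add_apply, LinearMap.id_apply] at hx ⊢
  rw [heckeT_tensCons, ← map_add, hx, map_zero]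

/-- The `q`-wedging map `V(z) × F_(m-1) → F_(m)`, `(v, x) ↦ v ∧ x`. -/
def wedge (q : 𝕜) (n : ℕ) (m : ℤ) : V 𝕜 →ₗ[𝕜] Fock q n (m - 1) →ₗ[𝕜] Fock q n m :=
  Finsupp.linearCombination 𝕜 fun l : ℤ =>
    (wedgeRel q n (m - 1)).mapQ (wedgeRel q n m) (tensCons 𝕜 m l) (wedgeRel_le_comap q n m l)

/-- The action of `U'_q(sl_n^)` on the spaces `F_(m)`: the action on the vacua `|m⟩` mirrors
the formal action on `u_m ⊗ u_{m-1} ⊗ ⋯`, and the action on `v ∧ x` is given by the coproduct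
`Δ K = K ⊗ K`, `Δ E = E ⊗ K + 1 ⊗ E`, `Δ F = F ⊗ 1 + K⁻¹ ⊗ F`.  Since every vector is a
combination of vectors `u_{l_1} ∧ ⋯ ∧ u_{l_N} ∧ |m - N⟩`, this leaves no choice. -/
structure IsWedgeAction (q : 𝕜) (n : ℕ)
    (ρ : ∀ m : ℤ, U q n →ₐ[𝕜] Module.End 𝕜 (Fock q n m)) : Prop where
  E_vacuum : ∀ (m : ℤ) (i : ZMod n), ρ m (gen q n (Gen.E i)) (vacuum q n m) = 0
  F_vacuum : ∀ (m : ℤ) (i : ZMod n), ρ m (gen q n (Gen.F i)) (vacuum q n m) =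
    if (m : ZMod n) = i then wedge q n m (Finsupp.single (m + 1) 1) (vacuum q n (m - 1)) else 0
  K_vacuum : ∀ (m : ℤ) (i : ZMod n), ρ m (gen q n (Gen.K i)) (vacuum q n m) =
    if (m : ZMod n) = i then q • vacuum q n m else vacuum q n m
  E_wedge : ∀ (m : ℤ) (i : ZMod n) (v : V 𝕜) (x : Fock q n (m - 1)),
    ρ m (gen q n (Gen.E i)) (wedge q n m v x) =
      wedge q n m (evE n i v) (ρ (m - 1) (gen q n (Gen.K i)) x)
        + wedge q n m v (ρ (m - 1) (gen q n (Gen.E i)) x)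
  F_wedge : ∀ (m : ℤ) (i : ZMod n) (v : V 𝕜) (x : Fock q n (m - 1)),
    ρ m (gen q n (Gen.F i)) (wedge q n m v x) =
      wedge q n m (evF n i v) x
        + wedge q n m (evKinv q n i v) (ρ (m - 1) (gen q n (Gen.F i)) x)
  K_wedge : ∀ (m : ℤ) (i : ZMod n) (v : V 𝕜) (x : Fock q n (m - 1)),
    ρ m (gen q n (Gen.K i)) (wedge q n m v x) =
      wedge q n m (evK q n i v) (ρ (m - 1) (gen q n (Gen.K i)) x)

end Wedge

/-! ### The Fock space of colored Young diagrams

Boxes are pairs `(r, c)` = (row, column), counted from `0`; rows go downward. -/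

section Young

/-- `b` can be added to `μ`: it is not in `μ`, but all boxes weakly north-west of it are. -/
def IsAddable (μ : YoungDiagram) (b : ℕ × ℕ) : Prop := b ∉ μ ∧ ∀ c, c < b → c ∈ μ

/-- `b` can be removed from `μ`: it is in `μ`, but no other box weakly south-east of it is. -/
def IsRemovable (μ : YoungDiagram) (b : ℕ × ℕ) : Prop := b ∈ μ ∧ ∀ c, b < c → c ∉ μ

open Classical in
/-- The finite set of addable boxes of `μ`. -/
def addable (μ : YoungDiagram) : Finset (ℕ × ℕ) :=
  {b ∈ Finset.range (μ.colLen 0 + 1) ×ˢ Finset.range (μ.rowLen 0 + 1) | IsAddable μ b}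

open Classical in
/-- The finite set of removable boxes of `μ`. -/
def removable (μ : YoungDiagram) : Finset (ℕ × ℕ) := {b ∈ μ.cells | IsRemovable μ b}

theorem mem_addable (μ : YoungDiagram) (b : ℕ × ℕ) : b ∈ addable μ ↔ IsAddable μ b := by
  classical
  obtain ⟨r, c⟩ := b
  simp only [addable, Finset.mem_filter, Finset.mem_product, Finset.mem_range,
    and_iff_right_iff_imp]
  rintro ⟨-, h⟩
  constructor
  · rcases r with _ | r
    · omega
    · have : (r, c) ∈ μ := h _ (Prod.mk_lt_mk.2 (Or.inl ⟨Nat.lt_succ_self r, le_rfl⟩))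
      have := YoungDiagram.mem_iff_lt_colLen.1 (μ.up_left_mem le_rfl (Nat.zero_le c) this)
      omega
  · rcases c with _ | c
    · omega
    · have : (r, c) ∈ μ := h _ (Prod.mk_lt_mk.2 (Or.inr ⟨le_rfl, Nat.lt_succ_self c⟩))
      have := YoungDiagram.mem_iff_lt_rowLen.1 (μ.up_left_mem (Nat.zero_le r) le_rfl this)
      omega

theorem mem_removable (μ : YoungDiagram) (b : ℕ × ℕ) : b ∈ removable μ ↔ IsRemovable μ b := by
  classical
  simp only [removable, Finset.mem_filter, YoungDiagram.mem_cells, and_iff_right_iff_imp]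
  exact fun h => h.1

/-- The smallest Young diagram containing `μ` and `b`; it is `μ ∪ {b}` if `b` is addable. -/
def addBox (μ : YoungDiagram) (b : ℕ × ℕ) : YoungDiagram where
  cells := μ.cells ∪ Finset.Iic b
  isLowerSet := by
    rw [Finset.coe_union, Finset.coe_Iic]
    exact μ.isLowerSet.union (isLowerSet_Iic b)

/-- The largest Young diagram inside `μ` without `b`; it is `μ \ {b}` if `b` is removable. -/
def removeBox (μ : YoungDiagram) (b : ℕ × ℕ) : YoungDiagram where
  cells := {c ∈ μ.cells | ¬ b ≤ c}
  isLowerSet := by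
    intro x y hyx hx
    simp only [Finset.coe_filter, Set.mem_ofPred_eq] at hx ⊢
    exact ⟨μ.isLowerSet hyx hx.1, fun h => hx.2 (h.trans hyx)⟩

theorem cells_addBox {μ : YoungDiagram} {b : ℕ × ℕ} (h : IsAddable μ b) :
    (addBox μ b).cells = insert b μ.cells := by
  ext c
  simp only [addBox, Finset.mem_union, Finset.mem_Iic, Finset.mem_insert, YoungDiagram.mem_cells]
  constructor
  · rintro (hc | hc)
    · exact Or.inr hc
    · exact hc.eq_or_lt.imp id (h.2 c)
  · rintro (rfl | hc)
    · exact Or.inr le_rfl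
    · exact Or.inl hc

theorem cells_removeBox {μ : YoungDiagram} {b : ℕ × ℕ} (h : IsRemovable μ b) :
    (removeBox μ b).cells = μ.cells.erase b := by
  ext c
  simp only [removeBox, Finset.mem_filter, Finset.mem_erase, YoungDiagram.mem_cells]
  constructor
  · rintro ⟨h1, h2⟩
    exact ⟨fun e => h2 e.ge, h1⟩
  · rintro ⟨h1, h2⟩
    exact ⟨h2, fun e => h.2 c (lt_of_le_of_ne e (Ne.symm h1)) h2⟩

/-- The color of a box in a diagram of charge `m`: `m + (column) - (row)` modulo `n`. -/
def color (n : ℕ) (m : ℤ) (b : ℕ × ℕ) : ZMod n := ((m + b.2 - b.1 : ℤ) : ZMod n)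

/-- Addable boxes of color `i`. -/
def addableC (n : ℕ) (m : ℤ) (i : ZMod n) (μ : YoungDiagram) : Finset (ℕ × ℕ) :=
  {b ∈ addable μ | color n m b = i}

/-- Removable boxes of color `i`. -/
def removableC (n : ℕ) (m : ℤ) (i : ZMod n) (μ : YoungDiagram) : Finset (ℕ × ℕ) :=
  {b ∈ removable μ | color n m b = i}

/-- (number of addable `i`-boxes) - (number of removable `i`-boxes). -/
def diff (n : ℕ) (m : ℤ) (i : ZMod n) (μ : YoungDiagram) : ℤ :=
  ((addableC n m i μ).card : ℤ) - ((removableC n m i μ).card : ℤ)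

/-- (number of addable `i`-boxes) - (number of removable `i`-boxes), both counted only in the
rows strictly above row `r`. -/
def diffAbove (n : ℕ) (m : ℤ) (i : ZMod n) (μ : YoungDiagram) (r : ℕ) : ℤ :=
  (({b ∈ addableC n m i μ | b.1 < r}).card : ℤ) - (({b ∈ removableC n m i μ | b.1 < r}).card : ℤ)

/-- (number of addable `i`-boxes) - (number of removable `i`-boxes), both counted only in the
rows strictly below row `r`. -/
def diffBelow (n : ℕ) (m : ℤ) (i : ZMod n) (μ : YoungDiagram) (r : ℕ) : ℤ :=
  (({b ∈ addableC n m i μ | r < b.1}).card : ℤ) - (({b ∈ removableC n m i μ | r < b.1}).card : ℤ)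

variable {𝕜 : Type*} [Field 𝕜]

/-- The vector space with the Young diagrams as basis. -/
abbrev YFock (𝕜 : Type*) [Field 𝕜] : Type _ := YoungDiagram →₀ 𝕜

/-- `E_i μ = ∑_b q^{diffBelow} (μ \ {b})`, over the removable `i`-boxes `b` of `μ`. -/
def youngE (q : 𝕜) (n : ℕ) (m : ℤ) (i : ZMod n) : YFock 𝕜 →ₗ[𝕜] YFock 𝕜 :=
  Finsupp.linearCombination 𝕜 fun μ : YoungDiagram =>
    ∑ b ∈ removableC n m i μ, Finsupp.single (removeBox μ b) (q ^ diffBelow n m i μ b.1)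

/-- `F_i μ = ∑_b q^{-diffAbove} (μ ∪ {b})`, over the addable `i`-boxes `b` of `μ`. -/
def youngF (q : 𝕜) (n : ℕ) (m : ℤ) (i : ZMod n) : YFock 𝕜 →ₗ[𝕜] YFock 𝕜 :=
  Finsupp.linearCombination 𝕜 fun μ : YoungDiagram =>
    ∑ b ∈ addableC n m i μ, Finsupp.single (addBox μ b) (q ^ (-diffAbove n m i μ b.1))

/-- `K_i μ = q^{diff} μ`. -/
def youngK (q : 𝕜) (n : ℕ) (m : ℤ) (i : ZMod n) : YFock 𝕜 →ₗ[𝕜] YFock 𝕜 :=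
  Finsupp.linearCombination 𝕜 fun μ : YoungDiagram => Finsupp.single μ (q ^ diff n m i μ)

/-- `σ` is the action of `U'_q(sl_n^)` on the Fock space of colored Young diagrams of
charge `m`. -/
structure IsYoungAction (q : 𝕜) (n : ℕ) (m : ℤ) (σ : U q n →ₐ[𝕜] Module.End 𝕜 (YFock 𝕜)) :
    Prop where
  E_eq : ∀ i : ZMod n, σ (gen q n (Gen.E i)) = youngE q n m i
  F_eq : ∀ i : ZMod n, σ (gen q n (Gen.F i)) = youngF q n m i
  K_eq : ∀ i : ZMod n, σ (gen q n (Gen.K i)) = youngK q n m i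

end Young

end

end QWedge

namespace QWedge

noncomputable section

/-! ### Signed sums over integer ranges -/

/-! Everything rests on the affine Hecke algebra acting on semi-infinite tensors. Let `Y_k`
(`posShift`) multiply the factor `k` by `z⁻¹`. Then `T_k Y_k = Y_{k+1} T_k - (q² - 1) Y_{k+1}`, `T_k
Y_{k+1} = Y_k T_k + (q² - 1) Y_{k+1}`, and `T_k` commutes with the other shifts. An operator that
intertwines shifts vanishes once it vanishes on tensors whose relevant entries lie in one window of
`n` consecutive integers (`eq_zero_of_window`), and on a window `T_k` is the finite Hecke action.
Finite checks therefore give `hecke_quadratic`, `hecke_braid` and the commutation of `T_k` with the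
coproduct action.

Basis of `F_(m)`. Since `(T_k + 1)(T_k - q²) = 0`, the operator `T_k` acts on the quotient as `q²`,
so an ascending pair can be rewritten through descending or closer pairs; a weighted sum of the
entries shows that this terminates (`pureWedge_mem_span`). For independence, the sum `A_N` of all
`T_w` satisfies `A_N T_i = q² A_N`, hence kills `Ker (T_i + 1)` because `q² + 1 ≠ 0`. On decreasing
tensors `A_N` is triangular for the lexicographic order, read off at the reversed tensors
(`eq_or_lex_of_antisymm_apply_rev_ne_zero`).

Action. The iterated coproduct is cut off after finitely many factors, the remaining tail
contributing only the weight of a vacuum. The truncations commute with the `T_k` they contain, and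
they stabilise in the quotient because equal neighbours wedge to zero (`exists_descend`). Every
vector arises from vacua by wedging, so an identity of operators is checked on vacua and carried
along the coproduct (`Fock.end_ext`); for the Serre relations this uses that Serre expressions are
additive on suitably `q`-commuting elements (`serre2_add`, `serre3_add`). Uniqueness follows by the
same induction.

Comparison. A diagram `μ` corresponds to the entries `m - k + μ_k`. Lowering or raising an entry
removes or adds a box, and when the box is not removable or addable the move creates equal
neighbours and gives zero. The exponents agree because (addable minus removable) equals the weight
row by row up to a telescoping correction (`card_filter_addableC_sub`). The Young action is then
obtained by transport, so its relations need no separate verification. -/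

/-- `∑_{k = 1}^d t k`, with the usual sign convention for negative `d`. -/
def signedSum {M : Type*} [AddCommGroup M] (t : ℤ → M) (d : ℤ) : M :=
  if 0 ≤ d then ∑ k ∈ Finset.range d.toNat, t (k + 1)
  else -∑ k ∈ Finset.range (-d).toNat, t (-k)

section SignedSum

variable {M : Type*} [AddCommGroup M]

theorem signedSum_zero (t : ℤ → M) : signedSum t 0 = 0 := by simp [signedSum]

theorem signedSum_natCast (t : ℤ → M) (d : ℕ) :
    signedSum t d = ∑ k ∈ Finset.range d, t (k + 1) := by simp [signedSum]

theorem signedSum_neg_natCast (t : ℤ → M) (d : ℕ) :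
    signedSum t (-d) = -∑ k ∈ Finset.range d, t (-k) := by
  rcases Nat.eq_zero_or_pos d with rfl | hd
  · simp [signedSum]
  · rw [signedSum, if_neg (by omega)]
    simp

theorem signedSum_succ (t : ℤ → M) (d : ℤ) :
    signedSum t (d + 1) = signedSum t d + t (d + 1) := by
  rcases Int.le_total 0 d with h | h
  · obtain ⟨a, rfl⟩ := Int.eq_ofNat_of_zero_le h
    have := signedSum_natCast t (a + 1)
    push_cast at this
    rw [this, Finset.sum_range_succ, signedSum_natCast]
  · rcases eq_or_lt_of_le h with rfl | h
    · simpa [signedSum_zero] using signedSum_natCast t 1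
    · obtain ⟨a, ha⟩ := Int.eq_ofNat_of_zero_le (show 0 ≤ -d - 1 by omega)
      obtain rfl : d = -((a + 1 : ℕ) : ℤ) := by push_cast; omega
      have e : -((a + 1 : ℕ) : ℤ) + 1 = -(a : ℤ) := by push_cast; ring
      rw [e, signedSum_neg_natCast, signedSum_neg_natCast, Finset.sum_range_succ]
      abel

/-- Shifting an entry by `n` in `heckePair` creates a new term at the start of the range, so the
range has to be peeled at `k = 1`, whatever the sign of `d`. -/
theorem signedSum_succ' (t : ℤ → M) (d : ℤ) :
    signedSum t (d + 1) = signedSum (fun k => t (k + 1)) d + t 1 := by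
  induction d using Int.induction_on with
  | zero => rw [signedSum_succ, signedSum_zero, signedSum_zero]; simp
  | succ i ih => rw [signedSum_succ, ih, signedSum_succ (fun k => t (k + 1))]; abel
  | pred i ih =>
    have h1 := signedSum_succ t (-(i : ℤ) - 1 + 1)
    have h2 := signedSum_succ (fun k => t (k + 1)) (-(i : ℤ) - 1)
    have e : (-(i : ℤ) - 1 + 1) = -i := by ring
    simp only [e] at h1 h2 ⊢
    rw [ih, h2] at h1
    have h3 := eq_sub_of_add_eq h1.symm
    rw [h3]
    abel

theorem map_signedSum {M' : Type*} [AddCommGroup M'] (f : M →+ M') (t : ℤ → M) (d : ℤ) :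
    f (signedSum t d) = signedSum (fun k => f (t k)) d := by
  unfold signedSum
  split_ifs <;> simp

theorem signedSum_mem {S : AddSubgroup M} {t : ℤ → M} {d : ℤ}
    (h : ∀ k, (0 < k ∧ k ≤ d) ∨ (d < k ∧ k ≤ 0) → t k ∈ S) : signedSum t d ∈ S := by
  unfold signedSum
  split_ifs with hd
  · refine S.sum_mem fun k hk => h _ ?_
    rw [Finset.mem_range] at hk
    omega
  · refine S.neg_mem (S.sum_mem fun k hk => h _ ?_)
    rw [Finset.mem_range] at hk
    omega

end SignedSum

/-! ### A uniform formula for the Hecke operator -/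

section HeckePair

variable {𝕜 : Type*} [Field 𝕜]

theorem place_zMon (n : ℕ) (i j a b : ℤ) :
    place 𝕜 n i j (zMon 𝕜 a b) = Finsupp.single (i - a * n, j - b * n) 1 := by
  simp [place, zMon]

theorem place_mul_divDiff (n : ℕ) (i j a b : ℤ) :
    place 𝕜 n i j (zMon 𝕜 1 0 * divDiff 𝕜 a b) =
      signedSum (fun k => Finsupp.single (i - (a + k) * n, j - (b - k) * n) 1) (b - a) := by
  unfold divDiff
  split_ifs with h
  · obtain ⟨d, rfl⟩ := Int.le.dest h
    have e : a + (d : ℤ) - a = d := by ring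
    rw [e, signedSum_natCast, Int.toNat_natCast, ← Finset.sum_range_reflect, Finset.mul_sum, map_sum]
    refine Finset.sum_congr rfl fun k hk => ?_
    rw [Finset.mem_range] at hk
    rw [zMon_mul, place_zMon]
    have : ((d - 1 - k : ℕ) : ℤ) = d - 1 - k := by omega
    rw [this]
    congr 3 <;> ring
  · obtain ⟨d, rfl⟩ := Int.le.dest (le_of_not_ge h)
    have e : b - (b + (d : ℤ)) = -d := by ring
    have e' : b + (d : ℤ) - b = d := by ring
    rw [e, e', signedSum_neg_natCast, Int.toNat_natCast, mul_neg, map_neg, Finset.mul_sum, map_sum]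
    congr 1
    refine Finset.sum_congr rfl fun k hk => ?_
    rw [zMon_mul, place_zMon]
    congr 3 <;> ring

theorem place_divDiff (n : ℕ) (i j a b : ℤ) :
    place 𝕜 n i j (divDiff 𝕜 (a + 1) b) =
      signedSum (fun k => Finsupp.single (i - (a + k) * n, j - (b - k) * n) 1) (b - a - 1) := by
  -- Multiplication by `z₁` lowers the first index by `n`; starting from `i + n` undoes this, so the
  -- formula for `z₁ * divDiff` also covers `divDiff` alone.
  have key := place_mul_divDiff (𝕜 := 𝕜) n (i + n) j (a + 1) b
  have h3 : ∀ x, place 𝕜 n (i + n) j (zMon 𝕜 1 0 * x) = place 𝕜 n i j x := by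
    intro x
    induction x using AddMonoidAlgebra.induction_linear with
    | zero => simp
    | add f g hf hg => rw [mul_add, map_add, hf, hg, map_add]
    | single p r =>
      obtain ⟨c, d⟩ := p
      have : (AddMonoidAlgebra.single (c, d) r : AddMonoidAlgebra 𝕜 (ℤ × ℤ)) = r • zMon 𝕜 c d := by
        simp [zMon]
      rw [this, mul_smul_comm, zMon_mul, map_smul, map_smul, place_zMon, place_zMon]
      congr 3 <;> ring
  rw [h3] at key
  rw [key]
  have e : b - (a + 1) = b - a - 1 := by ring
  rw [e]
  congr 1
  funext k
  congr 2
  ring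

/-- The coefficient of the exchanged tensor in `heckePair`, up to sign. -/
def exchangeCoeff (q : 𝕜) (n : ℕ) (l m : ℤ) : 𝕜 := if (n : ℤ) ∣ l - m then 1 else q

/-- With `l = i - a n` and `m = j - b n`, the difference quotient has signed length `b - a` if `i ≥
j` and `b - a - 1` if `i < j`. Both are the floor of `(l - m) / n`, so one signed sum covers the
three cases. The result is invariant under translating `l` and `m` together, which frees later
windows from starting at `1`. -/
theorem heckePair_eq (q : 𝕜) {n : ℕ} (hn : 0 < n) (l m : ℤ) :
    heckePair q n l m = -(exchangeCoeff q n l m) • Finsupp.single (m, l) (1 : 𝕜)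
      - (q ^ 2 - 1) • signedSum (fun k => Finsupp.single (l - n * k, m + n * k) (1 : 𝕜))
          ((l - m) / n) := by
  have hn' : (0 : ℤ) < n := by exact_mod_cast hn
  have hl := vIdx_sub_zExp_mul n l
  have hm := vIdx_sub_zExp_mul n m
  have il : 1 ≤ vIdx n l ∧ vIdx n l ≤ n := by
    have := Int.emod_nonneg (l - 1) hn'.ne'
    have := Int.emod_lt_of_pos (l - 1) hn'
    unfold vIdx; omega
  have im : 1 ≤ vIdx n m ∧ vIdx n m ≤ n := by
    have := Int.emod_nonneg (m - 1) hn'.ne'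
    have := Int.emod_lt_of_pos (m - 1) hn'
    unfold vIdx; omega
  unfold heckePair exchangeCoeff
  generalize vIdx n l = i at *
  generalize vIdx n m = j at *
  generalize zExp n l = a at *
  generalize zExp n m = b at *
  have hlm : l - m = (i - j) + (b - a) * n := by rw [← hl, ← hm]; ring
  have hdvd : (n : ℤ) ∣ l - m ↔ i = j := by
    rw [hlm, Int.dvd_add_left (Dvd.intro_left _ rfl)]
    constructor
    · intro h
      have := Int.eq_zero_of_abs_lt_dvd h (by rw [abs_lt]; omega)
      omega
    · rintro rfl; simp
  have hdiv : (l - m) / n = (i - j) / n + (b - a) := by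
    rw [hlm, Int.add_mul_ediv_right _ _ hn'.ne']
  have hfun : (fun k : ℤ => (Finsupp.single (l - n * k, m + n * k) (1 : 𝕜) : ℤ × ℤ →₀ 𝕜)) =
      fun k => Finsupp.single (i - (a + k) * n, j - (b - k) * n) 1 := by
    funext k
    rw [← hl, ← hm]
    congr 2 <;> ring
  rw [hfun, hdiv, place_divDiff, place_mul_divDiff]
  rcases lt_trichotomy i j with h | h | h
  · have : (i - j) / (n : ℤ) = -1 := by
      rw [Int.ediv_eq_iff_of_pos hn']; omega
    rw [if_pos h, if_neg (by rw [hdvd]; omega), this]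
    congr 3
    ring
  · have : (i - j) / (n : ℤ) = 0 := Int.ediv_eq_zero_of_lt (by omega) (by omega)
    rw [if_neg (by omega), if_pos h, if_pos (by rw [hdvd]; omega), this, zero_add]
    simp
  · have : (i - j) / (n : ℤ) = 0 := Int.ediv_eq_zero_of_lt (by omega) (by omega)
    rw [if_neg (by omega), if_neg (by omega), if_neg (by rw [hdvd]; omega), this, zero_add]

/-- Raising `l` by `n` puts one more term, `u_l ⊗ u_{m+n}`, at the front of the signed sum; the
others are the old terms with second entry raised. This is a Bernstein relation, read on pure
tensors. -/
theorem heckePair_add_left (q : 𝕜) {n : ℕ} (hn : 0 < n) (l m : ℤ) :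
    heckePair q n (l + n) m =
      Finsupp.mapDomain (fun p : ℤ × ℤ => (p.1, p.2 + n)) (heckePair q n l m)
        - (q ^ 2 - 1) • Finsupp.single (l, m + n) 1 := by
  have hn' : (n : ℤ) ≠ 0 := by exact_mod_cast hn.ne'
  have h1 : exchangeCoeff q n (l + n) m = exchangeCoeff q n l m := by
    unfold exchangeCoeff
    simp only [show l + n - m = (l - m) + n by ring, dvd_add_self_right]
  have h2 : (l + n - m) / (n : ℤ) = (l - m) / n + 1 := by
    rw [show l + n - m = (l - m) + 1 * n by ring, Int.add_mul_ediv_right _ _ hn']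
  have h3 := map_signedSum (Finsupp.mapDomain.addMonoidHom (M := 𝕜)
    (fun p : ℤ × ℤ => (p.1, p.2 + (n : ℤ))))
    (fun k => Finsupp.single (l - n * k, m + n * k) (1 : 𝕜)) ((l - m) / n)
  simp only [Finsupp.mapDomain.addMonoidHom_apply, Finsupp.mapDomain_single] at h3
  rw [heckePair_eq q hn, heckePair_eq q hn, h1, h2, signedSum_succ',
    ← Finsupp.lmapDomain_apply 𝕜 𝕜, map_sub, map_smul, map_smul, Finsupp.lmapDomain_apply,
    Finsupp.lmapDomain_apply, Finsupp.mapDomain_single, h3]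
  have e : ∀ k : ℤ, ((l + n - n * (k + 1), m + n * (k + 1)) : ℤ × ℤ) = (l - n * k, m + n * k + n) := by
    intro k
    ext <;> ring
  simp only [e, mul_one, add_sub_cancel_right]
  module

theorem heckePair_add_right (q : 𝕜) {n : ℕ} (hn : 0 < n) (l m : ℤ) :
    heckePair q n l (m + n) =
      Finsupp.mapDomain (fun p : ℤ × ℤ => (p.1 + n, p.2)) (heckePair q n l m)
        + (q ^ 2 - 1) • Finsupp.single (l, m + n) 1 := by
  have hn' : (n : ℤ) ≠ 0 := by exact_mod_cast hn.ne'
  have h1 : exchangeCoeff q n l (m + n) = exchangeCoeff q n l m := by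
    unfold exchangeCoeff
    simp only [show l - (m + n) = (l - m) - n by ring, dvd_sub_self_right]
  have h2 : (l - m) / (n : ℤ) = (l - (m + n)) / n + 1 := by
    rw [← Int.add_mul_ediv_right _ _ hn']
    congr 1
    ring
  have h3 := map_signedSum (Finsupp.mapDomain.addMonoidHom (M := 𝕜)
    (fun p : ℤ × ℤ => (p.1 + (n : ℤ), p.2)))
    (fun k => Finsupp.single (l - n * k, m + n * k) (1 : 𝕜)) ((l - m) / n)
  simp only [Finsupp.mapDomain.addMonoidHom_apply, Finsupp.mapDomain_single] at h3
  rw [heckePair_eq q hn, heckePair_eq q hn, h1,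
    ← Finsupp.lmapDomain_apply 𝕜 𝕜, map_sub, map_smul, map_smul, Finsupp.lmapDomain_apply,
    Finsupp.lmapDomain_apply, Finsupp.mapDomain_single, h3, h2, signedSum_succ']
  have e : ∀ k : ℤ, ((l - n * (k + 1) + n, m + n * (k + 1)) : ℤ × ℤ) = (l - n * k, m + n + n * k) := by
    intro k
    ext <;> ring
  simp only [e, mul_one, sub_add_cancel]
  module

theorem heckePair_self (q : 𝕜) {n : ℕ} (hn : 0 < n) (l : ℤ) :
    heckePair q n l l = -Finsupp.single (l, l) (1 : 𝕜) := by
  rw [heckePair_eq q hn]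
  simp [exchangeCoeff, signedSum_zero]

theorem heckePair_of_lt (q : 𝕜) {n : ℕ} (hn : 0 < n) {l m : ℤ} (h : l < m) (h' : m < l + n) :
    heckePair q n l m =
      -q • Finsupp.single (m, l) (1 : 𝕜) + (q ^ 2 - 1) • Finsupp.single (l, m) 1 := by
  have hn' : (0 : ℤ) < n := by exact_mod_cast hn
  -- A signed sum of length `-1` is minus its term at `k = 0`, here the tensor `u_l ⊗ u_m` itself.
  have h1 : (l - m) / (n : ℤ) = -(1 : ℕ) := by
    rw [Int.ediv_eq_iff_of_pos hn']; push_cast; omega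
  have h2 : ¬ (n : ℤ) ∣ l - m := by
    intro h
    have := Int.eq_zero_of_abs_lt_dvd h (by rw [abs_lt]; omega)
    omega
  rw [heckePair_eq q hn, h1, exchangeCoeff, if_neg h2, signedSum_neg_natCast]
  simp only [Finset.range_one, Finset.sum_singleton, Nat.cast_zero, neg_zero, mul_zero, sub_zero,
    add_zero]
  module

theorem heckePair_of_gt (q : 𝕜) {n : ℕ} (hn : 0 < n) {l m : ℤ} (h : m < l) (h' : l < m + n) :
    heckePair q n l m = -q • Finsupp.single (m, l) (1 : 𝕜) := by
  have hn' : (0 : ℤ) < n := by exact_mod_cast hn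
  have h1 : (l - m) / (n : ℤ) = 0 := Int.ediv_eq_zero_of_lt (by omega) (by omega)
  have h2 : ¬ (n : ℤ) ∣ l - m := by
    intro h
    have := Int.eq_zero_of_abs_lt_dvd h (by rw [abs_lt]; omega)
    omega
  rw [heckePair_eq q hn, h1, exchangeCoeff, if_neg h2, signedSum_zero]
  simp

theorem signedSum_mem_supported {α : Type*} {S : Set α} {f : ℤ → α} {d : ℤ}
    (h : ∀ k, (0 < k ∧ k ≤ d) ∨ (d < k ∧ k ≤ 0) → f k ∈ S) :
    signedSum (fun k => Finsupp.single (f k) (1 : 𝕜)) d ∈ Finsupp.supported 𝕜 𝕜 S :=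
  signedSum_mem (S := (Finsupp.supported 𝕜 𝕜 S).toAddSubgroup)
    fun k hk => Finsupp.single_mem_supported 𝕜 _ (h k hk)

/-- All terms of `(u_l ⊗ u_m) T` have entries between `l` and `m`. -/
theorem heckePair_mem_supported (q : 𝕜) {n : ℕ} (hn : 0 < n) (l m : ℤ) :
    heckePair q n l m ∈ Finsupp.supported 𝕜 𝕜
      {p : ℤ × ℤ | min l m ≤ p.1 ∧ p.1 ≤ max l m ∧ min l m ≤ p.2 ∧ p.2 ≤ max l m} := by
  have hn' : (0 : ℤ) < n := by exact_mod_cast hn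
  rw [heckePair_eq q hn]
  refine Submodule.sub_mem _ (Submodule.smul_mem _ _ (Finsupp.single_mem_supported 𝕜 _ ?_))
    (Submodule.smul_mem _ _ (signedSum_mem_supported fun k hk => ?_))
  · simp
  · have h1 := Int.ediv_mul_le (l - m) hn'.ne'
    have h2 := Int.lt_ediv_add_one_mul_self (l - m) hn'
    generalize (l - m) / (n : ℤ) = d at *
    simp only [Set.mem_ofPred_eq]
    rcases hk with ⟨hk1, hk2⟩ | ⟨hk1, hk2⟩
    · have h3 : (n : ℤ) * k ≤ d * n := by nlinarith
      have h4 : 0 ≤ (n : ℤ) * k := by positivity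
      rw [min_eq_right (by omega), max_eq_left (by omega)]
      omega
    · have h3 : (d + 1) * n ≤ (n : ℤ) * k := by nlinarith
      have h4 : (n : ℤ) * k ≤ 0 := by nlinarith
      rw [min_eq_left (by omega), max_eq_right (by omega)]
      omega

/-- For `l > m`, the leading term of `(u_l ⊗ u_m) T` is a multiple of `u_m ⊗ u_l`; all other terms
have entries strictly between `m` and `l`. -/
theorem exists_heckePair_of_gt {q : 𝕜} (hq : q ≠ 0) {n : ℕ} (hn : 0 < n) {l m : ℤ} (h : m < l) :
    ∃ c : 𝕜, c ≠ 0 ∧ heckePair q n l m - c • Finsupp.single (m, l) 1 ∈ Finsupp.supported 𝕜 𝕜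
      {p : ℤ × ℤ | m < p.1 ∧ p.1 < l ∧ m < p.2 ∧ p.2 < l ∧ p.1 + p.2 = l + m} := by
  have hn' : (0 : ℤ) < n := by exact_mod_cast hn
  have h1 := Int.ediv_mul_le (l - m) hn'.ne'
  have h2 := Int.lt_ediv_add_one_mul_self (l - m) hn'
  have h0 : 0 ≤ (l - m) / (n : ℤ) := Int.ediv_nonneg (by omega) hn'.le
  rw [heckePair_eq q hn, exchangeCoeff]
  split_ifs with hd
  -- If `n` divides `l - m`, the last term of the sum is again `u_m ⊗ u_l`, so the leading
  -- coefficient is `-1 - (q ^ 2 - 1)`.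
  · refine ⟨-q ^ 2, by simpa, ?_⟩
    have h3 := Int.ediv_mul_cancel hd
    obtain ⟨e, he⟩ : ∃ e, (l - m) / (n : ℤ) = e + 1 := ⟨(l - m) / (n : ℤ) - 1, by ring⟩
    rw [he, signedSum_succ]
    rw [he] at h3
    have h4 : l - n * (e + 1) = m := by linarith
    have h5 : m + n * (e + 1) = l := by linarith
    rw [h4, h5]
    have : ∀ x y : ℤ × ℤ →₀ 𝕜, (-1 : 𝕜) • x - (q ^ 2 - 1) • (y + x) - -q ^ 2 • x
        = -(q ^ 2 - 1) • y := by intro x y; module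
    rw [this]
    refine Submodule.smul_mem _ _ (signedSum_mem_supported fun k hk => ?_)
    have he0 : 0 ≤ e := by
      by_contra hc
      have : e + 1 ≤ 0 := by omega
      nlinarith
    have h6 : (n : ℤ) * k ≤ e * n := by
      have : k ≤ e := by omega
      nlinarith
    have h7 : 0 < (n : ℤ) * k := by
      have : 0 < k := by omega
      positivity
    have h8 : (e + 1) * (n : ℤ) = e * n + n := by ring
    simp only [Set.mem_ofPred_eq]
    omega
  · refine ⟨-q, by simpa, ?_⟩
    have : ∀ x y : ℤ × ℤ →₀ 𝕜, -q • x - (q ^ 2 - 1) • y - -q • x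
        = -(q ^ 2 - 1) • y := by intro x y; module
    rw [this]
    refine Submodule.smul_mem _ _ (signedSum_mem_supported fun k hk => ?_)
    have h6 : (n : ℤ) * k ≤ (l - m) / n * n := by
      have : k ≤ (l - m) / n := by omega
      nlinarith
    have h7 : 0 < (n : ℤ) * k := by
      have : 0 < k := by omega
      positivity
    have h8 : (l - m) / n * (n : ℤ) ≠ l - m := fun h => hd (Dvd.intro_left _ h)
    simp only [Set.mem_ofPred_eq]
    omega

end HeckePair

/-! ### The Hecke relations on semi-infinite tensors -/

namespace Seq

variable {m : ℤ}

theorem ext {s t : Seq m} (h : ∀ k, s.1 k = t.1 k) : s = t := Subtype.ext (funext h)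

/-- Replace the entry in position `i`. -/
def upd (s : Seq m) (i : ℕ) (l : ℤ) : Seq m :=
  ⟨Function.update s.1 i l, by
    obtain ⟨N, hN⟩ := s.2
    refine ⟨max N (i + 1), fun k hk => ?_⟩
    rw [Function.update_of_ne (by omega)]
    exact hN k (by omega)⟩

theorem upd_apply (s : Seq m) (i : ℕ) (l : ℤ) (k : ℕ) :
    (s.upd i l).1 k = if k = i then l else s.1 k := by
  simp [upd, Function.update_apply]

theorem replace_apply (s : Seq m) (i : ℕ) (p : ℤ × ℤ) (k : ℕ) :
    (s.replace i p).1 k = if k = i + 1 then p.2 else if k = i then p.1 else s.1 k := by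
  simp [replace, Function.update_apply]

/-- Exchange the entries in positions `i` and `i + 1`. -/
def swap (i : ℕ) (s : Seq m) : Seq m := s.replace i (s.1 (i + 1), s.1 i)

theorem swap_apply (s : Seq m) (i : ℕ) (k : ℕ) :
    (s.swap i).1 k = if k = i + 1 then s.1 i else if k = i then s.1 (i + 1) else s.1 k := by
  simp [swap, replace_apply]

theorem upd_self (s : Seq m) (i : ℕ) : s.upd i (s.1 i) = s :=
  ext fun k => by rw [upd_apply]; split_ifs with h <;> simp [*]

theorem replace_self (s : Seq m) (i : ℕ) : s.replace i (s.1 i, s.1 (i + 1)) = s :=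
  ext fun k => by rw [replace_apply]; split_ifs with h h' <;> simp [*]

theorem upd_upd (s : Seq m) (i : ℕ) (a b : ℤ) : (s.upd i a).upd i b = s.upd i b :=
  ext fun k => by simp only [upd_apply]; split_ifs <;> rfl

theorem swap_swap (s : Seq m) (i : ℕ) : (s.swap i).swap i = s :=
  ext fun k => by
    rcases eq_or_ne k (i + 1) with rfl | h
    · simp [swap_apply]
    · rcases eq_or_ne k i with rfl | h'
      · simp [swap_apply]
      · simp [swap_apply, h, h']

end Seq

section Hecke

variable {𝕜 : Type*} [Field 𝕜] {m : ℤ}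

/-- Shift the entry in position `k` by `n`, i.e. multiply the `k`-th factor by `z⁻¹`. -/
def posShift (𝕜 : Type*) [Field 𝕜] (n : ℕ) (m : ℤ) (k : ℕ) : Module.End 𝕜 (Tens 𝕜 m) :=
  Finsupp.lmapDomain 𝕜 𝕜 fun s : Seq m => s.upd k (s.1 k + n)

theorem posShift_single (n : ℕ) (k : ℕ) (s : Seq m) (a : 𝕜) :
    posShift 𝕜 n m k (Finsupp.single s a) = Finsupp.single (s.upd k (s.1 k + n)) a := by
  simp [posShift]

theorem posShift_injective (n : ℕ) (k : ℕ) : Function.Injective (posShift 𝕜 n m k) := by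
  refine Finsupp.mapDomain_injective fun s t h => Seq.ext fun j => ?_
  have h1 := congrArg (fun s : Seq m => s.1 j) h
  have h2 := congrArg (fun s : Seq m => s.1 k) h
  simp only [Seq.upd_apply, if_true] at h1 h2
  split_ifs at h1 with h
  · subst h; omega
  · exact h1

/-- The Hecke operator `T_k`, as an element of the endomorphism ring. -/
def hecke (q : 𝕜) (n : ℕ) (m : ℤ) (k : ℕ) : Module.End 𝕜 (Tens 𝕜 m) := heckeT q n m k

theorem hecke_single (q : 𝕜) (n : ℕ) (k : ℕ) (s : Seq m) :
    hecke q n m k (Finsupp.single s 1) =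
      Finsupp.mapDomain (fun p => s.replace k p) (heckePair q n (s.1 k) (s.1 (k + 1))) := by
  simp [hecke, heckeT]

theorem End_ext {M : Type*} [AddCommGroup M] [Module 𝕜 M] {f g : Tens 𝕜 m →ₗ[𝕜] M}
    (h : ∀ s, f (Finsupp.single s 1) = g (Finsupp.single s 1)) : f = g :=
  Finsupp.lhom_ext' fun s => LinearMap.ext_ring (h s)

/-- With `hecke_mul_posShift_succ` and `hecke_mul_posShift_of_ne`, these are the Bernstein
relations: `T_k` moves past a shift at the cost of a term free of `T_k`. All reductions to a window
depend on them. -/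
theorem hecke_mul_posShift (q : 𝕜) {n : ℕ} (hn : 0 < n) (k : ℕ) :
    hecke q n m k * posShift 𝕜 n m k =
      posShift 𝕜 n m (k + 1) * hecke q n m k - (q ^ 2 - 1) • posShift 𝕜 n m (k + 1) := by
  refine End_ext fun s => ?_
  rw [Module.End.mul_apply, LinearMap.sub_apply, Module.End.mul_apply, LinearMap.smul_apply,
    posShift_single, posShift_single, hecke_single, hecke_single, Seq.upd_apply, Seq.upd_apply,
    if_pos rfl, if_neg (by omega), heckePair_add_left q hn, posShift,
    ← Finsupp.lmapDomain_apply 𝕜 𝕜, map_sub, map_smul, Finsupp.lmapDomain_apply,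
    Finsupp.lmapDomain_apply, Finsupp.lmapDomain_apply, Finsupp.mapDomain_single,
    ← Finsupp.mapDomain_comp, ← Finsupp.mapDomain_comp]
  refine congrArg₂ (· - ·) (congrArg (fun f => Finsupp.mapDomain f _) (funext fun p => ?_))
    (congrArg (fun t : Seq m => (q ^ 2 - 1) • Finsupp.single t (1 : 𝕜)) ?_)
  all_goals
    refine Seq.ext fun i => ?_
    simp only [Function.comp, Seq.upd_apply, Seq.replace_apply]
    split_ifs <;> simp_all

theorem hecke_mul_posShift_succ (q : 𝕜) {n : ℕ} (hn : 0 < n) (k : ℕ) :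
    hecke q n m k * posShift 𝕜 n m (k + 1) =
      posShift 𝕜 n m k * hecke q n m k + (q ^ 2 - 1) • posShift 𝕜 n m (k + 1) := by
  refine End_ext fun s => ?_
  rw [Module.End.mul_apply, LinearMap.add_apply, Module.End.mul_apply, LinearMap.smul_apply,
    posShift_single, hecke_single, hecke_single, Seq.upd_apply, Seq.upd_apply,
    if_pos rfl, if_neg (by omega), heckePair_add_right q hn, posShift,
    ← Finsupp.lmapDomain_apply 𝕜 𝕜, map_add, map_smul, Finsupp.lmapDomain_apply,
    Finsupp.lmapDomain_apply, Finsupp.lmapDomain_apply, Finsupp.mapDomain_single,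
    ← Finsupp.mapDomain_comp, ← Finsupp.mapDomain_comp]
  refine congrArg₂ (· + ·) (congrArg (fun f => Finsupp.mapDomain f _) (funext fun p => ?_))
    (congrArg (fun t : Seq m => (q ^ 2 - 1) • Finsupp.single t (1 : 𝕜)) ?_)
  all_goals
    refine Seq.ext fun i => ?_
    simp only [Function.comp, Seq.upd_apply, Seq.replace_apply]
    split_ifs <;> first | rfl | omega | simp [*] at *

theorem hecke_mul_posShift_of_ne (q : 𝕜) {n : ℕ} {k j : ℕ} (h : j ≠ k) (h' : j ≠ k + 1) :
    hecke q n m k * posShift 𝕜 n m j =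
      posShift 𝕜 n m j * hecke q n m k := by
  refine End_ext fun s => ?_
  rw [Module.End.mul_apply, Module.End.mul_apply,
    posShift_single, hecke_single, hecke_single, Seq.upd_apply, Seq.upd_apply,
    if_neg h.symm, if_neg h'.symm, posShift, Finsupp.lmapDomain_apply, ← Finsupp.mapDomain_comp]
  congr 1
  funext p
  refine Seq.ext fun i => ?_
  simp only [Function.comp, Seq.upd_apply, Seq.replace_apply]
  split_ifs <;> simp_all

/-! #### Reduction to entries in a window of length `n` -/

theorem Seq.upd_shift_iff {n : ℕ} {P : Seq m → Prop} {k : ℕ}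
    (h : ∀ s, P (s.upd k (s.1 k + n)) ↔ P s) (s : Seq m) (z : ℤ) :
    P (s.upd k (s.1 k + n * z)) ↔ P s := by
  induction z using Int.induction_on with
  | zero => simp [Seq.upd_self]
  | succ i ih =>
    have := h (s.upd k (s.1 k + n * i))
    rw [Seq.upd_upd, Seq.upd_apply, if_pos rfl] at this
    rw [show s.1 k + n * ((i : ℤ) + 1) = s.1 k + n * i + n by ring, this, ih]
  | pred i ih =>
    have := h (s.upd k (s.1 k + n * (-i - 1)))
    rw [Seq.upd_upd, Seq.upd_apply, if_pos rfl,
      show s.1 k + n * (-(i : ℤ) - 1) + n = s.1 k + n * (-i) by ring, ih] at this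
    exact this.symm

/-- Every entry can be carried into the window by multiples of `n` without affecting `P`; the
positions in `A` are treated one at a time. -/
theorem Seq.forall_of_window {n : ℕ} (hn : 0 < n) {P : Seq m → Prop} (c : ℤ) (A : Finset ℕ)
    (h : ∀ k ∈ A, ∀ s, P (s.upd k (s.1 k + n)) ↔ P s)
    (hw : ∀ s : Seq m, (∀ k ∈ A, c ≤ s.1 k ∧ s.1 k < c + n) → P s) (s : Seq m) : P s := by
  classical
  have hn' : (0 : ℤ) < n := by exact_mod_cast hn
  induction A using Finset.induction_on generalizing P s with
  | empty => exact hw s (by simp)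
  | insert k A hk ih =>
    -- The window condition at `k` becomes a hypothesis of the predicate; shifts at other positions
    -- leave it untouched, so the induction hypothesis applies to `Q`.
    let Q : Seq m → Prop := fun s => (c ≤ s.1 k ∧ s.1 k < c + n) → P s
    have hQ : ∀ s, Q s := by
      refine ih (fun j hj s => ?_) fun s hs hsk => hw s fun j hj => ?_
      · have : k ≠ j := fun e => hk (e ▸ hj)
        simp only [Seq.upd_apply, if_neg this, h j (Finset.mem_insert_of_mem hj)]
      · rcases Finset.mem_insert.1 hj with rfl | hj
        · exact hsk
        · exact hs j hj
    -- This shift replaces `s k` by `c` plus the remainder of `s k - c` modulo `n`.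
    have h1 := (Seq.upd_shift_iff (h k (Finset.mem_insert_self k A)) s (-((s.1 k - c) / n))).1
    refine h1 (hQ _ ?_)
    rw [Seq.upd_apply, if_pos rfl]
    have h2 := Int.ediv_mul_le (s.1 k - c) hn'.ne'
    have h3 := Int.lt_ediv_add_one_mul_self (s.1 k - c) hn'
    constructor <;> nlinarith

/-- Because `posShift` is injective, `X Y_k = Y_j X` implies that `X` kills a tensor if and only if
it kills the shifted one. The index `j` may differ from `k`, as happens for the braid defect and for
commutators with `T_k`. -/
theorem eq_zero_of_window {n : ℕ} (hn : 0 < n) (X : Module.End 𝕜 (Tens 𝕜 m)) (c : ℤ)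
    (A : Finset ℕ) (h : ∀ k ∈ A, ∃ j, X * posShift 𝕜 n m k = posShift 𝕜 n m j * X)
    (hw : ∀ s : Seq m, (∀ k ∈ A, c ≤ s.1 k ∧ s.1 k < c + n) → X (Finsupp.single s 1) = 0) :
    X = 0 := by
  refine End_ext fun s => ?_
  refine Seq.forall_of_window hn (P := fun s => X (Finsupp.single s 1) = 0) c A
    (fun k hk s => ?_) hw s
  obtain ⟨j, hj⟩ := h k hk
  have := LinearMap.congr_fun hj (Finsupp.single s 1)
  rw [Module.End.mul_apply, Module.End.mul_apply, posShift_single] at this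
  rw [this, map_eq_zero_iff _ (posShift_injective n j)]

/-- In a window of length `n` the floor of `(a - b) / n` is `0` or `-1`, so the affine operator
becomes the finite Hecke operator. The start `c` is free; for the Chevalley generators it will be a
representative of the residue `i`. -/
theorem hecke_replace (q : 𝕜) {n : ℕ} (hn : 0 < n) (k : ℕ) (s : Seq m) (c a b : ℤ)
    (ha : c ≤ a) (ha' : a < c + n) (hb : c ≤ b) (hb' : b < c + n) :
    hecke q n m k (Finsupp.single (s.replace k (a, b)) 1) =
      if a < b then -q • Finsupp.single (s.replace k (b, a)) 1 +
        (q ^ 2 - 1) • Finsupp.single (s.replace k (a, b)) 1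
      else if a = b then -Finsupp.single (s.replace k (a, b)) 1
      else -q • Finsupp.single (s.replace k (b, a)) 1 := by
  have hr : ∀ p p', (s.replace k p).replace k p' = s.replace k p' := fun p p' =>
    Seq.ext fun i => by simp only [Seq.replace_apply]; split_ifs <;> rfl
  rw [hecke_single]
  simp only [Seq.replace_apply, hr, if_true, if_neg (Nat.succ_ne_self k).symm]
  split_ifs with h1 h2
  · rw [heckePair_of_lt q hn h1 (by omega), ← Finsupp.lmapDomain_apply 𝕜 𝕜,
      map_add, map_smul, map_smul]
    simp
  · subst h2
    rw [heckePair_self q hn, ← Finsupp.lmapDomain_apply 𝕜 𝕜, map_neg]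
    simp
  · rw [heckePair_of_gt q hn (by omega) (by omega), ← Finsupp.lmapDomain_apply 𝕜 𝕜, map_smul]
    simp


/-! ### Consequences of the Bernstein relations in an abstract algebra -/

section Algebra

variable {A : Type*} [Ring A] [Algebra 𝕜 A] {c d : 𝕜} {T Y Y' : A}

/-- Moving `Y` past `T` twice turns it into `Y'` and back; the corrections cancel against the one
from `c • T`, whatever `d` is. -/
theorem quadratic_mul_shift (h : T * Y = Y' * T - c • Y') (h' : T * Y' = Y * T + c • Y') :
    (T * T - (c • T + d • 1)) * Y = Y * (T * T - (c • T + d • 1)) := by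
  have a := fun x => congrArg (· * x) h
  have a' := fun x => congrArg (· * x) h'
  simp only [sub_mul, add_mul, smul_mul_assoc, mul_assoc] at a a'
  simp only [sub_mul, add_mul, smul_mul_assoc, mul_assoc, h, h', a', mul_sub, mul_smul_comm,
    one_mul, mul_add, mul_one]
  module

theorem quadratic_mul_shift_succ (h : T * Y = Y' * T - c • Y') (h' : T * Y' = Y * T + c • Y') :
    (T * T - (c • T + d • 1)) * Y' = Y' * (T * T - (c • T + d • 1)) := by
  have a := fun x => congrArg (· * x) h
  have a' := fun x => congrArg (· * x) h'
  simp only [sub_mul, add_mul, smul_mul_assoc, mul_assoc] at a a'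
  simp only [sub_mul, add_mul, smul_mul_assoc, mul_assoc, h', a, mul_sub, mul_smul_comm,
    one_mul, mul_add, mul_one]
  module

/-- The braid defect reverses the three shifts like the longest permutation. The lower-order terms
cancel with the help of the quadratic relations, which therefore have to be established before the
braid relation. -/
theorem braid_mul_shift {T₁ T₂ Y₁ Y₂ Y₃ : A}
    (h11 : T₁ * Y₁ = Y₂ * T₁ - c • Y₂) (h12 : T₁ * Y₂ = Y₁ * T₁ + c • Y₂) (h13 : T₁ * Y₃ = Y₃ * T₁)
    (h21 : T₂ * Y₁ = Y₁ * T₂) (h22 : T₂ * Y₂ = Y₃ * T₂ - c • Y₃) (h23 : T₂ * Y₃ = Y₂ * T₂ + c • Y₃)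
    (hq1 : T₁ * T₁ = c • T₁ + d • 1) (hq2 : T₂ * T₂ = c • T₂ + d • 1) :
    (T₁ * T₂ * T₁ - T₂ * T₁ * T₂) * Y₁ = Y₃ * (T₁ * T₂ * T₁ - T₂ * T₁ * T₂) ∧
    (T₁ * T₂ * T₁ - T₂ * T₁ * T₂) * Y₂ = Y₂ * (T₁ * T₂ * T₁ - T₂ * T₁ * T₂) ∧
    (T₁ * T₂ * T₁ - T₂ * T₁ * T₂) * Y₃ = Y₁ * (T₁ * T₂ * T₁ - T₂ * T₁ * T₂) := by
  have a11 := fun x => congrArg (· * x) h11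
  have a12 := fun x => congrArg (· * x) h12
  have a13 := fun x => congrArg (· * x) h13
  have a21 := fun x => congrArg (· * x) h21
  have a22 := fun x => congrArg (· * x) h22
  have a23 := fun x => congrArg (· * x) h23
  have aq1 := fun x => congrArg (· * x) hq1
  have aq2 := fun x => congrArg (· * x) hq2
  simp only [sub_mul, add_mul, smul_mul_assoc, mul_assoc, one_mul]
    at a11 a12 a13 a21 a22 a23 aq1 aq2
  refine ⟨?_, ?_, ?_⟩ <;>
  · simp only [sub_mul, mul_assoc, mul_sub, mul_smul_comm,
      mul_add, mul_one, h11, h12, h13, h21, h22, h23, a11, a12, a13, a21, a22, a23, hq1, hq2]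
    module

theorem commutator_mul_shift {X : A} (h : T * Y = Y' * T - c • Y') (hX : X * Y = Y * X)
    (hX' : X * Y' = Y' * X) : (T * X - X * T) * Y = Y' * (T * X - X * T) := by
  rw [sub_mul, mul_assoc, mul_assoc, hX, h, ← mul_assoc T, h, mul_sub, mul_sub, ← mul_assoc X,
    hX', sub_mul, mul_smul_comm, hX', smul_mul_assoc, mul_assoc, mul_assoc]
  abel

theorem commutator_mul_shift_succ {X : A} (h : T * Y' = Y * T + c • Y') (hX : X * Y = Y * X)
    (hX' : X * Y' = Y' * X) : (T * X - X * T) * Y' = Y * (T * X - X * T) := by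
  rw [sub_mul, mul_assoc, mul_assoc, hX', h, ← mul_assoc T, h, mul_sub, mul_add, ← mul_assoc X,
    hX, add_mul, mul_smul_comm, hX', smul_mul_assoc, mul_assoc, mul_assoc]
  abel

end Algebra

theorem hecke_quadratic (q : 𝕜) {n : ℕ} (hn : 0 < n) (k : ℕ) :
    hecke q n m k * hecke q n m k =
      (q ^ 2 - 1) • hecke q n m k + q ^ 2 • (1 : Module.End 𝕜 (Tens 𝕜 m)) := by
  have h1 := hecke_mul_posShift (m := m) q hn k
  have h2 := hecke_mul_posShift_succ (m := m) q hn k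
  refine sub_eq_zero.1 ?_
  refine eq_zero_of_window hn _ 0 {k, k + 1} (fun j hj => ?_) fun s hs => ?_
  · rw [Finset.mem_insert, Finset.mem_singleton] at hj
    rcases hj with rfl | rfl
    · exact ⟨_, quadratic_mul_shift (A := Module.End 𝕜 (Tens 𝕜 m)) h1 h2⟩
    · exact ⟨_, quadratic_mul_shift_succ (A := Module.End 𝕜 (Tens 𝕜 m)) h1 h2⟩
  · obtain ⟨wa, wa'⟩ := hs k (by simp)
    obtain ⟨wb, wb'⟩ := hs (k + 1) (by simp)
    have e := s.replace_self k
    generalize s.1 k = a at *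
    generalize s.1 (k + 1) = b at *
    have h1 := hecke_replace q hn k s 0 a b wa wa' wb wb'
    have h2 := hecke_replace q hn k s 0 b a wb wb' wa wa'
    rw [← e]
    simp only [LinearMap.sub_apply, LinearMap.add_apply, Module.End.mul_apply,
      LinearMap.smul_apply, Module.End.one_apply]
    rcases lt_trichotomy a b with h | h | h
    · rw [if_pos h] at h1
      rw [if_neg h.not_gt, if_neg h.ne'] at h2
      rw [h1, map_add, map_smul, map_smul, h1, h2]
      module
    · rw [if_neg h.not_lt, if_pos h] at h1
      rw [h1, map_neg, h1]
      module
    · rw [if_neg h.not_gt, if_neg h.ne'] at h1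
      rw [if_pos h] at h2
      rw [h1, map_smul, h2]
      module

theorem hecke_braid (q : 𝕜) {n : ℕ} (hn : 0 < n) (k : ℕ) :
    hecke q n m k * hecke q n m (k + 1) * hecke q n m k =
      hecke q n m (k + 1) * hecke q n m k * hecke q n m (k + 1) := by
  obtain ⟨h1, h2, h3⟩ := braid_mul_shift (A := Module.End 𝕜 (Tens 𝕜 m))
    (hecke_mul_posShift (m := m) q hn k)
    (hecke_mul_posShift_succ (m := m) q hn k)
    (hecke_mul_posShift_of_ne (m := m) q (n := n) (k := k) (j := k + 1 + 1)
      (by omega) (by omega))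
    (hecke_mul_posShift_of_ne (m := m) q (n := n) (k := k + 1) (j := k)
      (by omega) (by omega))
    (hecke_mul_posShift (m := m) q hn (k + 1)) (hecke_mul_posShift_succ (m := m) q hn (k + 1))
    (hecke_quadratic (m := m) q hn k) (hecke_quadratic (m := m) q hn (k + 1))
  refine sub_eq_zero.1 ?_
  refine eq_zero_of_window hn _ 0 {k, k + 1, k + 1 + 1} (fun j hj => ?_) fun s hs => ?_
  · simp only [Finset.mem_insert, Finset.mem_singleton] at hj
    rcases hj with rfl | rfl | rfl
    exacts [⟨_, h1⟩, ⟨_, h2⟩, ⟨_, h3⟩]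
  · let e : ℤ → ℤ → ℤ → Tens 𝕜 m := fun a b c =>
      Finsupp.single (((s.upd k a).upd (k + 1) b).upd (k + 1 + 1) c) 1
    have e1 : ∀ a b c, ((s.upd k a).upd (k + 1) b).upd (k + 1 + 1) c =
        (s.upd (k + 1 + 1) c).replace k (a, b) := fun a b c => Seq.ext fun i => by
      simp only [Seq.replace_apply, Seq.upd_apply]; split_ifs <;> first | rfl | omega
    have e2 : ∀ a b c, ((s.upd k a).upd (k + 1) b).upd (k + 1 + 1) c =
        (s.upd k a).replace (k + 1) (b, c) := fun a b c => Seq.ext fun i => by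
      simp only [Seq.replace_apply, Seq.upd_apply]
    have hs0 : Finsupp.single s 1 = e (s.1 k) (s.1 (k + 1)) (s.1 (k + 1 + 1)) := by
      simp only [e]
      congr 1
      refine Seq.ext fun i => ?_
      simp only [Seq.upd_apply]; split_ifs <;> simp [*]
    have H1 : ∀ a b c : ℤ, (0 ≤ a ∧ a < 0 + n) → (0 ≤ b ∧ b < 0 + n) → hecke q n m k (e a b c) =
        if a < b then -q • e b a c + (q ^ 2 - 1) • e a b c else if a = b then - e a b c
        else -q • e b a c := by
      intro a b c ha hb
      simp only [e, e1]
      exact hecke_replace q hn k _ 0 a b ha.1 ha.2 hb.1 hb.2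
    have H2 : ∀ a b c : ℤ, (0 ≤ b ∧ b < 0 + n) → (0 ≤ c ∧ c < 0 + n) →
        hecke q n m (k + 1) (e a b c) =
        if b < c then -q • e a c b + (q ^ 2 - 1) • e a b c else if b = c then - e a b c
        else -q • e a c b := by
      intro a b c ha hb
      simp only [e, e2]
      exact hecke_replace q hn (k + 1) _ 0 b c ha.1 ha.2 hb.1 hb.2
    have wa := hs k (by simp)
    have wb := hs (k + 1) (by simp)
    have wc := hs (k + 1 + 1) (by simp)
    rw [hs0]
    clear_value e
    clear hs0 e1 e2 hs h1 h2 h3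
    generalize s.1 k = a at *
    generalize s.1 (k + 1) = b at *
    generalize s.1 (k + 1 + 1) = c at *
    generalize hecke q n m k = T₁ at *
    generalize hecke q n m (k + 1) = T₂ at *
    rw [LinearMap.sub_apply, Module.End.mul_apply, Module.End.mul_apply, Module.End.mul_apply,
      Module.End.mul_apply]
    have tri : ∀ x y : ℤ, (x < y ∧ ¬ y < x ∧ ¬ x = y ∧ ¬ y = x) ∨ x = y ∨
        (y < x ∧ ¬ x < y ∧ ¬ x = y ∧ ¬ y = x) := fun x y => by omega
    -- The consistent cases are the thirteen weak orderings of three entries; `omega` discards the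
    -- others.
    rcases tri a b with ab | ab | ab <;> rcases tri b c with bc | bc | bc <;>
    rcases tri a c with ac | ac | ac <;>
    first
    | omega
    | simp only [H1 _ _ _ wa wb, H1 _ _ _ wa wc, H1 _ _ _ wb wa, H1 _ _ _ wb wb, H1 _ _ _ wb wc,
        H1 _ _ _ wc wa, H1 _ _ _ wc wb, H1 _ _ _ wc wc, H2 _ _ _ wa wb, H2 _ _ _ wa wc,
        H2 _ _ _ wb wb, H2 _ _ _ wb wc, H2 _ _ _ wc wb, H2 _ _ _ wc wc, ab, bc, ac,
        lt_irrefl, if_true, if_false, map_add, map_smul, map_neg]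
      module

/-! #### Operators commuting with the Hecke operators -/

/-- If `Y` commutes with both shifts, the corrections in the Bernstein relations drop out of the
commutator with `T_k`, which then exchanges the two shifts exactly and need only be tested on a
window. -/
theorem hecke_commute_of_window (q : 𝕜) {n : ℕ} (hn : 0 < n) (k : ℕ) (Y : Module.End 𝕜 (Tens 𝕜 m))
    (h1 : Commute Y (posShift 𝕜 n m k)) (h2 : Commute Y (posShift 𝕜 n m (k + 1))) (c : ℤ)
    (hw : ∀ s : Seq m, (c ≤ s.1 k ∧ s.1 k < c + n) → (c ≤ s.1 (k + 1) ∧ s.1 (k + 1) < c + n) →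
      hecke q n m k (Y (Finsupp.single s 1)) = Y (hecke q n m k (Finsupp.single s 1))) :
    Commute (hecke q n m k) Y := by
  have e1 := hecke_mul_posShift (m := m) q hn k
  have e2 := hecke_mul_posShift_succ (m := m) q hn k
  have h1' := h1.eq
  have h2' := h2.eq
  refine sub_eq_zero.1 ?_
  refine eq_zero_of_window hn _ c {k, k + 1} (fun j hj => ?_) fun s hs => ?_
  · rw [Finset.mem_insert, Finset.mem_singleton] at hj
    rcases hj with rfl | rfl
    · exact ⟨_, commutator_mul_shift (A := Module.End 𝕜 (Tens 𝕜 m)) e1 h1' h2'⟩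
    · exact ⟨_, commutator_mul_shift_succ (A := Module.End 𝕜 (Tens 𝕜 m)) e2 h1' h2'⟩
  · rw [LinearMap.sub_apply, Module.End.mul_apply, Module.End.mul_apply,
      hw s (hs k (by simp)) (hs (k + 1) (by simp)), sub_self]

/-- The point is uniformity: `α` and `β` depend on the two entries only, so `T_k` acts by one
formula on all terms that agree in positions `k` and `k + 1`. -/
theorem exists_hecke_window (q : 𝕜) {n : ℕ} (hn : 0 < n) (k : ℕ) (c a b : ℤ)
    (ha : c ≤ a ∧ a < c + n) (hb : c ≤ b ∧ b < c + n) :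
    ∃ α β : 𝕜, ∀ t : Seq m, t.1 k = a → t.1 (k + 1) = b →
      hecke q n m k (Finsupp.single t 1) =
        α • Finsupp.single (t.swap k) 1 + β • Finsupp.single t 1 := by
  have H : ∀ t : Seq m, t.1 k = a → t.1 (k + 1) = b → _ := fun t h1 h2 => by
    have := hecke_replace (m := m) q hn k t c a b ha.1 ha.2 hb.1 hb.2
    rw [← h1, ← h2, Seq.replace_self, ← Seq.swap, h1, h2] at this
    exact this
  rcases lt_trichotomy a b with h | h | h
  · exact ⟨-q, q ^ 2 - 1, fun t h1 h2 => by rw [H t h1 h2, if_pos h]⟩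
  · exact ⟨0, -1, fun t h1 h2 => by rw [H t h1 h2, if_neg h.not_lt, if_pos h]; module⟩
  · exact ⟨-q, 0, fun t h1 h2 => by rw [H t h1 h2, if_neg h.not_gt, if_neg h.ne']; module⟩

/-- An operator that does not involve the factors `k` and `k + 1` commutes with `T_k`. -/
theorem hecke_commute_of_away (q : 𝕜) {n : ℕ} (hn : 0 < n) (k : ℕ) (Y : Module.End 𝕜 (Tens 𝕜 m))
    (h1 : Commute Y (posShift 𝕜 n m k)) (h2 : Commute Y (posShift 𝕜 n m (k + 1)))
    (hs : ∀ s : Seq m, Y (Finsupp.single s 1) ∈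
      Finsupp.supported 𝕜 𝕜 {t : Seq m | t.1 k = s.1 k ∧ t.1 (k + 1) = s.1 (k + 1)})
    (hY : ∀ s : Seq m, Y (Finsupp.single (s.swap k) 1) =
      Finsupp.mapDomain (Seq.swap k) (Y (Finsupp.single s 1))) :
    Commute (hecke q n m k) Y := by
  refine hecke_commute_of_window q hn k Y h1 h2 0 fun s w1 w2 => ?_
  obtain ⟨α, β, H⟩ := exists_hecke_window (m := m) q hn k 0 _ _ w1 w2
  rw [H s rfl rfl, map_add, map_smul, map_smul, hY]
  have := hs s
  generalize Y (Finsupp.single s 1) = w at this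
  rw [Finsupp.supported_eq_span_single] at this
  induction this using Submodule.span_induction with
  | mem x hx =>
    obtain ⟨t, ⟨ht1, ht2⟩, rfl⟩ := hx
    rw [H t ht1 ht2, Finsupp.mapDomain_single]
  | zero => simp
  | add x y _ _ hx hy => rw [map_add, hx, hy, Finsupp.mapDomain_add]; module
  | smul a x _ hx => rw [map_smul, hx, Finsupp.mapDomain_smul]; module

theorem Seq.replace_replace_comm (s : Seq m) {j k : ℕ} (h : k + 2 ≤ j ∨ j + 2 ≤ k) (p p' : ℤ × ℤ) :
    (s.replace j p).replace k p' = (s.replace k p').replace j p := by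
  refine Seq.ext fun i => ?_
  simp only [Seq.replace_apply]
  split_ifs <;> first | rfl | omega

theorem hecke_commute_hecke (q : 𝕜) {n : ℕ} (hn : 0 < n) {j k : ℕ} (h : k + 2 ≤ j ∨ j + 2 ≤ k) :
    Commute (hecke q n m k) (hecke q n m j) := by
  refine hecke_commute_of_away q hn k _
    (hecke_mul_posShift_of_ne q (by omega) (by omega))
    (hecke_mul_posShift_of_ne q (by omega) (by omega)) (fun s => ?_) fun s => ?_
  · rw [hecke_single, Finsupp.mem_supported]
    classical
    intro t ht
    obtain ⟨p, -, rfl⟩ := Finset.mem_image.1 (Finsupp.mapDomain_support ht)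
    simp only [Set.mem_ofPred_eq, Seq.replace_apply]
    constructor <;> split_ifs <;> first | rfl | omega
  · have e1 : (s.swap k).1 j = s.1 j := by
      rw [Seq.swap_apply]; split_ifs <;> first | rfl | omega
    have e2 : (s.swap k).1 (j + 1) = s.1 (j + 1) := by
      rw [Seq.swap_apply]; split_ifs <;> first | rfl | omega
    rw [hecke_single, hecke_single, ← Finsupp.mapDomain_comp, e1, e2]
    congr 1
    funext p
    have e3 : (s.replace j p).1 k = s.1 k := by
      rw [Seq.replace_apply]; split_ifs <;> first | rfl | omega
    have e4 : (s.replace j p).1 (k + 1) = s.1 (k + 1) := by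
      rw [Seq.replace_apply]; split_ifs <;> first | rfl | omega
    simp only [Function.comp, Seq.swap, e3, e4]
    exact (s.replace_replace_comm h _ _).symm

end Hecke

/-! ### The antisymmetrizer -/

section Antisymmetrizer

variable {𝕜 A : Type*} [Field 𝕜] [Ring A] [Algebra 𝕜 A]

/-- The sum of the minimal coset representatives `T_{N-1} ⋯ T_j`, `0 ≤ j ≤ N`. -/
def cosetSum (T : ℕ → A) : ℕ → A
  | 0 => 1
  | N + 1 => 1 + T N * cosetSum T N

/-- The sum `∑ T_w` over the permutations `w` of `{0, …, N}`. -/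
def symmetrizer (T : ℕ → A) : ℕ → A
  | 0 => 1
  | N + 1 => symmetrizer T N * cosetSum T (N + 1)

variable {T : ℕ → A} {r : 𝕜}

theorem commute_cosetSum (hc : ∀ j k, j + 2 ≤ k → Commute (T k) (T j)) {N k : ℕ} (h : N + 1 ≤ k) :
    Commute (T k) (cosetSum T N) := by
  induction N with
  | zero => exact Commute.one_right _
  | succ N ih =>
    exact (Commute.one_right _).add_right ((hc N k (by omega)).mul_right (ih (by omega)))

/-- For `i` below the top generator `T N`, the element `a * T N` absorbs the same lower generators
as `a`, because `T N` commutes with them, and induction applies. For the top generator, the braid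
relation brings its lower neighbour `T M` next to `a`, which absorbs it; the remaining terms are
handled by the quadratic relation. -/
theorem mul_cosetSum_mul (hq : ∀ k, T k * T k = (r - 1) • T k + r • (1 : A))
    (hb : ∀ k, T k * T (k + 1) * T k = T (k + 1) * T k * T (k + 1))
    (hc : ∀ j k, j + 2 ≤ k → Commute (T k) (T j)) (N : ℕ) (a : A)
    (ha : ∀ j, j + 1 < N → a * T j = r • a) (i : ℕ) (hi : i < N) :
    a * cosetSum T N * T i = r • (a * cosetSum T N) := by
  induction N generalizing a i with
  | zero => omega
  | succ N ih =>
    rcases Nat.lt_succ_iff_lt_or_eq.1 hi with hi | rfl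
    · have h1 := ih (a * T N) (fun j hj => by
        rw [mul_assoc, (hc j N (by omega)).eq, ← mul_assoc, ha j (by omega), smul_mul_assoc]) i hi
      rw [cosetSum, mul_add, mul_one, ← mul_assoc, add_mul, h1, ha i (by omega), smul_add]
    · rcases i with _ | M
      · simp only [cosetSum, mul_add, mul_one, add_mul]
        rw [mul_assoc, hq, mul_add, mul_smul_comm, mul_smul_comm, mul_one]
        module
      · have h1 : T (M + 1) * (T M * cosetSum T M) * T (M + 1) =
            T M * T (M + 1) * (T M * cosetSum T M) := by
          rw [mul_assoc, mul_assoc, ← (commute_cosetSum hc (Nat.le_refl (M + 1))).eq, ← mul_assoc,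
            ← mul_assoc, ← hb, ← mul_assoc]
        have h2 : cosetSum T (M + 1 + 1) * T (M + 1) = r • T (M + 1) + r • (1 : A) +
            T M * T (M + 1) * (T M * cosetSum T M) := by
          rw [cosetSum, cosetSum, mul_add, mul_one, add_mul, add_mul, hq, h1, one_mul]
          module
        rw [mul_assoc, h2, cosetSum, cosetSum, mul_add, mul_add, ← mul_assoc, ← mul_assoc a,
          ha M (by omega), mul_add, mul_add, mul_add]
        simp only [mul_smul_comm, smul_mul_assoc, mul_one, mul_assoc]
        module

theorem symmetrizer_mul (hq : ∀ k, T k * T k = (r - 1) • T k + r • (1 : A))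
    (hb : ∀ k, T k * T (k + 1) * T k = T (k + 1) * T k * T (k + 1))
    (hc : ∀ j k, j + 2 ≤ k → Commute (T k) (T j)) (N i : ℕ) (hi : i < N) :
    symmetrizer T N * T i = r • symmetrizer T N := by
  induction N generalizing i with
  | zero => omega
  | succ N ih =>
    exact mul_cosetSum_mul hq hb hc (N + 1) _ (fun j hj => ih j (by omega)) i hi

end Antisymmetrizer

/-! ### Linear independence of the normally ordered wedges -/

section Independence

variable {𝕜 : Type*} [Field 𝕜] {m : ℤ}

/-- The antisymmetrizer in the factors `0, …, N`. -/
def antisymm (q : 𝕜) (n : ℕ) (m : ℤ) (N : ℕ) : Module.End 𝕜 (Tens 𝕜 m) :=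
  symmetrizer (hecke q n m) N

theorem antisymm_mul_hecke (q : 𝕜) {n : ℕ} (hn : 0 < n) {N i : ℕ} (hi : i < N) :
    antisymm q n m N * hecke q n m i = q ^ 2 • antisymm q n m N :=
  symmetrizer_mul (hecke_quadratic q hn) (hecke_braid q hn)
    (fun _ _ h => hecke_commute_hecke q hn (Or.inr h)) N i hi

/-- If `T_i x = -x`, evaluating `A_N T_i x` in two ways gives `(q² + 1) A_N x = 0`. An element of
the sum of the kernels involves finitely many `i`, so all large `N` work. -/
theorem exists_antisymm_eq_zero {q : 𝕜} (hq : q ^ 2 + 1 ≠ 0) {n : ℕ} (hn : 0 < n) {x : Tens 𝕜 m}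
    (hx : x ∈ wedgeRel q n m) : ∃ N₀, ∀ N, N₀ ≤ N → antisymm q n m N x = 0 := by
  induction hx using Submodule.iSup_induction' with
  | mem i x hx =>
    refine ⟨i + 1, fun N hN => ?_⟩
    have h1 : hecke q n m i x = -x := by
      rw [LinearMap.mem_ker, LinearMap.add_apply, LinearMap.id_apply] at hx
      exact eq_neg_of_add_eq_zero_left hx
    have h2 := LinearMap.congr_fun (antisymm_mul_hecke (m := m) q hn (show i < N by omega)) x
    rw [Module.End.mul_apply, h1, map_neg, LinearMap.smul_apply] at h2
    have h3 : (q ^ 2 + 1) • antisymm q n m N x = 0 := by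
      rw [add_smul, ← h2, one_smul, neg_add_cancel]
    exact (smul_eq_zero.1 h3).resolve_left hq
  | zero => exact ⟨0, fun N _ => map_zero _⟩
  | add x y _ _ hx hy =>
    obtain ⟨N₁, h1⟩ := hx
    obtain ⟨N₂, h2⟩ := hy
    exact ⟨max N₁ N₂, fun N hN => by
      rw [map_add, h1 N (le_of_max_le_left hN), h2 N (le_of_max_le_right hN), add_zero]⟩

theorem map_mem_supported {α β : Type*} {S : Set α} {S' : Set β} {f : (α →₀ 𝕜) →ₗ[𝕜] (β →₀ 𝕜)}
    (h : ∀ s ∈ S, f (Finsupp.single s 1) ∈ Finsupp.supported 𝕜 𝕜 S') {x : α →₀ 𝕜}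
    (hx : x ∈ Finsupp.supported 𝕜 𝕜 S) : f x ∈ Finsupp.supported 𝕜 𝕜 S' := by
  rw [Finsupp.supported_eq_span_single] at hx
  refine (Submodule.span_le (p := (Finsupp.supported 𝕜 𝕜 S').comap f)).2 ?_ hx
  rintro _ ⟨s, hs, rfl⟩
  exact h s hs

theorem hecke_mem_supported (q : 𝕜) {n : ℕ} (hn : 0 < n) (k : ℕ) (s : Seq m) :
    hecke q n m k (Finsupp.single s 1) ∈ Finsupp.supported 𝕜 𝕜 {t : Seq m |
      (∀ j, j ≠ k → j ≠ k + 1 → t.1 j = s.1 j) ∧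
      (min (s.1 k) (s.1 (k + 1)) ≤ t.1 k ∧ t.1 k ≤ max (s.1 k) (s.1 (k + 1))) ∧
      min (s.1 k) (s.1 (k + 1)) ≤ t.1 (k + 1) ∧ t.1 (k + 1) ≤ max (s.1 k) (s.1 (k + 1))} := by
  rw [hecke_single, ← Finsupp.lmapDomain_apply 𝕜 𝕜]
  refine map_mem_supported (fun p hp => ?_) (heckePair_mem_supported q hn _ _)
  rw [Finsupp.lmapDomain_apply, Finsupp.mapDomain_single]
  refine Finsupp.single_mem_supported 𝕜 _ ⟨fun j h1 h2 => ?_, ?_, ?_⟩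
  · rw [Seq.replace_apply, if_neg h2, if_neg h1]
  · rw [Seq.replace_apply, if_neg (by omega), if_pos rfl]
    exact ⟨hp.1, hp.2.1⟩
  · rw [Seq.replace_apply, if_pos rfl]
    exact ⟨hp.2.2.1, hp.2.2.2⟩

theorem exists_hecke_of_gt {q : 𝕜} (hq : q ≠ 0) {n : ℕ} (hn : 0 < n) (k : ℕ) (s : Seq m)
    (h : s.1 (k + 1) < s.1 k) :
    ∃ c : 𝕜, c ≠ 0 ∧ hecke q n m k (Finsupp.single s 1) - c • Finsupp.single (s.swap k) 1 ∈
      Finsupp.supported 𝕜 𝕜 {t : Seq m | (∀ j, j ≠ k → j ≠ k + 1 → t.1 j = s.1 j) ∧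
        (s.1 (k + 1) < t.1 k ∧ t.1 k < s.1 k) ∧ (s.1 (k + 1) < t.1 (k + 1) ∧ t.1 (k + 1) < s.1 k) ∧
          t.1 k + t.1 (k + 1) = s.1 k + s.1 (k + 1)} := by
  obtain ⟨c, hc, hw⟩ := exists_heckePair_of_gt hq hn h
  refine ⟨c, hc, ?_⟩
  have e : hecke q n m k (Finsupp.single s 1) - c • Finsupp.single (s.swap k) 1 =
      Finsupp.lmapDomain 𝕜 𝕜 (fun p => s.replace k p)
        (heckePair q n (s.1 k) (s.1 (k + 1)) - c • Finsupp.single (s.1 (k + 1), s.1 k) 1) := by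
    rw [map_sub, map_smul, hecke_single, Finsupp.lmapDomain_apply, Finsupp.lmapDomain_apply,
      Finsupp.mapDomain_single, Seq.swap]
  rw [e]
  refine map_mem_supported (fun p hp => ?_) hw
  rw [Finsupp.lmapDomain_apply, Finsupp.mapDomain_single]
  have e1 : (s.replace k p).1 k = p.1 := by rw [Seq.replace_apply, if_neg (by omega), if_pos rfl]
  have e2 : (s.replace k p).1 (k + 1) = p.2 := by rw [Seq.replace_apply, if_pos rfl]
  refine Finsupp.single_mem_supported 𝕜 _ ⟨fun j h1 h2 => ?_, ?_, ?_, ?_⟩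
  · rw [Seq.replace_apply, if_neg h2, if_neg h1]
  · rw [e1]; exact ⟨hp.1, hp.2.1⟩
  · rw [e2]; exact ⟨hp.2.2.1, hp.2.2.2.1⟩
  · rw [e1, e2]; exact hp.2.2.2.2

/-- Move the entry in position `0` to position `N`. -/
def Seq.rot (N : ℕ) (s : Seq m) : Seq m :=
  ⟨fun k => if k < N then s.1 (k + 1) else if k = N then s.1 0 else s.1 k, by
    obtain ⟨M, hM⟩ := s.2
    refine ⟨max M (N + 1), fun k hk => ?_⟩
    beta_reduce
    rw [if_neg (by omega), if_neg (by omega)]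
    exact hM k (by omega)⟩

/-- Reverse the entries in positions `0, …, N`. -/
def Seq.rev (N : ℕ) (s : Seq m) : Seq m :=
  ⟨fun k => if k ≤ N then s.1 (N - k) else s.1 k, by
    obtain ⟨M, hM⟩ := s.2
    refine ⟨max M (N + 1), fun k hk => ?_⟩
    beta_reduce
    rw [if_neg (by omega)]
    exact hM k (by omega)⟩

theorem Seq.rot_apply (N : ℕ) (s : Seq m) (k : ℕ) :
    (s.rot N).1 k = if k < N then s.1 (k + 1) else if k = N then s.1 0 else s.1 k := rfl

theorem Seq.rev_apply (N : ℕ) (s : Seq m) (k : ℕ) :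
    (s.rev N).1 k = if k ≤ N then s.1 (N - k) else s.1 k := rfl

theorem Seq.rev_succ (N : ℕ) (s : Seq m) : s.rev (N + 1) = (s.rot (N + 1)).rev N := by
  refine Seq.ext fun k => ?_
  simp only [Seq.rev_apply, Seq.rot_apply]
  split_ifs <;> first | omega | rfl | skip
  · exact congrArg s.1 (by omega)
  · exact congrArg s.1 (by omega)

/-- Applying `T_0`, `T_1`, … in turn carries the largest entry `s 0` to position `N`. All other
terms come from shorter products or from lower terms of some `T_k`; since `T_k` produces only
entries between the two it acts on, they have a smaller entry at `N`. -/
theorem exists_cosetSum {q : 𝕜} (hq : q ≠ 0) {n : ℕ} (hn : 0 < n) (N : ℕ) (s : Seq m)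
    (h : ∀ j, 1 ≤ j → j ≤ N → s.1 j < s.1 0) :
    ∃ c : 𝕜, c ≠ 0 ∧ cosetSum (hecke q n m) N (Finsupp.single s 1) -
      c • Finsupp.single (s.rot N) 1 ∈
      Finsupp.supported 𝕜 𝕜 {t : Seq m | t.1 N < s.1 0 ∧ ∀ j, N < j → t.1 j = s.1 j} := by
  induction N with
  | zero =>
    refine ⟨1, one_ne_zero, ?_⟩
    have : s.rot 0 = s := Seq.ext fun k => by
      rw [Seq.rot_apply, if_neg (by omega)]; split_ifs with h <;> simp [h]
    rw [this, cosetSum, Module.End.one_apply, one_smul, sub_self]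
    exact Submodule.zero_mem _
  | succ N ih =>
    obtain ⟨c, hc, hw⟩ := ih fun j h1 h2 => h j h1 (by omega)
    have r0 : (s.rot N).1 N = s.1 0 := by rw [Seq.rot_apply, if_neg (by omega), if_pos rfl]
    have r1 : (s.rot N).1 (N + 1) = s.1 (N + 1) := by
      rw [Seq.rot_apply, if_neg (by omega), if_neg (by omega)]
    obtain ⟨c', hc', hw'⟩ := exists_hecke_of_gt (m := m) hq hn N (s.rot N) (by
      rw [r0, r1]; exact h (N + 1) (by omega) le_rfl)
    have hrot : (s.rot N).swap N = s.rot (N + 1) := Seq.ext fun k => by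
      simp only [Seq.swap_apply, Seq.rot_apply]
      split_ifs <;> first | omega | rfl | simp [*]
    refine ⟨c * c', mul_ne_zero hc hc', ?_⟩
    set w := cosetSum (hecke q n m) N (Finsupp.single s 1) - c • Finsupp.single (s.rot N) 1 with hwd
    set w' := hecke q n m N (Finsupp.single (s.rot N) 1) -
      c' • Finsupp.single ((s.rot N).swap N) 1 with hwd'
    have e1 : cosetSum (hecke q n m) N (Finsupp.single s 1) =
      c • Finsupp.single (s.rot N) 1 + w := by rw [hwd]; abel
    have e2 : hecke q n m N (Finsupp.single (s.rot N) 1) =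
      c' • Finsupp.single (s.rot (N + 1)) 1 + w' := by rw [hwd', hrot]; abel
    rw [cosetSum, LinearMap.add_apply, Module.End.mul_apply, Module.End.one_apply, e1, map_add,
      map_smul, e2]
    have e3 : Finsupp.single s 1 + (c • (c' • Finsupp.single (s.rot (N + 1)) 1 + w') +
        hecke q n m N w) - (c * c') • Finsupp.single (s.rot (N + 1)) 1 =
        Finsupp.single s 1 + c • w' + hecke q n m N w := by module
    -- The remainder consists of the tensor itself (from the representative `1`), the lower terms of
    -- `T_N` on the leading tensor, and `T_N` applied to the previous remainder.
    rw [e3]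
    have hs1 := h (N + 1) (by omega) le_rfl
    refine Submodule.add_mem _ (Submodule.add_mem _ (Finsupp.single_mem_supported 𝕜 _ ⟨hs1, fun _ _ => rfl⟩)
      (Submodule.smul_mem _ _ (Finsupp.supported_mono ?_ hw'))) (map_mem_supported (fun t ht => ?_) hw)
    · rintro t ⟨h1, -, ⟨-, h2⟩, -⟩
      refine ⟨r0 ▸ h2, fun j hj => ?_⟩
      rw [h1 j (by omega) (by omega), Seq.rot_apply, if_neg (by omega), if_neg (by omega)]
    · refine Finsupp.supported_mono ?_ (hecke_mem_supported q hn N t)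
      rintro t' ⟨h1, -, -, h2⟩
      refine ⟨lt_of_le_of_lt h2 (max_lt ht.1 (by rw [ht.2 _ (by omega)]; exact hs1)), fun j hj => ?_⟩
      rw [h1 j (by omega) (by omega), ht.2 j (by omega)]

theorem cosetSum_mem_supported (q : 𝕜) {n : ℕ} (hn : 0 < n) (N : ℕ) (s : Seq m) :
    cosetSum (hecke q n m) N (Finsupp.single s 1) ∈
      Finsupp.supported 𝕜 𝕜 {t : Seq m | ∀ j, N < j → t.1 j = s.1 j} := by
  induction N with
  | zero => exact Finsupp.single_mem_supported 𝕜 _ fun _ _ => rfl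
  | succ N ih =>
    rw [cosetSum, LinearMap.add_apply, Module.End.mul_apply, Module.End.one_apply]
    refine Submodule.add_mem _ (Finsupp.single_mem_supported 𝕜 _ fun _ _ => rfl)
      (map_mem_supported (fun t ht => ?_) ih)
    refine Finsupp.supported_mono ?_ (hecke_mem_supported q hn N t)
    rintro t' ⟨h1, -⟩ j hj
    rw [h1 j (by omega) (by omega), ht j (by omega)]

theorem antisymm_mem_supported (q : 𝕜) {n : ℕ} (hn : 0 < n) (N : ℕ) (s : Seq m) :
    antisymm q n m N (Finsupp.single s 1) ∈
      Finsupp.supported 𝕜 𝕜 {t : Seq m | ∀ j, N < j → t.1 j = s.1 j} := by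
  induction N generalizing s with
  | zero => exact Finsupp.single_mem_supported 𝕜 _ fun _ _ => rfl
  | succ N ih =>
    rw [antisymm, symmetrizer, Module.End.mul_apply]
    refine map_mem_supported (fun t ht => ?_) (cosetSum_mem_supported q hn (N + 1) s)
    refine Finsupp.supported_mono ?_ (ih t)
    intro t' h1 j hj
    rw [h1 j (by omega), ht j (by omega)]

theorem apply_eq_zero_of_mem_supported {α : Type*} {S : Set α} {x : α →₀ 𝕜}
    (hx : x ∈ Finsupp.supported 𝕜 𝕜 S) {a : α} (ha : a ∉ S) : x a = 0 := by
  by_contra h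
  exact ha (hx (Finsupp.mem_support_iff.2 h))

/-- The leading coefficient of the antisymmetrization of a decreasing tensor. -/
theorem exists_antisymm_succ_apply {q : 𝕜} (hq : q ≠ 0) {n : ℕ} (hn : 0 < n) (N : ℕ) (s : Seq m)
    (hs : ∀ j, 1 ≤ j → j ≤ N + 1 → s.1 j < s.1 0) :
    ∃ c : 𝕜, c ≠ 0 ∧ ∀ t : Seq m, s.1 0 ≤ t.1 (N + 1) →
      antisymm q n m (N + 1) (Finsupp.single s 1) t =
        c * antisymm q n m N (Finsupp.single (s.rot (N + 1)) 1) t := by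
  obtain ⟨c, hc, hw⟩ := exists_cosetSum (m := m) hq hn (N + 1) s hs
  refine ⟨c, hc, fun t ht => ?_⟩
  -- The antisymmetrizer of level `N` leaves position `N + 1` alone, so the error terms keep an
  -- entry below `s 0` there and cannot contribute at `t`.
  have h1 : antisymm q n m N (cosetSum (hecke q n m) (N + 1) (Finsupp.single s 1) -
      c • Finsupp.single (s.rot (N + 1)) 1) ∈
      Finsupp.supported 𝕜 𝕜 {t : Seq m | t.1 (N + 1) < s.1 0} := by
    refine map_mem_supported (fun u hu => ?_) hw
    refine Finsupp.supported_mono ?_ (antisymm_mem_supported q hn N u)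
    intro v hv
    have := hv (N + 1) (by omega)
    simp only [Set.mem_ofPred_eq, this]
    exact hu.1
  have h2 := apply_eq_zero_of_mem_supported h1 (a := t) (by simpa using ht)
  rw [map_sub, map_smul, Finsupp.sub_apply, sub_eq_zero] at h2
  rw [antisymm, symmetrizer, Module.End.mul_apply]
  exact h2

/-- Sending the largest remaining entry to the last free position at each step ends in the
increasing order, and each step contributes a nonzero factor. -/
theorem antisymm_apply_rev_self {q : 𝕜} (hq : q ≠ 0) {n : ℕ} (hn : 0 < n) (N : ℕ) (s : Seq m)
    (hs : ∀ i j, i < j → j ≤ N → s.1 j < s.1 i) :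
    antisymm q n m N (Finsupp.single s 1) (s.rev N) ≠ 0 := by
  induction N generalizing s with
  | zero =>
    have : s.rev 0 = s := Seq.ext fun k => by
      rw [Seq.rev_apply]; split_ifs with h
      · exact congrArg _ (by omega)
      · rfl
    rw [this, antisymm, symmetrizer, Module.End.one_apply, Finsupp.single_eq_same]
    exact one_ne_zero
  | succ N ih =>
    obtain ⟨c, hc, h⟩ := exists_antisymm_succ_apply (m := m) hq hn N s fun j h1 h2 => hs 0 j h1 h2
    rw [h _ (by rw [Seq.rev_apply, if_pos le_rfl, Nat.sub_self]), Seq.rev_succ]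
    refine mul_ne_zero hc (ih _ fun i j h1 h2 => ?_)
    rw [Seq.rot_apply, Seq.rot_apply, if_pos (by omega), if_pos (by omega)]
    exact hs _ _ (by omega) (by omega)

/-- This is the triangularity behind linear independence. The last antisymmetrized position never
holds more than the largest entry `s 0`; if it holds exactly that, the comparison passes to the
rotated sequences. -/
theorem eq_or_lex_of_antisymm_apply_rev_ne_zero {q : 𝕜} (hq : q ≠ 0) {n : ℕ} (hn : 0 < n) (N : ℕ)
    (s r : Seq m) (hs : ∀ i j, i < j → j ≤ N → s.1 j < s.1 i)
    (h : antisymm q n m N (Finsupp.single s 1) (r.rev N) ≠ 0) :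
    s = r ∨ ∃ i, (∀ j, j < i → r.1 j = s.1 j) ∧ r.1 i < s.1 i := by
  induction N generalizing s r with
  | zero =>
    have : r.rev 0 = r := Seq.ext fun k => by
      rw [Seq.rev_apply]; split_ifs with h
      · exact congrArg _ (by omega)
      · rfl
    rw [this, antisymm, symmetrizer, Module.End.one_apply] at h
    left
    by_contra hne
    exact h (Finsupp.single_eq_of_ne (Ne.symm hne))
  | succ N ih =>
    obtain ⟨c, hc, happ⟩ := exists_antisymm_succ_apply (m := m) hq hn N s
      fun j h1 h2 => hs 0 j h1 h2
    rcases lt_or_ge (r.1 0) (s.1 0) with h0 | h0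
    · exact Or.inr ⟨0, fun j hj => by omega, h0⟩
    rw [happ _ (by rw [Seq.rev_apply, if_pos le_rfl, Nat.sub_self]; exact h0), Seq.rev_succ] at h
    have h := right_ne_zero_of_mul h
    -- Position `N + 1` is fixed by the antisymmetrizer of level `N`, and the rotated sequences
    -- carry `s 0` and `r 0` there.
    have h00 : r.1 0 = s.1 0 := by
      by_contra hne
      refine h (apply_eq_zero_of_mem_supported (antisymm_mem_supported q hn N _) fun hmem => hne ?_)
      have := hmem (N + 1) (by omega)
      rw [Seq.rev_apply, if_neg (by omega), Seq.rot_apply, Seq.rot_apply, if_neg (by omega),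
        if_pos rfl, if_neg (by omega), if_pos rfl] at this
      exact this
    have key : ∀ i, (∀ j, j < i → (r.rot (N + 1)).1 j = (s.rot (N + 1)).1 j) → ∀ j, j ≤ i →
        (j ≤ N + 1 ∨ j < i) → r.1 j = s.1 j := by
      intro i hi j hj hj'
      rcases Nat.eq_zero_or_pos j with rfl | hj0
      · exact h00
      rcases Nat.lt_or_ge (N + 1) j with h1 | h1
      · have := hi j (by omega)
        rwa [Seq.rot_apply, Seq.rot_apply, if_neg (by omega), if_neg (by omega), if_neg (by omega),
          if_neg (by omega)] at this
      · have := hi (j - 1) (by omega)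
        rwa [Seq.rot_apply, Seq.rot_apply, if_pos (by omega), if_pos (by omega),
          Nat.sub_add_cancel hj0] at this
    rcases ih (s.rot (N + 1)) (r.rot (N + 1)) (fun i j h1 h2 => by
      rw [Seq.rot_apply, Seq.rot_apply, if_pos (by omega), if_pos (by omega)]
      exact hs _ _ (by omega) (by omega)) h with h1 | ⟨i, h1, h2⟩
    · left
      refine Seq.ext fun k => (key (k + 1) (fun j _ => by rw [h1]) k (by omega) (by omega)).symm
    · right
      rcases lt_trichotomy i (N + 1) with hi | hi | hi
      · refine ⟨i + 1, fun j hj => key i h1 j (by omega) (by omega), ?_⟩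
        rwa [Seq.rot_apply, Seq.rot_apply, if_pos hi, if_pos hi] at h2
      -- At position `N + 1` the rotated sequences hold the equal entries `s 0` and `r 0`, so they
      -- cannot differ there.
      · subst hi
        simp [Seq.rot_apply, h00] at h2
      · refine ⟨i, fun j hj => key i h1 j (by omega) (by omega), ?_⟩
        rwa [Seq.rot_apply, Seq.rot_apply, if_neg (by omega), if_neg (by omega), if_neg (by omega),
          if_neg (by omega)] at h2

/-- No nontrivial combination of normally ordered tensors is zero in the wedge space. -/
theorem eq_zero_of_mem_wedgeRel {q : 𝕜} (hq : q ≠ 0) (hq2 : q ^ 2 + 1 ≠ 0) {n : ℕ} (hn : 0 < n)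
    {x : Tens 𝕜 m} (hx : x ∈ wedgeRel q n m) (hs : ∀ s ∈ x.support, StrictAnti s.1) : x = 0 := by
  by_contra hne
  -- At the reversal of the lexicographically largest tensor of the support, no other tensor of the
  -- support contributes to the antisymmetrization.
  obtain ⟨r, hr, hmax⟩ := Finset.exists_max_image x.support (fun s : Seq m => toLex s.1)
    (Finsupp.support_nonempty_iff.2 hne)
  obtain ⟨N, hN⟩ := exists_antisymm_eq_zero hq2 hn hx
  have h1 := congrArg (fun y : Tens 𝕜 m => y (r.rev N)) (hN N le_rfl)
  have hxs : x = ∑ s ∈ x.support, x s • Finsupp.single s (1 : 𝕜) := by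
    conv_lhs => rw [← Finsupp.sum_single x]
    exact Finset.sum_congr rfl fun s _ => by rw [Finsupp.smul_single, smul_eq_mul, mul_one]
  beta_reduce at h1
  rw [hxs, map_sum, Finsupp.finsetSum_apply, Finset.sum_eq_single_of_mem r hr, map_smul,
    Finsupp.smul_apply, Finsupp.zero_apply, smul_eq_zero] at h1
  · rcases h1 with h1 | h1
    · exact Finsupp.mem_support_iff.1 hr h1
    · exact antisymm_apply_rev_self hq hn N r (fun i j h _ => hs r hr h) h1
  · intro s hsx hsr
    rw [map_smul, Finsupp.smul_apply, smul_eq_zero]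
    right
    by_contra h2
    rcases eq_or_lex_of_antisymm_apply_rev_ne_zero hq hn N s r (fun i j h _ => hs s hsx h) h2
      with h3 | h3
    · exact hsr h3
    · exact (hmax s hsx).not_gt h3

theorem linearIndependent_pureWedge {q : 𝕜} (hq : q ≠ 0) (hq2 : q ^ 2 + 1 ≠ 0) {n : ℕ}
    (hn : 0 < n) (m : ℤ) :
    LinearIndependent 𝕜 fun s : {s : Seq m // StrictAnti s.1} => pureWedge q n s.1 := by
  rw [linearIndependent_iff]
  intro l hl
  have h1 : ∀ l : {s : Seq m // StrictAnti s.1} →₀ 𝕜,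
      Finsupp.linearCombination 𝕜 (fun s : {s : Seq m // StrictAnti s.1} => pureWedge q n s.1) l =
      (wedgeRel q n m).mkQ (Finsupp.mapDomain Subtype.val l) := by
    intro l
    induction l using Finsupp.induction_linear with
    | zero => simp
    | add f g hf hg => rw [map_add, hf, hg, Finsupp.mapDomain_add, map_add]
    | single s a =>
      rw [Finsupp.linearCombination_single, Finsupp.mapDomain_single, pureWedge, ← map_smul,
        Finsupp.smul_single, smul_eq_mul, mul_one]
  rw [h1, Submodule.mkQ_apply, Submodule.Quotient.mk_eq_zero] at hl
  refine Finsupp.mapDomain_injective Subtype.val_injective ?_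
  rw [Finsupp.mapDomain_zero]
  refine eq_zero_of_mem_wedgeRel hq hq2 hn hl fun s hs => ?_
  classical
  obtain ⟨t, -, rfl⟩ := Finset.mem_image.1 (Finsupp.mapDomain_support hs)
  exact t.2

end Independence

/-! ### Straightening, and the basis of normally ordered wedges -/

section Straightening

variable {𝕜 : Type*} [Field 𝕜] {m : ℤ}

/-- The factorisation `(T_k + 1)(T_k - q²) = 0` puts the image of `T_k - q²` inside `Ker (T_k + 1)`.
-/
theorem mkQ_hecke (q : 𝕜) {n : ℕ} (hn : 0 < n) (k : ℕ) (x : Tens 𝕜 m) :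
    (wedgeRel q n m).mkQ (hecke q n m k x) = q ^ 2 • (wedgeRel q n m).mkQ x := by
  rw [← sub_eq_zero, ← map_smul, ← map_sub, Submodule.mkQ_apply, Submodule.Quotient.mk_eq_zero]
  refine Submodule.mem_iSup_of_mem k ?_
  rw [LinearMap.mem_ker]
  have h := LinearMap.congr_fun (hecke_quadratic (m := m) q hn k) x
  rw [Module.End.mul_apply, LinearMap.add_apply, LinearMap.smul_apply, LinearMap.smul_apply,
    Module.End.one_apply] at h
  change hecke q n m k (hecke q n m k x - q ^ 2 • x) + (hecke q n m k x - q ^ 2 • x) = 0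
  rw [map_sub, h, map_smul]
  module

/-- `T` negates `u_l ⊗ u_l`, so the tensor lies in the kernel. This makes the truncated operators
stabilise and discards the moves that do not correspond to a box. -/
theorem pureWedge_eq_zero (q : 𝕜) {n : ℕ} (hn : 0 < n) {k : ℕ} {s : Seq m}
    (h : s.1 k = s.1 (k + 1)) : pureWedge q n s = 0 := by
  rw [pureWedge, Submodule.mkQ_apply, Submodule.Quotient.mk_eq_zero]
  refine Submodule.mem_iSup_of_mem k ?_
  rw [LinearMap.mem_ker]
  change hecke q n m k (Finsupp.single s 1) + Finsupp.single s 1 = 0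
  have e := s.replace_self k
  rw [← h] at e
  rw [hecke_single, ← h, heckePair_self q hn, ← Finsupp.lmapDomain_apply 𝕜 𝕜, map_neg,
    Finsupp.lmapDomain_apply, Finsupp.mapDomain_single, e, neg_add_cancel]

theorem mkQ_mem_span (q : 𝕜) (n : ℕ) {S : Set (Seq m)} {x : Tens 𝕜 m}
    (hx : x ∈ Finsupp.supported 𝕜 𝕜 S) :
    (wedgeRel q n m).mkQ x ∈ Submodule.span 𝕜 (pureWedge q n '' S) := by
  rw [Finsupp.supported_eq_span_single] at hx
  refine (Submodule.span_le (p := (Submodule.span 𝕜 (pureWedge q n '' S)).comap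
    (wedgeRel q n m).mkQ)).2 ?_ hx
  rintro _ ⟨s, hs, rfl⟩
  exact Submodule.subset_span ⟨s, hs, rfl⟩

/-- Apply `T_k` to the swapped, descending tensor: its leading term is a nonzero multiple of `s`,
and in the quotient `T_k` is the scalar `q²`, so `s` can be solved for. The bounds and the preserved
sum serve the termination argument. -/
theorem pureWedge_mem_span_of_lt {q : 𝕜} (hq : q ≠ 0) {n : ℕ} (hn : 0 < n) {k : ℕ} {s : Seq m}
    (h : s.1 k < s.1 (k + 1)) :
    pureWedge q n s ∈ Submodule.span 𝕜 (pureWedge q n '' {t : Seq m |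
      (∀ j, j ≠ k → j ≠ k + 1 → t.1 j = s.1 j) ∧ s.1 k ≤ t.1 k ∧ s.1 k ≤ t.1 (k + 1) ∧
        t.1 (k + 1) < s.1 (k + 1) ∧ t.1 k + t.1 (k + 1) = s.1 k + s.1 (k + 1)}) := by
  have u1 : (s.swap k).1 k = s.1 (k + 1) := by
    rw [Seq.swap_apply, if_neg (by omega), if_pos rfl]
  have u2 : (s.swap k).1 (k + 1) = s.1 k := by rw [Seq.swap_apply, if_pos rfl]
  obtain ⟨c, hc, hw⟩ := exists_hecke_of_gt (m := m) hq hn k (s.swap k) (by rw [u1, u2]; exact h)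
  rw [Seq.swap_swap] at hw
  set w := hecke q n m k (Finsupp.single (s.swap k) 1) - c • Finsupp.single s 1 with hwd
  have e1 : (wedgeRel q n m).mkQ w = q ^ 2 • pureWedge q n (s.swap k) - c • pureWedge q n s := by
    rw [hwd, map_sub, map_smul, mkQ_hecke q hn]
    rfl
  have e2 : pureWedge q n s = c⁻¹ • (q ^ 2 • pureWedge q n (s.swap k) - (wedgeRel q n m).mkQ w) := by
    rw [e1, sub_sub_cancel, smul_smul, inv_mul_cancel₀ hc, one_smul]
  rw [e2]
  have off : ∀ j, j ≠ k → j ≠ k + 1 → (s.swap k).1 j = s.1 j := fun j h1 h2 => by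
    rw [Seq.swap_apply, if_neg h2, if_neg h1]
  refine Submodule.smul_mem _ _ (Submodule.sub_mem _ (Submodule.smul_mem _ _
    (Submodule.subset_span ⟨_, ?_, rfl⟩)) (Submodule.span_mono (Set.image_mono ?_)
      (mkQ_mem_span q n hw)))
  · exact ⟨off, by omega, by omega, by omega, by omega⟩
  · rintro t ⟨h1, h2, h3, h4⟩
    rw [u1, u2] at *
    exact ⟨fun j hj hj' => (h1 j hj hj').trans (off j hj hj'), by omega, by omega, by omega,
      by omega⟩

/-- Straightening an ascent moves a positive amount from position `k + 1` to position `k`, so `∑ i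
(s i - (m - M))` drops. The sum stays nonnegative because the entries before `M` remain above `m -
M`. -/
theorem pureWedge_mem_span_of_bound {q : 𝕜} (hq : q ≠ 0) {n : ℕ} (hn : 0 < n) (M : ℕ) (s : Seq m)
    (htail : ∀ k, M ≤ k → s.1 k = m - k) (hlow : ∀ k, k < M → m - M < s.1 k) :
    pureWedge q n s ∈ Submodule.span 𝕜 (pureWedge q n '' {t : Seq m | StrictAnti t.1}) := by
  obtain ⟨d, hd⟩ : ∃ d : ℕ, (∑ i ∈ Finset.range M, (i : ℤ) * (s.1 i - (m - M))) ≤ d :=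
    ⟨_, Int.self_le_toNat _⟩
  induction d using Nat.strong_induction_on generalizing s with
  | _ d ih =>
  by_cases hs : ∀ k, s.1 (k + 1) < s.1 k
  · exact Submodule.subset_span ⟨s, strictAnti_nat_of_succ_lt hs, rfl⟩
  push Not at hs
  obtain ⟨k, hk⟩ := hs
  -- The tail is strictly decreasing and the entries before `M` lie above its first entry `m - M`,
  -- so an ascent or a repetition lies entirely before `M`.
  have hkM : k + 1 < M := by
    by_contra hc
    have h1 := htail (k + 1) (by omega)
    rcases Nat.lt_or_ge k M with h2 | h2
    · have := hlow k h2
      push_cast at h1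
      omega
    · have := htail k h2
      push_cast at h1
      omega
  rcases hk.eq_or_lt with hk | hk
  · rw [pureWedge_eq_zero q hn hk]
    exact Submodule.zero_mem _
  refine Submodule.span_le.2 ?_ (pureWedge_mem_span_of_lt hq hn hk)
  rintro _ ⟨t, ⟨h1, h2, h3, h4, h5⟩, rfl⟩
  have ht : ∀ j, M ≤ j → t.1 j = m - j := fun j hj => by
    rw [h1 j (by omega) (by omega), htail j hj]
  have hl : ∀ j, j < M → m - M < t.1 j := fun j hj => by
    rcases eq_or_ne j k with rfl | e1
    · exact lt_of_lt_of_le (hlow j hj) h2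
    · rcases eq_or_ne j (k + 1) with rfl | e2
      · exact lt_of_lt_of_le (hlow k (by omega)) h3
      · rw [h1 j e1 e2]; exact hlow j hj
  have hsum : (∑ i ∈ Finset.range M, (i : ℤ) * (t.1 i - (m - M))) <
      ∑ i ∈ Finset.range M, (i : ℤ) * (s.1 i - (m - M)) := by
    rw [← sub_neg, ← Finset.sum_sub_distrib, Finset.sum_eq_add_of_mem k (k + 1)
      (Finset.mem_range.2 (by omega)) (Finset.mem_range.2 hkM) (by omega)]
    · push_cast
      nlinarith
    · rintro j - ⟨e1, e2⟩
      rw [h1 j e1 e2, sub_self]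
  have hnn : 0 ≤ ∑ i ∈ Finset.range M, (i : ℤ) * (t.1 i - (m - M)) :=
    Finset.sum_nonneg fun i hi => mul_nonneg (by positivity)
      (by have := hl i (Finset.mem_range.1 hi); omega)
  obtain ⟨d', hd'⟩ := Int.eq_ofNat_of_zero_le hnn
  exact ih d' (by omega) t ht hl hd'.le

theorem Seq.exists_bound (s : Seq m) :
    ∃ M : ℕ, (∀ k, M ≤ k → s.1 k = m - k) ∧ ∀ k, k < M → m - M < s.1 k := by
  obtain ⟨N, hN⟩ := s.2
  -- `B` is chosen so that `m - B` lies below each of the first `N` entries.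
  set B := (Finset.range N).sup fun k => (m - s.1 k).toNat + 1 with hB
  refine ⟨max N B, fun k hk => hN k (le_of_max_le_left hk), fun k hk => ?_⟩
  rcases Nat.lt_or_ge k N with h | h
  · have h1 : (m - s.1 k).toNat + 1 ≤ B :=
      Finset.le_sup (f := fun k => (m - s.1 k).toNat + 1) (Finset.mem_range.2 h)
    omega
  · rw [hN k h]
    omega

theorem pureWedge_mem_span {q : 𝕜} (hq : q ≠ 0) {n : ℕ} (hn : 0 < n) (s : Seq m) :
    pureWedge q n s ∈ Submodule.span 𝕜 (pureWedge q n '' {t : Seq m | StrictAnti t.1}) := by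
  obtain ⟨M, h1, h2⟩ := s.exists_bound
  exact pureWedge_mem_span_of_bound hq hn M s h1 h2

theorem Fock.hom_ext {q : 𝕜} {n : ℕ} {M : Type*} [AddCommGroup M] [Module 𝕜 M]
    {f g : Fock q n m →ₗ[𝕜] M} (h : ∀ s : Seq m, f (pureWedge q n s) = g (pureWedge q n s)) :
    f = g :=
  Submodule.linearMap_qext _ (End_ext h)

theorem span_pureWedge {q : 𝕜} (hq : q ≠ 0) {n : ℕ} (hn : 0 < n) (m : ℤ) :
    ⊤ ≤ Submodule.span 𝕜
      (Set.range fun s : {s : Seq m // StrictAnti s.1} => pureWedge q n s.1) := by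
  have h : (pureWedge q n '' {t : Seq m | StrictAnti t.1}) =
      Set.range fun s : {s : Seq m // StrictAnti s.1} => pureWedge q n s.1 := by
    rw [Set.image_eq_range]
    rfl
  rw [← h]
  rintro x -
  obtain ⟨y, rfl⟩ := (wedgeRel q n m).mkQ_surjective x
  have hy : y ∈ Finsupp.supported 𝕜 𝕜 (Set.univ : Set (Seq m)) := by simp
  refine Submodule.span_le.2 ?_ (mkQ_mem_span q n hy)
  rintro _ ⟨s, -, rfl⟩
  exact pureWedge_mem_span hq hn s

/-- The normally ordered wedges form a basis of `F_(m)`. -/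
def wedgeBasis {q : 𝕜} (hq : q ≠ 0) (hq2 : q ^ 2 + 1 ≠ 0) {n : ℕ} (hn : 0 < n) (m : ℤ) :
    Module.Basis {s : Seq m // StrictAnti s.1} 𝕜 (Fock q n m) :=
  Module.Basis.mk (linearIndependent_pureWedge hq hq2 hn m) (span_pureWedge hq hn m)

theorem wedgeBasis_apply {q : 𝕜} (hq : q ≠ 0) (hq2 : q ^ 2 + 1 ≠ 0) {n : ℕ} (hn : 0 < n)
    (s : {s : Seq m // StrictAnti s.1}) : wedgeBasis hq hq2 hn m s = pureWedge q n s.1 :=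
  Module.Basis.mk_apply _ _ s

/-! #### Wedging by a vector -/

theorem wedge_single_pureWedge (q : 𝕜) (n : ℕ) (l : ℤ) (s : Seq (m - 1)) :
    wedge q n m (Finsupp.single l 1) (pureWedge q n s) = pureWedge q n (Seq.cons l s : Seq m) := by
  rw [wedge, Finsupp.linearCombination_single, one_smul, pureWedge, Submodule.mkQ_apply,
    Submodule.mapQ_apply, tensCons, Finsupp.lmapDomain_apply, Finsupp.mapDomain_single]
  rfl

/-- Remove the first entry. -/
def Seq.tail (s : Seq m) : Seq (m - 1) :=
  ⟨fun k => s.1 (k + 1), by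
    obtain ⟨N, hN⟩ := s.2
    refine ⟨N, fun k hk => ?_⟩
    beta_reduce
    rw [hN (k + 1) (by omega)]
    push_cast
    ring⟩

theorem Seq.cons_tail (s : Seq m) : (Seq.cons (s.1 0) s.tail : Seq m) = s :=
  Seq.ext fun k => by cases k <;> rfl

/-- Removing the first entry lowers the charge by one, so the induction has to run over all charges
at once. -/
theorem Seq.induction {P : ∀ m : ℤ, Seq m → Prop} (hvac : ∀ m, P m (Seq.vac m))
    (hcons : ∀ m l (s : Seq (m - 1)), P (m - 1) s → P m (Seq.cons l s)) (m : ℤ) (s : Seq m) :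
    P m s := by
  obtain ⟨N, hN⟩ := s.2
  induction N generalizing m s with
  | zero =>
    have : s = Seq.vac m := Seq.ext fun k => hN k (Nat.zero_le k)
    rw [this]
    exact hvac m
  | succ N ih =>
    rw [← s.cons_tail]
    refine hcons m _ _ (ih _ _ fun k hk => ?_)
    change s.1 (k + 1) = _
    rw [hN (k + 1) (by omega)]
    push_cast
    ring

/-- A family of linear maps out of the `F_(m)` is determined by its behaviour on the vacua and
under wedging. -/
theorem Fock.hom_eq_zero {q : 𝕜} {n : ℕ} {M : ℤ → Type*} [∀ m, AddCommGroup (M m)]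
    [∀ m, Module 𝕜 (M m)] (f : ∀ m, Fock q n m →ₗ[𝕜] M m) (hvac : ∀ m, f m (vacuum q n m) = 0)
    (hwedge : ∀ m l (x : Fock q n (m - 1)), f (m - 1) x = 0 →
      f m (wedge q n m (Finsupp.single l 1) x) = 0) (m : ℤ) : f m = 0 := by
  refine Fock.hom_ext fun s => ?_
  rw [LinearMap.zero_apply]
  refine Seq.induction (P := fun m s => f m (pureWedge q n s) = 0) hvac (fun m l s hs => ?_) m s
  rw [← wedge_single_pureWedge]
  exact hwedge m l _ hs

end Straightening

/-! ### The action of the Chevalley generators on semi-infinite tensors -/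

section Operators

variable {𝕜 : Type*} [Field 𝕜] {m : ℤ}

/-- `1` if `l ≡ i` modulo `n`, and `0` otherwise. -/
def kron (n : ℕ) (i : ZMod n) (l : ℤ) : ℤ := if (l : ZMod n) = i then 1 else 0

theorem wt_eq (n : ℕ) (i : ZMod n) (l : ℤ) : wt n i l = kron n i l - kron n i (l - 1) := by
  simp [wt, kron, sub_eq_iff_eq_add]

theorem wt_add (n : ℕ) (i : ZMod n) (l : ℤ) : wt n i (l + n) = wt n i l := by
  simp [wt]

/-- `E_i` acting in the factor `k`. -/
def posE (𝕜 : Type*) [Field 𝕜] (n : ℕ) (m : ℤ) (i : ZMod n) (k : ℕ) : Module.End 𝕜 (Tens 𝕜 m) :=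
  Finsupp.linearCombination 𝕜 fun s : Seq m =>
    if ((s.1 k - 1 : ℤ) : ZMod n) = i then Finsupp.single (s.upd k (s.1 k - 1)) (1 : 𝕜) else 0

/-- `F_i` acting in the factor `k`. -/
def posF (𝕜 : Type*) [Field 𝕜] (n : ℕ) (m : ℤ) (i : ZMod n) (k : ℕ) : Module.End 𝕜 (Tens 𝕜 m) :=
  Finsupp.linearCombination 𝕜 fun s : Seq m =>
    if (s.1 k : ZMod n) = i then Finsupp.single (s.upd k (s.1 k + 1)) (1 : 𝕜) else 0

/-- The diagonal operator with eigenvalues `q ^ f s`. -/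
def diagQ (q : 𝕜) (f : Seq m → ℤ) : Module.End 𝕜 (Tens 𝕜 m) :=
  Finsupp.linearCombination 𝕜 fun s : Seq m => Finsupp.single s (q ^ f s)

theorem posE_single (n : ℕ) (i : ZMod n) (k : ℕ) (s : Seq m) :
    posE 𝕜 n m i k (Finsupp.single s 1) =
      if ((s.1 k - 1 : ℤ) : ZMod n) = i then Finsupp.single (s.upd k (s.1 k - 1)) (1 : 𝕜) else 0 := by
  rw [posE, Finsupp.linearCombination_single, one_smul]

theorem posF_single (n : ℕ) (i : ZMod n) (k : ℕ) (s : Seq m) :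
    posF 𝕜 n m i k (Finsupp.single s 1) =
      if (s.1 k : ZMod n) = i then Finsupp.single (s.upd k (s.1 k + 1)) (1 : 𝕜) else 0 := by
  rw [posF, Finsupp.linearCombination_single, one_smul]

theorem diagQ_single (q : 𝕜) (f : Seq m → ℤ) (s : Seq m) :
    diagQ q f (Finsupp.single s 1) = q ^ f s • Finsupp.single s 1 := by
  rw [diagQ, Finsupp.linearCombination_single, one_smul, Finsupp.smul_single, smul_eq_mul, mul_one]

theorem diagQ_mul {q : 𝕜} (hq : q ≠ 0) (f g : Seq m → ℤ) :
    diagQ q f * diagQ q g = diagQ q fun s => f s + g s := by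
  refine End_ext fun s => ?_
  rw [Module.End.mul_apply, diagQ_single, diagQ_single, map_smul, diagQ_single, smul_smul,
    zpow_add₀ hq, mul_comm]

theorem commute_diagQ_posShift (q : 𝕜) (n : ℕ) (k : ℕ) {f : Seq m → ℤ}
    (h : ∀ s, f (s.upd k (s.1 k + n)) = f s) : Commute (diagQ q f) (posShift 𝕜 n m k) := by
  refine End_ext fun s => ?_
  rw [Module.End.mul_apply, Module.End.mul_apply, posShift_single, diagQ_single, diagQ_single,
    map_smul, posShift_single, h]

theorem Seq.upd_comm (s : Seq m) {j k : ℕ} (h : j ≠ k) (a b : ℤ) :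
    (s.upd j a).upd k b = (s.upd k b).upd j a :=
  Seq.ext fun i => by simp only [Seq.upd_apply]; split_ifs <;> first | rfl | omega

theorem commute_posE_posShift (n : ℕ) (i : ZMod n) (j k : ℕ) :
    Commute (posE 𝕜 n m i j) (posShift 𝕜 n m k) := by
  refine End_ext fun s => ?_
  rw [Module.End.mul_apply, Module.End.mul_apply, posShift_single, posE_single, posE_single]
  rcases eq_or_ne j k with rfl | h
  · simp only [Seq.upd_apply, if_true, Seq.upd_upd]
    push_cast
    rw [ZMod.natCast_self, add_zero]
    split_ifs
    · rw [posShift_single, Seq.upd_upd, Seq.upd_apply, if_pos rfl]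
      congr 2
      ring
    · rw [map_zero]
  · simp only [Seq.upd_apply, if_neg h]
    split_ifs
    · rw [posShift_single, Seq.upd_comm _ h, Seq.upd_apply, if_neg h.symm]
    · rw [map_zero]

theorem commute_posF_posShift (n : ℕ) (i : ZMod n) (j k : ℕ) :
    Commute (posF 𝕜 n m i j) (posShift 𝕜 n m k) := by
  refine End_ext fun s => ?_
  rw [Module.End.mul_apply, Module.End.mul_apply, posShift_single, posF_single, posF_single]
  rcases eq_or_ne j k with rfl | h
  · simp only [Seq.upd_apply, if_true, Seq.upd_upd]
    push_cast
    rw [ZMod.natCast_self, add_zero]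
    split_ifs
    · rw [posShift_single, Seq.upd_upd, Seq.upd_apply, if_pos rfl]
      congr 2
      ring
    · rw [map_zero]
  · simp only [Seq.upd_apply, if_neg h]
    split_ifs
    · rw [posShift_single, Seq.upd_comm _ h, Seq.upd_apply, if_neg h.symm]
    · rw [map_zero]

/-! #### Commutation with the Hecke operators -/

theorem hecke_commute_diagQ (q : 𝕜) {n : ℕ} (hn : 0 < n) (k : ℕ) {f : Seq m → ℤ}
    (h1 : ∀ s, f (s.upd k (s.1 k + n)) = f s)
    (h2 : ∀ s, f (s.upd (k + 1) (s.1 (k + 1) + n)) = f s) (h3 : ∀ s, f (s.swap k) = f s) :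
    Commute (hecke q n m k) (diagQ q f) := by
  refine hecke_commute_of_away q hn k _ (commute_diagQ_posShift q n k h1)
    (commute_diagQ_posShift q n (k + 1) h2) (fun s => ?_) fun s => ?_
  · rw [diagQ_single]
    exact Submodule.smul_mem _ _ (Finsupp.single_mem_supported 𝕜 _ ⟨rfl, rfl⟩)
  · rw [diagQ_single, diagQ_single, Finsupp.mapDomain_smul, Finsupp.mapDomain_single, h3]

/-- The total weight of the entries in the positions in `A`. -/
def wtSum (n : ℕ) (i : ZMod n) (A : Finset ℕ) (s : Seq m) : ℤ := ∑ p ∈ A, wt n i (s.1 p)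

theorem wtSum_upd_add (n : ℕ) (i : ZMod n) (A : Finset ℕ) (k : ℕ) (s : Seq m) :
    wtSum n i A (s.upd k (s.1 k + n)) = wtSum n i A s :=
  Finset.sum_congr rfl fun p _ => by
    rw [Seq.upd_apply]
    split_ifs with h
    · rw [wt_add, h]
    · rfl

theorem wtSum_swap (n : ℕ) (i : ZMod n) {A : Finset ℕ} {k : ℕ} (h : k ∈ A ↔ k + 1 ∈ A) (s : Seq m) :
    wtSum n i A (s.swap k) = wtSum n i A s := by
  unfold wtSum
  refine Finset.sum_equiv (Equiv.swap k (k + 1)) (fun p => ?_) fun p _ => ?_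
  · rcases eq_or_ne p k with rfl | h1
    · rw [Equiv.swap_apply_left, h]
    · rcases eq_or_ne p (k + 1) with rfl | h2
      · rw [Equiv.swap_apply_right, h]
      · rw [Equiv.swap_apply_of_ne_of_ne h1 h2]
  · rcases eq_or_ne p k with rfl | h1
    · rw [Equiv.swap_apply_left, Seq.swap_apply, if_neg (by omega), if_pos rfl]
    · rcases eq_or_ne p (k + 1) with rfl | h2
      · rw [Equiv.swap_apply_right, Seq.swap_apply, if_pos rfl]
      · rw [Equiv.swap_apply_of_ne_of_ne h1 h2, Seq.swap_apply, if_neg h2, if_neg h1]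

theorem hecke_commute_posE (q : 𝕜) {n : ℕ} (hn : 0 < n) (i : ZMod n) {j k : ℕ} (h1 : j ≠ k)
    (h2 : j ≠ k + 1) : Commute (hecke q n m k) (posE 𝕜 n m i j) := by
  refine hecke_commute_of_away q hn k _ (commute_posE_posShift n i j k)
    (commute_posE_posShift n i j (k + 1)) (fun s => ?_) fun s => ?_
  · rw [posE_single]
    split_ifs
    · refine Finsupp.single_mem_supported 𝕜 _ ⟨?_, ?_⟩
      · rw [Seq.upd_apply, if_neg h1.symm]
      · rw [Seq.upd_apply, if_neg h2.symm]
    · exact Submodule.zero_mem _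
  · rw [posE_single, posE_single, Seq.swap_apply, if_neg h2, if_neg h1]
    split_ifs
    · rw [Finsupp.mapDomain_single]
      congr 1
      refine Seq.ext fun p => ?_
      simp only [Seq.swap_apply, Seq.upd_apply]
      split_ifs <;> first | rfl | omega
    · rw [Finsupp.mapDomain_zero]

theorem hecke_commute_posF (q : 𝕜) {n : ℕ} (hn : 0 < n) (i : ZMod n) {j k : ℕ} (h1 : j ≠ k)
    (h2 : j ≠ k + 1) : Commute (hecke q n m k) (posF 𝕜 n m i j) := by
  refine hecke_commute_of_away q hn k _ (commute_posF_posShift n i j k)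
    (commute_posF_posShift n i j (k + 1)) (fun s => ?_) fun s => ?_
  · rw [posF_single]
    split_ifs
    · refine Finsupp.single_mem_supported 𝕜 _ ⟨?_, ?_⟩
      · rw [Seq.upd_apply, if_neg h1.symm]
      · rw [Seq.upd_apply, if_neg h2.symm]
    · exact Submodule.zero_mem _
  · rw [posF_single, posF_single, Seq.swap_apply, if_neg h2, if_neg h1]
    split_ifs
    · rw [Finsupp.mapDomain_single]
      congr 1
      refine Seq.ext fun p => ?_
      simp only [Seq.swap_apply, Seq.upd_apply]
      split_ifs <;> first | rfl | omega
    · rw [Finsupp.mapDomain_zero]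

/-- In a window starting at a representative `c` of `i`, congruence becomes equality: `E_i` only
lowers `c + 1` to `c`, `F_i` only raises `c` to `c + 1`, and neither leaves the window. The bound `2
≤ n` keeps `c - 1` from being congruent to `c`. -/
theorem kron_of_window {n : ℕ} (hn : 2 ≤ n) {c a : ℤ} (h1 : c ≤ a) (h2 : a < c + n) :
    (((a : ℤ) : ZMod n) = (c : ZMod n) ↔ a = c) ∧
    (((a - 1 : ℤ) : ZMod n) = (c : ZMod n) ↔ a = c + 1) := by
  have key : ∀ b : ℤ, c - 1 ≤ b → b < c + n → (((b : ℤ) : ZMod n) = (c : ZMod n) ↔ b = c) := by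
    intro b hb hb'
    constructor
    · intro h
      rw [eq_comm, ZMod.intCast_eq_intCast_iff_dvd_sub] at h
      have := Int.eq_zero_of_abs_lt_dvd h (by rw [abs_lt]; omega)
      omega
    · rintro rfl; rfl
  refine ⟨key a (by omega) h2, ?_⟩
  rw [key (a - 1) (by omega) (by omega)]
  omega

theorem wt_of_window {n : ℕ} (hn : 2 ≤ n) {c a : ℤ} (h1 : c ≤ a) (h2 : a < c + n) :
    wt n (c : ZMod n) a = if a = c then 1 else if a = c + 1 then -1 else 0 := by
  obtain ⟨e1, e2⟩ := kron_of_window hn h1 h2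
  rw [wt_eq, kron, kron]
  simp only [e1, e2]
  split_ifs <;> first | rfl | omega

/-- This is `E ⊗ K + 1 ⊗ E` commuting with the Hecke operator on two factors. On a window starting
at a representative of `i`, it matters only whether each entry is `c`, `c + 1` or neither, and how
the two compare. -/
theorem hecke_commute_posE_pair {q : 𝕜} (hq : q ≠ 0) {n : ℕ} (hn : 2 ≤ n) (i : ZMod n) (k : ℕ) :
    Commute (hecke q n m k)
      (posE 𝕜 n m i k * diagQ q (fun s => wt n i (s.1 (k + 1))) + posE 𝕜 n m i (k + 1)) := by
  obtain ⟨c, rfl⟩ := ZMod.intCast_surjective i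
  have hd : ∀ j, Commute (diagQ q (fun s : Seq m => wt n (c : ZMod n) (s.1 (k + 1))))
      (posShift 𝕜 n m j) := fun j => commute_diagQ_posShift q n j fun s => by
    rw [Seq.upd_apply]
    split_ifs with h
    · rw [wt_add, h]
    · rfl
  refine hecke_commute_of_window q (by omega) k _
    (((commute_posE_posShift n _ k k).mul_left (hd k)).add_left (commute_posE_posShift n _ _ k))
    (((commute_posE_posShift n _ k _).mul_left (hd _)).add_left (commute_posE_posShift n _ _ _)) c
    fun s wa wb => ?_
  let e : ℤ → ℤ → Tens 𝕜 m := fun a b => Finsupp.single (s.replace k (a, b)) 1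
  have hs0 : Finsupp.single s 1 = e (s.1 k) (s.1 (k + 1)) := by
    simp only [e, Seq.replace_self]
  have HT : ∀ a b : ℤ, (c ≤ a ∧ a < c + n) → (c ≤ b ∧ b < c + n) → hecke q n m k (e a b) =
      if a < b then -q • e b a + (q ^ 2 - 1) • e a b else if a = b then - e a b
      else -q • e b a := fun a b ha hb =>
    hecke_replace q (by omega) k _ c a b ha.1 ha.2 hb.1 hb.2
  have H1 : ∀ a b : ℤ, (c ≤ a ∧ a < c + n) → (c ≤ b ∧ b < c + n) →
      (posE 𝕜 n m (c : ZMod n) k * diagQ q (fun s => wt n (c : ZMod n) (s.1 (k + 1))) +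
        posE 𝕜 n m (c : ZMod n) (k + 1) : Module.End 𝕜 (Tens 𝕜 m)) (e a b) =
      (if a = c + 1 then q ^ (if b = c then 1 else if b = c + 1 then -1 else 0 : ℤ) • e c b else 0) +
        (if b = c + 1 then e a c else 0) := by
    intro a b ha hb
    have r1 : (s.replace k (a, b)).1 k = a := by
      rw [Seq.replace_apply, if_neg (by omega), if_pos rfl]
    have r2 : (s.replace k (a, b)).1 (k + 1) = b := by
      rw [Seq.replace_apply, if_pos rfl]
    simp only [e]
    rw [LinearMap.add_apply, Module.End.mul_apply, diagQ_single, map_smul, posE_single, posE_single,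
      r1, r2, wt_of_window hn hb.1 hb.2]
    simp only [(kron_of_window hn ha.1 ha.2).2, (kron_of_window hn hb.1 hb.2).2]
    rw [smul_ite, smul_zero]
    congr 1
    · refine if_ctx_congr Iff.rfl (fun h => ?_) fun _ => rfl
      congr 2
      refine Seq.ext fun p => ?_
      simp only [Seq.replace_apply, Seq.upd_apply]
      split_ifs <;> first | rfl | omega
    · refine if_ctx_congr Iff.rfl (fun h => ?_) fun _ => rfl
      congr 1
      refine Seq.ext fun p => ?_
      simp only [Seq.replace_apply, Seq.upd_apply]
      split_ifs <;> first | rfl | omega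
  rw [hs0]
  have wc : c ≤ c ∧ c < c + n := by omega
  generalize s.1 k = a at *
  generalize s.1 (k + 1) = b at *
  have dich : ∀ x : ℤ, (c ≤ x ∧ x < c + n) → x = c ∨ x = c + 1 ∨
      (¬ x = c ∧ ¬ x = c + 1 ∧ c < x ∧ c + 1 < x ∧ ¬ x < c ∧ ¬ x < c + 1 ∧ ¬ c = x ∧ ¬ c + 1 = x) := by
    intro x hx; omega
  have tri : (a < b ∧ ¬ b < a ∧ ¬ a = b ∧ ¬ b = a) ∨ a = b ∨
      (b < a ∧ ¬ a < b ∧ ¬ a = b ∧ ¬ b = a) := by omega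
  have c1 : ¬ c = c + 1 := by omega
  have c2 : ¬ c + 1 = c := by omega
  have c3 : c < c + 1 := by omega
  have c4 : ¬ c + 1 < c := by omega
  have hT := HT a b wa wb
  have h1 := H1 a b wa wb
  have h2 := H1 b a wb wa
  have hT1 := HT c b wc wb
  have hT2 := HT a c wa wc
  generalize (posE 𝕜 n m (c : ZMod n) k * diagQ q (fun s => wt n (c : ZMod n) (s.1 (k + 1))) +
        posE 𝕜 n m (c : ZMod n) (k + 1) : Module.End 𝕜 (Tens 𝕜 m)) = P at *
  generalize hecke q n m k = T at *
  clear H1 HT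
  rcases dich a wa with ha | ha | ha <;> rcases dich b wb with hb | hb | hb <;>
    rcases tri with ab | ab | ab <;>
  first
  | omega
  | simp only [ha, hb, ab, c1, c2, c3, c4, if_true, if_false, lt_irrefl, add_zero, zero_add]
      at hT h1 h2 hT1 hT2 ⊢
    simp only [hT, h1, h2, hT1, hT2, map_add, map_smul, map_neg, map_zero]
    try simp only [zpow_one, zpow_neg, zpow_zero, one_smul]
    all_goals (match_scalars <;> field_simp <;> ring)

theorem hecke_commute_posF_pair {q : 𝕜} (hq : q ≠ 0) {n : ℕ} (hn : 2 ≤ n) (i : ZMod n) (k : ℕ) :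
    Commute (hecke q n m k)
      (posF 𝕜 n m i k + posF 𝕜 n m i (k + 1) * diagQ q (fun s => -wt n i (s.1 k))) := by
  obtain ⟨c, rfl⟩ := ZMod.intCast_surjective i
  have hd : ∀ j, Commute (diagQ q (fun s : Seq m => -wt n (c : ZMod n) (s.1 k)))
      (posShift 𝕜 n m j) := fun j => commute_diagQ_posShift q n j fun s => by
    rw [Seq.upd_apply]
    split_ifs with h
    · rw [wt_add, h]
    · rfl
  refine hecke_commute_of_window q (by omega) k _
    ((commute_posF_posShift n _ k k).add_left ((commute_posF_posShift n _ _ k).mul_left (hd k)))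
    ((commute_posF_posShift n _ k _).add_left ((commute_posF_posShift n _ _ _).mul_left (hd _))) c
    fun s wa wb => ?_
  let e : ℤ → ℤ → Tens 𝕜 m := fun a b => Finsupp.single (s.replace k (a, b)) 1
  have hs0 : Finsupp.single s 1 = e (s.1 k) (s.1 (k + 1)) := by
    simp only [e, Seq.replace_self]
  have HT : ∀ a b : ℤ, (c ≤ a ∧ a < c + n) → (c ≤ b ∧ b < c + n) → hecke q n m k (e a b) =
      if a < b then -q • e b a + (q ^ 2 - 1) • e a b else if a = b then - e a b
      else -q • e b a := fun a b ha hb =>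
    hecke_replace q (by omega) k _ c a b ha.1 ha.2 hb.1 hb.2
  have H1 : ∀ a b : ℤ, (c ≤ a ∧ a < c + n) → (c ≤ b ∧ b < c + n) →
      (posF 𝕜 n m (c : ZMod n) k +
        posF 𝕜 n m (c : ZMod n) (k + 1) * diagQ q (fun s => -wt n (c : ZMod n) (s.1 k)) : Module.End 𝕜 (Tens 𝕜 m)) (e a b) =
      (if a = c then e (c + 1) b else 0) +
        (if b = c then q ^ (-(if a = c then 1 else if a = c + 1 then -1 else 0) : ℤ) • e a (c + 1)
          else 0) := by
    intro a b ha hb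
    have r1 : (s.replace k (a, b)).1 k = a := by
      rw [Seq.replace_apply, if_neg (by omega), if_pos rfl]
    have r2 : (s.replace k (a, b)).1 (k + 1) = b := by
      rw [Seq.replace_apply, if_pos rfl]
    simp only [e]
    rw [LinearMap.add_apply, Module.End.mul_apply, diagQ_single, map_smul, posF_single, posF_single,
      r1, r2, wt_of_window hn ha.1 ha.2]
    simp only [(kron_of_window hn ha.1 ha.2).1, (kron_of_window hn hb.1 hb.2).1]
    rw [smul_ite, smul_zero]
    congr 1
    · refine if_ctx_congr Iff.rfl (fun h => ?_) fun _ => rfl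
      congr 1
      refine Seq.ext fun p => ?_
      simp only [Seq.replace_apply, Seq.upd_apply]
      split_ifs <;> first | rfl | omega
    · refine if_ctx_congr Iff.rfl (fun h => ?_) fun _ => rfl
      congr 2
      refine Seq.ext fun p => ?_
      simp only [Seq.replace_apply, Seq.upd_apply]
      split_ifs <;> first | rfl | omega
  rw [hs0]
  have wc : c ≤ c + 1 ∧ c + 1 < c + n := by omega
  generalize s.1 k = a at *
  generalize s.1 (k + 1) = b at *
  have dich : ∀ x : ℤ, (c ≤ x ∧ x < c + n) → x = c ∨ x = c + 1 ∨
      (¬ x = c ∧ ¬ x = c + 1 ∧ c < x ∧ c + 1 < x ∧ ¬ x < c ∧ ¬ x < c + 1 ∧ ¬ c = x ∧ ¬ c + 1 = x) := by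
    intro x hx; omega
  have tri : (a < b ∧ ¬ b < a ∧ ¬ a = b ∧ ¬ b = a) ∨ a = b ∨
      (b < a ∧ ¬ a < b ∧ ¬ a = b ∧ ¬ b = a) := by omega
  have c1 : ¬ c = c + 1 := by omega
  have c2 : ¬ c + 1 = c := by omega
  have c3 : c < c + 1 := by omega
  have c4 : ¬ c + 1 < c := by omega
  have hT := HT a b wa wb
  have h1 := H1 a b wa wb
  have h2 := H1 b a wb wa
  have hT1 := HT (c + 1) b wc wb
  have hT2 := HT a (c + 1) wa wc
  generalize (posF 𝕜 n m (c : ZMod n) k +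
        posF 𝕜 n m (c : ZMod n) (k + 1) * diagQ q (fun s => -wt n (c : ZMod n) (s.1 k)) : Module.End 𝕜 (Tens 𝕜 m)) = P at *
  generalize hecke q n m k = T at *
  clear H1 HT
  rcases dich a wa with ha | ha | ha <;> rcases dich b wb with hb | hb | hb <;>
    rcases tri with ab | ab | ab <;>
  first
  | omega
  | simp only [ha, hb, ab, c1, c2, c3, c4, if_true, if_false, lt_irrefl, add_zero, zero_add]
      at hT h1 h2 hT1 hT2 ⊢
    simp only [hT, h1, h2, hT1, hT2, map_add, map_smul, map_neg, map_zero]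
    try simp only [zpow_one, neg_neg, neg_zero, zpow_neg, zpow_zero, one_smul]
    all_goals (match_scalars <;> field_simp <;> ring)

end Operators

/-! ### The Chevalley generators on the wedge spaces -/

section Truncated

variable {𝕜 : Type*} [Field 𝕜] {m : ℤ}

/-- The operator `E_i`, with all factors from position `N` on treated as a vacuum. -/
def truncE (q : 𝕜) (n : ℕ) (m : ℤ) (i : ZMod n) (N : ℕ) : Module.End 𝕜 (Tens 𝕜 m) :=
  ∑ k ∈ Finset.range N, posE 𝕜 n m i k *
    diagQ q (fun s => wtSum n i (Finset.Ico (k + 1) N) s + kron n i (m - N))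

/-- The operator `F_i`, truncated to the factors before position `N`. -/
def truncF (q : 𝕜) (n : ℕ) (m : ℤ) (i : ZMod n) (N : ℕ) : Module.End 𝕜 (Tens 𝕜 m) :=
  ∑ k ∈ Finset.range N, posF 𝕜 n m i k * diagQ q (fun s => -wtSum n i (Finset.range k) s)

/-- The operator `K_i ^ e`, with all factors from position `N` on treated as a vacuum. -/
def truncK (q : 𝕜) (n : ℕ) (m : ℤ) (i : ZMod n) (e : ℤ) (N : ℕ) : Module.End 𝕜 (Tens 𝕜 m) :=
  diagQ q (fun s => e * (wtSum n i (Finset.range N) s + kron n i (m - N)))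

theorem truncE_single (q : 𝕜) (n : ℕ) (i : ZMod n) (N : ℕ) (s : Seq m) :
    truncE q n m i N (Finsupp.single s 1) = ∑ k ∈ Finset.range N,
      q ^ (wtSum n i (Finset.Ico (k + 1) N) s + kron n i (m - N)) •
        posE 𝕜 n m i k (Finsupp.single s 1) := by
  rw [truncE, LinearMap.sum_apply]
  exact Finset.sum_congr rfl fun k _ => by
    rw [Module.End.mul_apply, diagQ_single, map_smul]

theorem truncF_single (q : 𝕜) (n : ℕ) (i : ZMod n) (N : ℕ) (s : Seq m) :
    truncF q n m i N (Finsupp.single s 1) = ∑ k ∈ Finset.range N,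
      q ^ (-wtSum n i (Finset.range k) s) • posF 𝕜 n m i k (Finsupp.single s 1) := by
  rw [truncF, LinearMap.sum_apply]
  exact Finset.sum_congr rfl fun k _ => by
    rw [Module.End.mul_apply, diagQ_single, map_smul]

theorem truncK_single (q : 𝕜) (n : ℕ) (i : ZMod n) (e : ℤ) (N : ℕ) (s : Seq m) :
    truncK q n m i e N (Finsupp.single s 1) =
      q ^ (e * (wtSum n i (Finset.range N) s + kron n i (m - N))) • Finsupp.single s 1 := by
  rw [truncK, diagQ_single]

theorem hecke_commute_wtSum (q : 𝕜) {n : ℕ} (hn : 0 < n) (i : ZMod n) (g : ℤ → ℤ) {A : Finset ℕ}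
    {k : ℕ} (h : k ∈ A ↔ k + 1 ∈ A) :
    Commute (hecke q n m k) (diagQ q fun s => g (wtSum n i A s)) :=
  hecke_commute_diagQ q hn k (fun s => by rw [wtSum_upd_add]) (fun s => by rw [wtSum_upd_add])
    fun s => by rw [wtSum_swap n i h]

theorem sum_range_eq_add_add {M : Type*} [AddCommMonoid M] (f : ℕ → M) {k N : ℕ} (h : k + 1 < N) :
    ∑ j ∈ Finset.range N, f j =
      f k + f (k + 1) + ∑ j ∈ ((Finset.range N).erase k).erase (k + 1), f j := by
  rw [← Finset.add_sum_erase _ f (Finset.mem_range.2 (show k < N by omega)),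
    ← Finset.add_sum_erase _ f (Finset.mem_erase.2 ⟨show k + 1 ≠ k by omega, Finset.mem_range.2 h⟩),
    add_assoc]

/-- The terms `k` and `k + 1` combine to the two-factor coproduct times a common weight. Every other
term changes a factor away from these two, and its weight involves both positions or neither, so it
is symmetric in them. -/
theorem hecke_commute_truncE {q : 𝕜} (hq : q ≠ 0) {n : ℕ} (hn : 2 ≤ n) (i : ZMod n) {k N : ℕ}
    (h : k + 1 < N) : Commute (hecke q n m k) (truncE q n m i N) := by
  have hn0 : 0 < n := by omega
  rw [truncE, sum_range_eq_add_add _ h]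
  refine Commute.add_right ?_ (Commute.sum_right _ _ _ fun j hj => ?_)
  · have e : posE 𝕜 n m i k *
        diagQ q (fun s => wtSum n i (Finset.Ico (k + 1) N) s + kron n i (m - N)) +
        posE 𝕜 n m i (k + 1) *
        diagQ q (fun s => wtSum n i (Finset.Ico (k + 1 + 1) N) s + kron n i (m - N)) =
        (posE 𝕜 n m i k * diagQ q (fun s => wt n i (s.1 (k + 1))) + posE 𝕜 n m i (k + 1)) *
        diagQ q (fun s => wtSum n i (Finset.Ico (k + 1 + 1) N) s + kron n i (m - N)) := by
      rw [add_mul, mul_assoc, diagQ_mul hq]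
      congr 3
      funext s
      rw [wtSum, Finset.sum_eq_sum_Ico_succ_bot (by omega), wtSum, add_assoc]
    rw [e]
    exact (hecke_commute_posE_pair hq hn i k).mul_right
      (hecke_commute_wtSum q hn0 i (· + kron n i (m - N)) (by simp only [Finset.mem_Ico]; omega))
  · simp only [Finset.mem_erase] at hj
    exact (hecke_commute_posE q hn0 i hj.2.1 hj.1).mul_right
      (hecke_commute_wtSum q hn0 i (· + kron n i (m - N)) (by simp only [Finset.mem_Ico]; omega))

theorem hecke_commute_truncF {q : 𝕜} (hq : q ≠ 0) {n : ℕ} (hn : 2 ≤ n) (i : ZMod n) {k N : ℕ}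
    (h : k + 1 < N) : Commute (hecke q n m k) (truncF q n m i N) := by
  have hn0 : 0 < n := by omega
  rw [truncF, sum_range_eq_add_add _ h]
  refine Commute.add_right ?_ (Commute.sum_right _ _ _ fun j hj => ?_)
  · have e : posF 𝕜 n m i k * diagQ q (fun s => -wtSum n i (Finset.range k) s) +
        posF 𝕜 n m i (k + 1) * diagQ q (fun s => -wtSum n i (Finset.range (k + 1)) s) =
        (posF 𝕜 n m i k + posF 𝕜 n m i (k + 1) * diagQ q (fun s => -wt n i (s.1 k))) *
        diagQ q (fun s => -wtSum n i (Finset.range k) s) := by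
      rw [add_mul, mul_assoc, diagQ_mul hq]
      congr 3
      funext s
      rw [wtSum, Finset.sum_range_succ, wtSum]
      ring
    rw [e]
    exact (hecke_commute_posF_pair hq hn i k).mul_right
      (hecke_commute_wtSum q hn0 i (fun x => -x) (by simp only [Finset.mem_range]; omega))
  · simp only [Finset.mem_erase] at hj
    exact (hecke_commute_posF q hn0 i hj.2.1 hj.1).mul_right
      (hecke_commute_wtSum q hn0 i (fun x => -x) (by simp only [Finset.mem_range]; omega))

theorem hecke_commute_truncK (q : 𝕜) {n : ℕ} (hn : 2 ≤ n) (i : ZMod n) (e : ℤ) {k N : ℕ}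
    (h : k + 1 < N) : Commute (hecke q n m k) (truncK q n m i e N) :=
  hecke_commute_wtSum q (by omega) i (fun x => e * (x + kron n i (m - N)))
    (by simp only [Finset.mem_range]; omega)

/-! #### Passing to the wedge space -/

theorem mkQ_upd_eq_zero (q : 𝕜) {n : ℕ} (hn : 0 < n) {s : Seq m} {k : ℕ} {l : ℤ}
    (h : (s.upd k l).1 k = (s.upd k l).1 (k + 1) ∨
      ∃ j, k = j + 1 ∧ (s.upd k l).1 j = (s.upd k l).1 k) :
    (wedgeRel q n m).mkQ (Finsupp.single (s.upd k l) 1) = 0 := by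
  rcases h with h | ⟨j, rfl, h⟩
  · exact pureWedge_eq_zero q hn h
  · exact pureWedge_eq_zero q hn h

/-- `wt` is a difference of consecutive values of `kron`, so splitting one factor off a vacuum
leaves the total weight unchanged. -/
theorem kron_sub_succ (n : ℕ) (i : ZMod n) (N : ℕ) :
    wt n i (m - (N + 1 : ℕ)) + kron n i (m - (N + 2 : ℕ)) = kron n i (m - (N + 1 : ℕ)) := by
  rw [wt_eq, show m - ((N + 2 : ℕ) : ℤ) = m - (N + 1 : ℕ) - 1 by push_cast; ring]
  ring

/-- The additional term lowers the vacuum entry at position `N + 1` onto its right neighbour and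
dies; the weights of the other terms agree by telescoping. -/
theorem mkQ_truncE_succ (q : 𝕜) {n : ℕ} (hn : 0 < n) (i : ZMod n) {s : Seq m} {N : ℕ}
    (h : ∀ k, N ≤ k → s.1 k = m - k) :
    (wedgeRel q n m).mkQ (truncE q n m i (N + 2) (Finsupp.single s 1)) =
      (wedgeRel q n m).mkQ (truncE q n m i (N + 1) (Finsupp.single s 1)) := by
  rw [truncE_single, truncE_single, Finset.sum_range_succ, map_add]
  have h0 : (wedgeRel q n m).mkQ (posE 𝕜 n m i (N + 1) (Finsupp.single s 1)) = 0 := by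
    rw [posE_single]
    split_ifs
    · refine mkQ_upd_eq_zero q hn (Or.inl ?_)
      rw [Seq.upd_apply, Seq.upd_apply, if_pos rfl, if_neg (by omega), h _ (by omega),
        h _ (by omega)]
      push_cast
      ring
    · rw [map_zero]
  rw [map_smul, h0, smul_zero, add_zero]
  congr 1
  refine Finset.sum_congr rfl fun k hk => ?_
  rw [Finset.mem_range] at hk
  congr 2
  rw [wtSum, Finset.sum_Ico_succ_top (by omega), wtSum, add_assoc, h (N + 1) (by omega),
    kron_sub_succ]

/-- The additional term raises the entry at `N + 1` onto its left neighbour at `N`, which must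
already belong to the vacuum tail. This is why a tail starting at `N` calls for truncation at `N +
1`. -/
theorem mkQ_truncF_succ (q : 𝕜) {n : ℕ} (hn : 0 < n) (i : ZMod n) {s : Seq m} {N : ℕ}
    (h : ∀ k, N ≤ k → s.1 k = m - k) :
    (wedgeRel q n m).mkQ (truncF q n m i (N + 2) (Finsupp.single s 1)) =
      (wedgeRel q n m).mkQ (truncF q n m i (N + 1) (Finsupp.single s 1)) := by
  rw [truncF_single, truncF_single, Finset.sum_range_succ, map_add]
  have h0 : (wedgeRel q n m).mkQ (posF 𝕜 n m i (N + 1) (Finsupp.single s 1)) = 0 := by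
    rw [posF_single]
    split_ifs
    · refine mkQ_upd_eq_zero q hn (Or.inr ⟨N, rfl, ?_⟩)
      rw [Seq.upd_apply, Seq.upd_apply, if_pos rfl, if_neg (by omega), h _ (by omega),
        h _ (by omega)]
      push_cast
      ring
    · rw [map_zero]
  rw [map_smul, h0, smul_zero, add_zero]

theorem mkQ_truncK_succ (q : 𝕜) (n : ℕ) (i : ZMod n) (e : ℤ) {s : Seq m} {N : ℕ}
    (h : ∀ k, N ≤ k → s.1 k = m - k) :
    (wedgeRel q n m).mkQ (truncK q n m i e (N + 2) (Finsupp.single s 1)) =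
      (wedgeRel q n m).mkQ (truncK q n m i e (N + 1) (Finsupp.single s 1)) := by
  rw [truncK_single, truncK_single, wtSum, Finset.sum_range_succ, wtSum, add_assoc,
    h (N + 1) (by omega), kron_sub_succ]

/-- No single truncation serves all of `U_(m)`, but on each tensor the truncations eventually agree
in the quotient. For a given `x` in `Ker (T_k + 1)` one large truncation computes the limit and
commutes with `T_k`, so its value lies in the same kernel. -/
theorem exists_descend {q : 𝕜} {n : ℕ} (Op : ℕ → Module.End 𝕜 (Tens 𝕜 m))
    (hcomm : ∀ N k, k + 1 < N → Commute (hecke q n m k) (Op N))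
    (hstab : ∀ (s : Seq m) (N : ℕ), (∀ k, N ≤ k → s.1 k = m - k) →
      (wedgeRel q n m).mkQ (Op (N + 2) (Finsupp.single s 1)) =
        (wedgeRel q n m).mkQ (Op (N + 1) (Finsupp.single s 1))) :
    ∃ O : Module.End 𝕜 (Fock q n m), ∀ (s : Seq m) (N : ℕ), (∀ k, N ≤ k → s.1 k = m - k) →
      O (pureWedge q n s) = (wedgeRel q n m).mkQ (Op (N + 1) (Finsupp.single s 1)) := by
  have hstab' : ∀ (s : Seq m) (N : ℕ), (∀ k, N ≤ k → s.1 k = m - k) → ∀ N', N ≤ N' →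
      (wedgeRel q n m).mkQ (Op (N' + 1) (Finsupp.single s 1)) =
        (wedgeRel q n m).mkQ (Op (N + 1) (Finsupp.single s 1)) := by
    intro s N hN N' hN'
    induction N', hN' using Nat.le_induction with
    | base => rfl
    | succ N' h ih => rw [← ih]; exact hstab s N' fun k hk => hN k (by omega)
  -- An arbitrary start of the tail is chosen for each tensor; `hG` shows that the choice does not
  -- matter.
  choose τ hτ using fun s : Seq m => s.2
  let G : Tens 𝕜 m →ₗ[𝕜] Fock q n m := Finsupp.linearCombination 𝕜 fun s =>
    (wedgeRel q n m).mkQ (Op (τ s + 1) (Finsupp.single s 1))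
  have hG : ∀ (s : Seq m) (N : ℕ), (∀ k, N ≤ k → s.1 k = m - k) →
      G (Finsupp.single s 1) = (wedgeRel q n m).mkQ (Op (N + 1) (Finsupp.single s 1)) := by
    intro s N hN
    simp only [G, Finsupp.linearCombination_single, one_smul]
    rw [← hstab' s N hN (max N (τ s)) (le_max_left _ _),
      ← hstab' s (τ s) (hτ s) (max N (τ s)) (le_max_right _ _)]
  have hG' : ∀ x, ∃ N₀, ∀ N, N₀ ≤ N → G x = (wedgeRel q n m).mkQ (Op (N + 1) x) := by
    intro x
    induction x using Finsupp.induction_linear with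
    | zero => exact ⟨0, fun N _ => by simp only [map_zero]⟩
    | add f g hf hg =>
      obtain ⟨N₁, h1⟩ := hf
      obtain ⟨N₂, h2⟩ := hg
      exact ⟨max N₁ N₂, fun N hN => by
        simp only [map_add]
        rw [h1 N (le_of_max_le_left hN), h2 N (le_of_max_le_right hN)]⟩
    | single s a =>
      refine ⟨τ s, fun N hN => ?_⟩
      have : (Finsupp.single s a : Tens 𝕜 m) = a • Finsupp.single s 1 := by simp
      rw [this, map_smul, map_smul, map_smul, hG s N fun k hk => hτ s k (by omega)]
  have hker : wedgeRel q n m ≤ LinearMap.ker G := by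
    refine iSup_le fun k x hx => ?_
    rw [LinearMap.mem_ker] at hx ⊢
    obtain ⟨N, hN⟩ := hG' x
    rw [hN (max N (k + 1)) (le_max_left _ _), Submodule.mkQ_apply, Submodule.Quotient.mk_eq_zero]
    refine Submodule.mem_iSup_of_mem k ?_
    have h1 := LinearMap.congr_fun (hcomm (max N (k + 1) + 1) k (by omega)).eq x
    rw [Module.End.mul_apply, Module.End.mul_apply] at h1
    change hecke q n m k _ + Op _ x = 0
    rw [h1, ← map_add]
    change Op _ ((heckeT q n m k + LinearMap.id : Tens 𝕜 m →ₗ[𝕜] Tens 𝕜 m) x) = 0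
    rw [hx, map_zero]
  refine ⟨(wedgeRel q n m).liftQ G hker, fun s N hN => ?_⟩
  rw [← hG s N hN, pureWedge, Submodule.mkQ_apply, Submodule.liftQ_apply]

/-! #### Behaviour under wedging -/

theorem mkQ_tensCons (q : 𝕜) (n : ℕ) (l : ℤ) (x : Tens 𝕜 (m - 1)) :
    (wedgeRel q n m).mkQ (tensCons 𝕜 m l x) =
      wedge q n m (Finsupp.single l 1) ((wedgeRel q n (m - 1)).mkQ x) := by
  rw [wedge, Finsupp.linearCombination_single, one_smul, Submodule.mkQ_apply, Submodule.mkQ_apply,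
    Submodule.mapQ_apply]

theorem tensCons_single (l : ℤ) (s : Seq (m - 1)) (a : 𝕜) :
    tensCons 𝕜 m l (Finsupp.single s a) = Finsupp.single (Seq.cons l s) a := by
  rw [tensCons, Finsupp.lmapDomain_apply, Finsupp.mapDomain_single]

theorem Seq.cons_upd_succ (l : ℤ) (s : Seq (m - 1)) (k : ℕ) (a : ℤ) :
    (Seq.cons l s : Seq m).upd (k + 1) a = Seq.cons l (s.upd k a) :=
  Seq.ext fun j => by
    rw [Seq.upd_apply]
    cases j with
    | zero => rw [if_neg (by omega)]; rfl
    | succ j =>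
      change _ = (s.upd k a).1 j
      rw [Seq.upd_apply]
      simp only [Nat.add_right_cancel_iff]
      rfl

theorem Seq.cons_upd_zero (l : ℤ) (s : Seq (m - 1)) (a : ℤ) :
    (Seq.cons l s : Seq m).upd 0 a = Seq.cons a s :=
  Seq.ext fun j => by
    rw [Seq.upd_apply]
    cases j with
    | zero => rfl
    | succ j => rw [if_neg (by omega)]; rfl

theorem posE_cons_succ (n : ℕ) (i : ZMod n) (k : ℕ) (l : ℤ) (s : Seq (m - 1)) :
    posE 𝕜 n m i (k + 1) (Finsupp.single (Seq.cons l s) 1) =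
      tensCons 𝕜 m l (posE 𝕜 n (m - 1) i k (Finsupp.single s 1)) := by
  have h : (Seq.cons l s : Seq m).1 (k + 1) = s.1 k := rfl
  rw [posE_single, posE_single, h, Seq.cons_upd_succ]
  split_ifs
  · rw [tensCons_single]
  · rw [map_zero]

theorem posF_cons_succ (n : ℕ) (i : ZMod n) (k : ℕ) (l : ℤ) (s : Seq (m - 1)) :
    posF 𝕜 n m i (k + 1) (Finsupp.single (Seq.cons l s) 1) =
      tensCons 𝕜 m l (posF 𝕜 n (m - 1) i k (Finsupp.single s 1)) := by
  have h : (Seq.cons l s : Seq m).1 (k + 1) = s.1 k := rfl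
  rw [posF_single, posF_single, h, Seq.cons_upd_succ]
  split_ifs
  · rw [tensCons_single]
  · rw [map_zero]

theorem kron_charge (n : ℕ) (i : ZMod n) (N : ℕ) :
    kron n i (m - (N + 1 : ℕ)) = kron n i (m - 1 - N) := by
  congr 1
  push_cast
  ring

/-- The term of the first factor carries the `K`-weight of everything to its right, and the other
terms form the same operator on the tail; this is the coproduct `E ⊗ K + 1 ⊗ E` at the truncated
level. -/
theorem truncE_cons (q : 𝕜) (n : ℕ) (i : ZMod n) (N : ℕ) (l : ℤ) (s : Seq (m - 1)) :
    truncE q n m i (N + 1) (Finsupp.single (Seq.cons l s) 1) =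
      q ^ (wtSum n i (Finset.range N) s + kron n i (m - 1 - N)) •
        (if ((l - 1 : ℤ) : ZMod n) = i then tensCons 𝕜 m (l - 1) (Finsupp.single s 1) else 0) +
      tensCons 𝕜 m l (truncE q n (m - 1) i N (Finsupp.single s 1)) := by
  have h0 : (Seq.cons l s : Seq m).1 0 = l := rfl
  rw [truncE_single, Finset.sum_range_succ', truncE_single, map_sum, add_comm]
  congr 1
  · rw [posE_single, h0, Seq.cons_upd_zero, tensCons_single, kron_charge]
    congr 3
    rw [wtSum, wtSum, Finset.sum_Ico_eq_sum_range, zero_add, Nat.add_sub_cancel]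
    exact Finset.sum_congr rfl fun p _ => by rw [Nat.add_comm 1 p]; rfl
  · refine Finset.sum_congr rfl fun k _ => ?_
    rw [posE_cons_succ, map_smul, kron_charge]
    congr 3
    rw [wtSum, wtSum, ← Finset.sum_Ico_add' _ (k + 1) N 1]
    rfl

theorem truncF_cons {q : 𝕜} (hq : q ≠ 0) (n : ℕ) (i : ZMod n) (N : ℕ) (l : ℤ) (s : Seq (m - 1)) :
    truncF q n m i (N + 1) (Finsupp.single (Seq.cons l s) 1) =
      (if (l : ZMod n) = i then tensCons 𝕜 m (l + 1) (Finsupp.single s 1) else 0) +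
      q ^ (-wt n i l) • tensCons 𝕜 m l (truncF q n (m - 1) i N (Finsupp.single s 1)) := by
  have h0 : (Seq.cons l s : Seq m).1 0 = l := rfl
  rw [truncF_single, Finset.sum_range_succ', truncF_single, map_sum, add_comm, Finset.smul_sum]
  congr 1
  · rw [posF_single, h0, Seq.cons_upd_zero, tensCons_single, wtSum, Finset.range_zero,
      Finset.sum_empty, neg_zero, zpow_zero, one_smul]
  · refine Finset.sum_congr rfl fun k _ => ?_
    rw [posF_cons_succ, map_smul, smul_smul, ← zpow_add₀ hq]
    congr 2
    rw [wtSum, wtSum, Finset.sum_range_succ', h0, neg_add_rev]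
    rfl

theorem truncK_cons {q : 𝕜} (hq : q ≠ 0) (n : ℕ) (i : ZMod n) (e : ℤ) (N : ℕ) (l : ℤ)
    (s : Seq (m - 1)) :
    truncK q n m i e (N + 1) (Finsupp.single (Seq.cons l s) 1) =
      q ^ (e * wt n i l) • tensCons 𝕜 m l (truncK q n (m - 1) i e N (Finsupp.single s 1)) := by
  have h0 : (Seq.cons l s : Seq m).1 0 = l := rfl
  rw [truncK_single, truncK_single, map_smul, smul_smul, ← zpow_add₀ hq, tensCons_single, ← mul_add,
    kron_charge]
  congr 3
  rw [wtSum, wtSum, Finset.sum_range_succ', h0, add_comm (wt n i l), add_right_comm]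
  rfl

end Truncated

/-! #### The operators on the wedge spaces -/

section WedgeOperators

variable {𝕜 : Type*} [Field 𝕜] {q : 𝕜} {n : ℕ}

theorem exists_fockE (hq : q ≠ 0) (hn : 2 ≤ n) (m : ℤ) (i : ZMod n) :
    ∃ O : Module.End 𝕜 (Fock q n m), ∀ (s : Seq m) (N : ℕ), (∀ k, N ≤ k → s.1 k = m - k) →
      O (pureWedge q n s) = (wedgeRel q n m).mkQ (truncE q n m i (N + 1) (Finsupp.single s 1)) :=
  exists_descend _ (fun _ _ h => hecke_commute_truncE hq hn i h)
    fun _ _ h => mkQ_truncE_succ q (by omega) i h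

theorem exists_fockF (hq : q ≠ 0) (hn : 2 ≤ n) (m : ℤ) (i : ZMod n) :
    ∃ O : Module.End 𝕜 (Fock q n m), ∀ (s : Seq m) (N : ℕ), (∀ k, N ≤ k → s.1 k = m - k) →
      O (pureWedge q n s) = (wedgeRel q n m).mkQ (truncF q n m i (N + 1) (Finsupp.single s 1)) :=
  exists_descend _ (fun _ _ h => hecke_commute_truncF hq hn i h)
    fun _ _ h => mkQ_truncF_succ q (by omega) i h

variable (q) in
theorem exists_fockK (hn : 2 ≤ n) (m : ℤ) (i : ZMod n) (e : ℤ) :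
    ∃ O : Module.End 𝕜 (Fock q n m), ∀ (s : Seq m) (N : ℕ), (∀ k, N ≤ k → s.1 k = m - k) →
      O (pureWedge q n s) =
        (wedgeRel q n m).mkQ (truncK q n m i e (N + 1) (Finsupp.single s 1)) :=
  exists_descend _ (fun _ _ h => hecke_commute_truncK q hn i e h)
    fun _ _ h => mkQ_truncK_succ q n i e h

/-- The operator `E_i` on `F_(m)`. -/
def fockE (hq : q ≠ 0) (hn : 2 ≤ n) (m : ℤ) (i : ZMod n) : Module.End 𝕜 (Fock q n m) :=
  (exists_fockE hq hn m i).choose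

/-- The operator `F_i` on `F_(m)`. -/
def fockF (hq : q ≠ 0) (hn : 2 ≤ n) (m : ℤ) (i : ZMod n) : Module.End 𝕜 (Fock q n m) :=
  (exists_fockF hq hn m i).choose

variable (q) in
/-- The operator `K_i ^ e` on `F_(m)`. -/
def fockK (hn : 2 ≤ n) (m : ℤ) (i : ZMod n) (e : ℤ) : Module.End 𝕜 (Fock q n m) :=
  (exists_fockK q hn m i e).choose

variable {m : ℤ} {s : Seq m} {N : ℕ}

theorem fockE_pureWedge (hq : q ≠ 0) (hn : 2 ≤ n) (i : ZMod n) (h : ∀ k, N ≤ k → s.1 k = m - k) :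
    fockE hq hn m i (pureWedge q n s) =
      (wedgeRel q n m).mkQ (truncE q n m i (N + 1) (Finsupp.single s 1)) :=
  (exists_fockE hq hn m i).choose_spec s N h

theorem fockF_pureWedge (hq : q ≠ 0) (hn : 2 ≤ n) (i : ZMod n) (h : ∀ k, N ≤ k → s.1 k = m - k) :
    fockF hq hn m i (pureWedge q n s) =
      (wedgeRel q n m).mkQ (truncF q n m i (N + 1) (Finsupp.single s 1)) :=
  (exists_fockF hq hn m i).choose_spec s N h

theorem fockK_pureWedge (hn : 2 ≤ n) (i : ZMod n) (e : ℤ) (h : ∀ k, N ≤ k → s.1 k = m - k) :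
    fockK q hn m i e (pureWedge q n s) =
      q ^ (e * (wtSum n i (Finset.range (N + 1)) s + kron n i (m - (N + 1 : ℕ)))) •
        pureWedge q n s := by
  rw [fockK, (exists_fockK q hn m i e).choose_spec s N h, truncK_single, map_smul, pureWedge]

theorem Seq.cons_apply_of_le {l : ℤ} {s : Seq (m - 1)} (h : ∀ k, N ≤ k → s.1 k = m - 1 - k) (k : ℕ)
    (hk : N + 1 ≤ k) : (Seq.cons l s : Seq m).1 k = m - k := by
  obtain ⟨k, rfl⟩ := Nat.exists_eq_add_of_le' (show 1 ≤ k by omega)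
  change s.1 k = _
  rw [h k (by omega)]
  push_cast
  ring

theorem wedge_hom_ext {M : Type*} [AddCommGroup M] [Module 𝕜 M]
    {f g : V 𝕜 →ₗ[𝕜] Fock q n (m - 1) →ₗ[𝕜] M}
    (h : ∀ l s, f (Finsupp.single l 1) (pureWedge q n s) = g (Finsupp.single l 1) (pureWedge q n s)) :
    f = g :=
  Finsupp.lhom_ext' fun l => LinearMap.ext_ring (Fock.hom_ext (h l))

theorem fockE_wedge (hq : q ≠ 0) (hn : 2 ≤ n) (i : ZMod n) (v : V 𝕜) (x : Fock q n (m - 1)) :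
    fockE hq hn m i (wedge q n m v x) =
      wedge q n m (evE n i v) (fockK q hn (m - 1) i 1 x) +
        wedge q n m v (fockE hq hn (m - 1) i x) := by
  refine LinearMap.congr_fun (LinearMap.congr_fun (wedge_hom_ext
    (f := (wedge q n m).compr₂ (fockE hq hn m i))
    (g := (wedge q n m).compl₁₂ (evE n i) (fockK q hn (m - 1) i 1) +
      (wedge q n m).compl₂ (fockE hq hn (m - 1) i)) fun l s => ?_) v) x
  obtain ⟨N, hN⟩ := s.2
  simp only [LinearMap.compr₂_apply, LinearMap.add_apply, LinearMap.compl₁₂_apply,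
    LinearMap.compl₂_apply]
  rw [wedge_single_pureWedge, fockE_pureWedge hq hn i (Seq.cons_apply_of_le hN), truncE_cons,
    map_add, mkQ_tensCons, fockE_pureWedge hq hn i hN, fockK_pureWedge hn i 1 hN, one_mul,
    map_smul, map_smul, evE, Finsupp.linearCombination_single, one_smul]
  congr 2
  split_ifs
  · rw [mkQ_tensCons, pureWedge]
  · rw [map_zero, map_zero, LinearMap.zero_apply]

theorem fockF_wedge (hq : q ≠ 0) (hn : 2 ≤ n) (i : ZMod n) (v : V 𝕜) (x : Fock q n (m - 1)) :
    fockF hq hn m i (wedge q n m v x) =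
      wedge q n m (evF n i v) x + wedge q n m (evKinv q n i v) (fockF hq hn (m - 1) i x) := by
  refine LinearMap.congr_fun (LinearMap.congr_fun (wedge_hom_ext
    (f := (wedge q n m).compr₂ (fockF hq hn m i))
    (g := (wedge q n m).comp (evF n i) +
      (wedge q n m).compl₁₂ (evKinv q n i) (fockF hq hn (m - 1) i)) fun l s => ?_) v) x
  obtain ⟨N, hN⟩ := s.2
  simp only [LinearMap.compr₂_apply, LinearMap.add_apply, LinearMap.compl₁₂_apply,
    LinearMap.comp_apply]
  rw [wedge_single_pureWedge, fockF_pureWedge hq hn i (Seq.cons_apply_of_le hN), truncF_cons hq,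
    map_add, map_smul, mkQ_tensCons, fockF_pureWedge hq hn i hN, evF, evKinv,
    Finsupp.linearCombination_single, Finsupp.linearCombination_single, one_smul, one_smul]
  congr 1
  · split_ifs
    · rw [mkQ_tensCons, pureWedge]
    · rw [map_zero, map_zero, LinearMap.zero_apply]
  · have : (Finsupp.single l (q ^ (-wt n i l)) : V 𝕜) = q ^ (-wt n i l) • Finsupp.single l 1 := by
      simp
    rw [this, map_smul, LinearMap.smul_apply]

theorem fockK_wedge_single (hq : q ≠ 0) (hn : 2 ≤ n) (i : ZMod n) (e : ℤ) (l : ℤ)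
    (x : Fock q n (m - 1)) :
    fockK q hn m i e (wedge q n m (Finsupp.single l 1) x) =
      q ^ (e * wt n i l) • wedge q n m (Finsupp.single l 1) (fockK q hn (m - 1) i e x) := by
  refine LinearMap.congr_fun (Fock.hom_ext
    (f := (fockK q hn m i e).comp (wedge q n m (Finsupp.single l 1)))
    (g := q ^ (e * wt n i l) • (wedge q n m (Finsupp.single l 1)).comp (fockK q hn (m - 1) i e))
    fun s => ?_) x
  obtain ⟨N, hN⟩ := s.2
  simp only [LinearMap.comp_apply, LinearMap.smul_apply]
  rw [wedge_single_pureWedge, fockK, (exists_fockK q hn m i e).choose_spec _ _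
    (Seq.cons_apply_of_le hN), truncK_cons hq, map_smul, mkQ_tensCons, fockK,
    (exists_fockK q hn (m - 1) i e).choose_spec s N hN]

theorem fockK_wedge (hq : q ≠ 0) (hn : 2 ≤ n) (i : ZMod n) (v : V 𝕜) (x : Fock q n (m - 1)) :
    fockK q hn m i 1 (wedge q n m v x) =
      wedge q n m (evK q n i v) (fockK q hn (m - 1) i 1 x) := by
  refine LinearMap.congr_fun (LinearMap.congr_fun (wedge_hom_ext
    (f := (wedge q n m).compr₂ (fockK q hn m i 1))
    (g := (wedge q n m).compl₁₂ (evK q n i) (fockK q hn (m - 1) i 1)) fun l s => ?_) v) x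
  simp only [LinearMap.compr₂_apply, LinearMap.compl₁₂_apply]
  have : (Finsupp.single l (q ^ (wt n i l)) : V 𝕜) = q ^ (wt n i l) • Finsupp.single l 1 := by simp
  rw [fockK_wedge_single hq, evK, Finsupp.linearCombination_single, one_smul, this, map_smul,
    LinearMap.smul_apply, one_mul]

/-- Truncation at level `1` suffices, and lowering the first entry `m` makes it equal to its
neighbour `m - 1`. -/
theorem fockE_vacuum (hq : q ≠ 0) (hn : 2 ≤ n) (m : ℤ) (i : ZMod n) :
    fockE hq hn m i (vacuum q n m) = 0 := by
  rw [vacuum, fockE_pureWedge hq hn i (s := Seq.vac m) (N := 0) fun _ _ => rfl, truncE_single,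
    Finset.sum_range_one, map_smul, posE_single]
  split_ifs
  · rw [mkQ_upd_eq_zero q (by omega), smul_zero]
    left
    rw [Seq.upd_apply, Seq.upd_apply, if_pos rfl, if_neg (by omega)]
    simp [Seq.vac]
  · rw [map_zero, smul_zero]

theorem Seq.vac_eq_cons (m : ℤ) : Seq.vac m = Seq.cons m (Seq.vac (m - 1)) :=
  Seq.ext fun k => by
    cases k with
    | zero => simp [Seq.vac, Seq.cons]
    | succ k => simp [Seq.vac, Seq.cons]; ring

theorem vacuum_eq_wedge (m : ℤ) :
    vacuum q n m = wedge q n m (Finsupp.single m 1) (vacuum q n (m - 1)) := by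
  rw [vacuum, vacuum, wedge_single_pureWedge, ← Seq.vac_eq_cons]

theorem fockF_vacuum (hq : q ≠ 0) (hn : 2 ≤ n) (m : ℤ) (i : ZMod n) :
    fockF hq hn m i (vacuum q n m) = if (m : ZMod n) = i then
      wedge q n m (Finsupp.single (m + 1) 1) (vacuum q n (m - 1)) else 0 := by
  have h0 : (Seq.vac m).1 0 = m := by simp [Seq.vac]
  rw [vacuum, fockF_pureWedge hq hn i (s := Seq.vac m) (N := 0) fun _ _ => rfl, truncF_single,
    Finset.sum_range_one, wtSum, Finset.range_zero, Finset.sum_empty, neg_zero, zpow_zero, one_smul,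
    posF_single, h0]
  split_ifs
  · rw [vacuum, wedge_single_pureWedge, Seq.vac_eq_cons, Seq.cons_upd_zero, pureWedge]
  · rw [map_zero]

theorem fockK_vacuum (hn : 2 ≤ n) (m : ℤ) (i : ZMod n) (e : ℤ) :
    fockK q hn m i e (vacuum q n m) = q ^ (e * kron n i m) • vacuum q n m := by
  have h0 : (Seq.vac m).1 0 = m := by simp [Seq.vac]
  rw [vacuum, fockK_pureWedge hn i e (s := Seq.vac m) (N := 0) fun _ _ => rfl, wtSum,
    zero_add, Finset.sum_range_one, h0, wt_eq, Nat.cast_one, sub_add_cancel]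

end WedgeOperators

/-! ### The relations between the Chevalley generators -/

section SerreExpressions

variable {𝕜 A : Type*} [Field 𝕜] [Ring A] [Algebra 𝕜 A]

theorem qInt_three {q : 𝕜} (hq : q ≠ 0) (hqq : q - q⁻¹ ≠ 0) : qInt q 3 = q ^ 2 + 1 + (q⁻¹) ^ 2 := by
  rw [qInt, div_eq_iff hqq]
  field_simp
  ring

theorem qInt_inv (q : 𝕜) (k : ℕ) : qInt q⁻¹ k = qInt q k := by
  rw [qInt, qInt, inv_inv, ← neg_sub, ← neg_sub q, neg_div_neg_eq]

theorem serre2_inv (q : 𝕜) (a b : A) : serre2 q⁻¹ a b = serre2 q a b := by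
  rw [serre2, serre2, inv_inv, add_comm q⁻¹]

theorem serre3_inv (q : 𝕜) (a b : A) : serre3 q⁻¹ a b = serre3 q a b := by
  rw [serre3, serre3, qInt_inv]

/-- The Serre expressions are additive on suitably `q`-commuting elements. -/
theorem serre2_add {q : 𝕜} (hq : q ≠ 0) {a₁ a₂ b₁ b₂ : A}
    (h11 : b₁ * a₁ = (q⁻¹) ^ 2 • (a₁ * b₁)) (h12 : b₁ * a₂ = q • (a₂ * b₁))
    (h21 : b₂ * a₁ = q • (a₁ * b₂)) :
    serre2 q (a₁ + b₁) (a₂ + b₂) = serre2 q a₁ a₂ + serre2 q b₁ b₂ := by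
  have h11' : ∀ x, b₁ * (a₁ * x) = (q⁻¹) ^ 2 • (a₁ * (b₁ * x)) := fun x => by
    rw [← mul_assoc, h11, smul_mul_assoc, mul_assoc]
  have h12' : ∀ x, b₁ * (a₂ * x) = q • (a₂ * (b₁ * x)) := fun x => by
    rw [← mul_assoc, h12, smul_mul_assoc, mul_assoc]
  have h21' : ∀ x, b₂ * (a₁ * x) = q • (a₁ * (b₂ * x)) := fun x => by
    rw [← mul_assoc, h21, smul_mul_assoc, mul_assoc]
  simp only [serre2, pow_two a₁, pow_two b₁, pow_two (a₁ + b₁), mul_add, add_mul, mul_assoc, h11,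
    h12, h21, h11', h12', h21', mul_smul_comm, smul_mul_assoc,
    smul_add, smul_smul]
  match_scalars <;> field_simp <;> ring

/-- Once the first-summand factors are moved to the left, the coefficients of all mixed words
vanish. The expression is linear in its second argument, so `a₂` and `b₂` never occur in the same
word and no rule for exchanging them is needed. -/
theorem serre3_add {q : 𝕜} (hq : q ≠ 0) (hqq : q - q⁻¹ ≠ 0) {a₁ a₂ b₁ b₂ : A}
    (h11 : b₁ * a₁ = (q⁻¹) ^ 2 • (a₁ * b₁)) (h12 : b₁ * a₂ = q ^ 2 • (a₂ * b₁))
    (h21 : b₂ * a₁ = q ^ 2 • (a₁ * b₂)) :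
    serre3 q (a₁ + b₁) (a₂ + b₂) = serre3 q a₁ a₂ + serre3 q b₁ b₂ := by
  have h11' : ∀ x, b₁ * (a₁ * x) = (q⁻¹) ^ 2 • (a₁ * (b₁ * x)) := fun x => by
    rw [← mul_assoc, h11, smul_mul_assoc, mul_assoc]
  have h12' : ∀ x, b₁ * (a₂ * x) = q ^ 2 • (a₂ * (b₁ * x)) := fun x => by
    rw [← mul_assoc, h12, smul_mul_assoc, mul_assoc]
  have h21' : ∀ x, b₂ * (a₁ * x) = q ^ 2 • (a₁ * (b₂ * x)) := fun x => by
    rw [← mul_assoc, h21, smul_mul_assoc, mul_assoc]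
  simp only [serre3, qInt_three hq hqq, pow_three, pow_two a₁, pow_two b₁, pow_two (a₁ + b₁),
    mul_add, add_mul, mul_assoc, h11, h12, h21, h11', h12', h21', mul_smul_comm, smul_mul_assoc,
    smul_add, smul_smul]
  match_scalars <;> field_simp <;> ring

theorem map_serre2 {B : Type*} [Ring B] [Algebra 𝕜 B] (f : A →ₐ[𝕜] B) (q : 𝕜) (a b : A) :
    f (serre2 q a b) = serre2 q (f a) (f b) := by
  simp only [serre2, map_add, map_sub, map_mul, map_pow, map_smul]

theorem map_serre3 {B : Type*} [Ring B] [Algebra 𝕜 B] (f : A →ₐ[𝕜] B) (q : 𝕜) (a b : A) :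
    f (serre3 q a b) = serre3 q (f a) (f b) := by
  simp only [serre3, map_add, map_sub, map_mul, map_pow, map_smul]

end SerreExpressions

/-! ### Relations on the evaluation module `V(z)` -/

section EvaluationModule

variable {𝕜 : Type*} [Field 𝕜] {n : ℕ}

theorem evE_single (i : ZMod n) (l : ℤ) : evE n i (Finsupp.single l (1 : 𝕜)) =
    if ((l - 1 : ℤ) : ZMod n) = i then Finsupp.single (l - 1) 1 else 0 := by
  rw [evE, Finsupp.linearCombination_single, one_smul]

theorem evF_single (i : ZMod n) (l : ℤ) : evF n i (Finsupp.single l (1 : 𝕜)) =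
    if (l : ZMod n) = i then Finsupp.single (l + 1) 1 else 0 := by
  rw [evF, Finsupp.linearCombination_single, one_smul]

theorem evK_single (q : 𝕜) (i : ZMod n) (l : ℤ) :
    evK q n i (Finsupp.single l (1 : 𝕜)) = q ^ wt n i l • Finsupp.single l 1 := by
  simp [evK]

theorem evKinv_single (q : 𝕜) (i : ZMod n) (l : ℤ) :
    evKinv q n i (Finsupp.single l (1 : 𝕜)) = q ^ (-wt n i l) • Finsupp.single l 1 := by
  simp [evKinv]

theorem V_hom_ext {M : Type*} [AddCommGroup M] [Module 𝕜 M] {f g : V 𝕜 →ₗ[𝕜] M}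
    (h : ∀ l, f (Finsupp.single l 1) = g (Finsupp.single l 1)) : f = g :=
  Finsupp.lhom_ext' fun l => LinearMap.ext_ring (h l)

theorem one_ne_zero_zmod (hn : 2 ≤ n) : (1 : ZMod n) ≠ 0 := by
  have : Fact (1 < n) := ⟨hn⟩
  exact one_ne_zero

theorem two_ne_zero_zmod (hn : 2 < n) : (2 : ZMod n) ≠ 0 := by
  intro h
  have h2 : ((2 : ℕ) : ZMod n) = 0 := by exact_mod_cast h
  rw [ZMod.natCast_eq_zero_iff] at h2
  exact absurd (Nat.le_of_dvd (by norm_num) h2) (by omega)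

/-- The weight is a first difference of `kron`, so its change under a unit step is a second
difference, which is a Cartan integer up to sign. For `n = 2` both neighbours fall in the same
class, whence `-2`. -/
theorem kron_second_difference (hn : 2 ≤ n) (i : ZMod n) (l : ℤ) :
    kron n i (l + 1) + kron n i (l - 1) - 2 * kron n i l = -cartan n i (l : ZMod n) := by
  have h1 := one_ne_zero_zmod hn
  simp only [kron, cartan, Int.cast_add, Int.cast_sub, Int.cast_one]
  by_cases h : i = l
  · simp [h, h1]
  · have h' : ¬ ((l : ZMod n) = i) := fun e => h e.symm
    rw [if_neg h, if_neg h']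
    by_cases h2 : n = 2
    · rw [if_pos h2]
      subst h2
      have : ∀ a b : ZMod 2, ¬ a = b → b + 1 = a ∧ b - 1 = a := by decide
      rw [if_pos (this _ _ h).1, if_pos (this _ _ h).2]
      norm_num
    · have h3 := two_ne_zero_zmod (lt_of_le_of_ne hn (Ne.symm h2))
      rw [if_neg h2]
      by_cases h4 : i = l + 1
      · have h5 : ¬ ((l : ZMod n) - 1 = i) := by
          rw [h4]
          intro e
          apply h3
          linear_combination -e
        rw [if_pos h4.symm, if_neg h5, if_pos (Or.inl h4)]
        norm_num
      · rw [if_neg fun e => h4 e.symm]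
        by_cases h5 : i = l - 1
        · rw [if_pos h5.symm, if_pos (Or.inr h5)]
          norm_num
        · rw [if_neg fun e => h5 e.symm, if_neg (by tauto)]
          norm_num

theorem wt_add_one (hn : 2 ≤ n) (i : ZMod n) (l : ℤ) :
    wt n i (l + 1) = wt n i l - cartan n i (l : ZMod n) := by
  have := kron_second_difference hn i l
  rw [wt_eq, wt_eq, add_sub_cancel_right]
  omega

theorem wt_sub_one (hn : 2 ≤ n) (i : ZMod n) (l : ℤ) :
    wt n i (l - 1) = wt n i l + cartan n i ((l - 1 : ℤ) : ZMod n) := by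
  have := wt_add_one hn i (l - 1)
  rw [sub_add_cancel] at this
  omega

theorem evK_mul_evE {q : 𝕜} (hq : q ≠ 0) (hn : 2 ≤ n) (i j : ZMod n) :
    evK q n i * evE n j = q ^ cartan n i j • (evE n j * evK q n i) := by
  refine V_hom_ext fun l => ?_
  rw [LinearMap.smul_apply, Module.End.mul_apply, Module.End.mul_apply, evK_single, map_smul,
    evE_single]
  split_ifs with h
  · rw [evK_single, smul_smul, ← zpow_add₀ hq, wt_sub_one hn, h, add_comm]
  · rw [map_zero, smul_zero, smul_zero]

theorem evE_mul_evKinv {q : 𝕜} (hq : q ≠ 0) (hn : 2 ≤ n) (i j : ZMod n) :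
    evE n j * evKinv q n i = q ^ cartan n i j • (evKinv q n i * evE n j) := by
  refine V_hom_ext fun l => ?_
  rw [LinearMap.smul_apply, Module.End.mul_apply, Module.End.mul_apply, evKinv_single, map_smul,
    evE_single]
  split_ifs with h
  · rw [evKinv_single, smul_smul, ← zpow_add₀ hq, wt_sub_one hn, h]
    congr 2
    ring
  · rw [map_zero, smul_zero, smul_zero]

theorem evK_mul_evF {q : 𝕜} (hq : q ≠ 0) (hn : 2 ≤ n) (i j : ZMod n) :
    evK q n i * evF n j = q ^ (-cartan n i j) • (evF n j * evK q n i) := by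
  refine V_hom_ext fun l => ?_
  rw [LinearMap.smul_apply, Module.End.mul_apply, Module.End.mul_apply, evK_single, map_smul,
    evF_single]
  split_ifs with h
  · rw [evK_single, smul_smul, ← zpow_add₀ hq, wt_add_one hn, h]
    congr 2
    ring
  · rw [map_zero, smul_zero, smul_zero]

theorem evKinv_mul_evF {q : 𝕜} (hq : q ≠ 0) (hn : 2 ≤ n) (i j : ZMod n) :
    evKinv q n i * evF n j = q ^ cartan n i j • (evF n j * evKinv q n i) := by
  refine V_hom_ext fun l => ?_
  rw [LinearMap.smul_apply, Module.End.mul_apply, Module.End.mul_apply, evKinv_single, map_smul,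
    evF_single]
  split_ifs with h
  · rw [evKinv_single, smul_smul, ← zpow_add₀ hq, wt_add_one hn, h]
    congr 2
    ring
  · rw [map_zero, smul_zero, smul_zero]

theorem evK_mul_evKinv (q : 𝕜) (i j : ZMod n) :
    evK q n i * evKinv q n j = evKinv q n j * evK q n i := by
  refine V_hom_ext fun l => ?_
  simp only [Module.End.mul_apply, evK_single, evKinv_single, map_smul]
  rw [smul_comm]

theorem evKinv_mul_evKinv {q : 𝕜} (i j : ZMod n) :
    evKinv q n i * evKinv q n j = evKinv q n j * evKinv q n i := by
  refine V_hom_ext fun l => ?_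
  simp only [Module.End.mul_apply, evKinv_single, map_smul]
  rw [smul_comm]

theorem evE_mul_evE {i j : ZMod n} (h : j ≠ i + 1) :
    (evE n i * evE n j : Module.End 𝕜 (V 𝕜)) = 0 := by
  refine V_hom_ext fun l => ?_
  rw [Module.End.mul_apply, evE_single, LinearMap.zero_apply]
  split_ifs with h1
  · rw [evE_single, if_neg]
    intro h2
    apply h
    rw [← h1, ← h2]
    push_cast
    ring
  · rw [map_zero]

theorem evF_mul_evF {i j : ZMod n} (h : i ≠ j + 1) :
    (evF n i * evF n j : Module.End 𝕜 (V 𝕜)) = 0 := by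
  refine V_hom_ext fun l => ?_
  rw [Module.End.mul_apply, evF_single, LinearMap.zero_apply]
  split_ifs with h1
  · rw [evF_single, if_neg]
    intro h2
    apply h
    rw [← h1, ← h2]
    push_cast
    ring
  · rw [map_zero]

theorem evE_evF_sub_evF_evE {q : 𝕜} (hqq : q - q⁻¹ ≠ 0) (hn : 2 ≤ n) (i j : ZMod n) :
    evE n i * evF n j - evF n j * evE n i =
      if i = j then (q - q⁻¹)⁻¹ • (evK q n i - evKinv q n i) else 0 := by
  have h1 := one_ne_zero_zmod hn
  refine V_hom_ext fun l => ?_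
  have e1 : (evE n i * evF n j : Module.End 𝕜 (V 𝕜)) (Finsupp.single l 1) =
      if i = j ∧ (l : ZMod n) = i then Finsupp.single l 1 else 0 := by
    rw [Module.End.mul_apply, evF_single]
    split_ifs with h2 h3 h3
    · rw [evE_single, add_sub_cancel_right, if_pos h3.2]
    · rw [evE_single, add_sub_cancel_right, if_neg]
      rintro rfl
      exact h3 ⟨h2, rfl⟩
    · exact absurd (h3.2.trans h3.1) h2
    · rw [map_zero]
  have e2 : (evF n j * evE n i : Module.End 𝕜 (V 𝕜)) (Finsupp.single l 1) =
      if i = j ∧ (l : ZMod n) = i + 1 then Finsupp.single l 1 else 0 := by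
    rw [Module.End.mul_apply, evE_single]
    push_cast
    simp only [sub_eq_iff_eq_add]
    split_ifs with h2 h3 h3
    · rw [evF_single, sub_add_cancel, if_pos]
      push_cast
      rw [h2, add_sub_cancel_right, h3.1]
    · rw [evF_single, if_neg]
      push_cast
      rw [h2, add_sub_cancel_right]
      exact fun h4 => h3 ⟨h4, h2⟩
    · exact absurd h3.2 h2
    · rw [map_zero]
  rw [LinearMap.sub_apply, e1, e2]
  by_cases hij : i = j
  · simp only [hij, true_and, if_true, LinearMap.smul_apply, LinearMap.sub_apply, evK_single,
      evKinv_single, wt]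
    by_cases h2 : (l : ZMod n) = j
    · have h3 : ¬ (j = j + 1) := by simpa using h1
      simp only [h2, h3, if_true, if_false, sub_zero, zpow_one, zpow_neg_one]
      rw [← sub_smul, smul_smul, inv_mul_cancel₀ hqq, one_smul]
    · by_cases h3 : (l : ZMod n) = j + 1
      · have h3 : ¬ (j + 1 = j) := by simpa using h1
        simp only [*, if_true, if_false, zero_sub, zpow_one, zpow_neg_one, neg_neg]
        rw [← sub_smul, smul_smul, ← neg_sub q, mul_neg, inv_mul_cancel₀ hqq, neg_smul, one_smul]
      · simp [h2, h3]
  · simp [hij]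

end EvaluationModule

/-! ### The module structure on the wedge spaces -/

section WedgeRelations

variable {𝕜 : Type*} [Field 𝕜] {q : 𝕜} {n : ℕ} {m : ℤ}

theorem fockE_wedge_single (hq : q ≠ 0) (hn : 2 ≤ n) (i : ZMod n) (l : ℤ) (x : Fock q n (m - 1)) :
    fockE hq hn m i (wedge q n m (Finsupp.single l 1) x) =
      (if ((l - 1 : ℤ) : ZMod n) = i then
        wedge q n m (Finsupp.single (l - 1) 1) (fockK q hn (m - 1) i 1 x) else 0) +
      wedge q n m (Finsupp.single l 1) (fockE hq hn (m - 1) i x) := by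
  rw [fockE_wedge, evE_single]
  congr 1
  split_ifs
  · rfl
  · rw [map_zero, LinearMap.zero_apply]

theorem fockF_wedge_single (hq : q ≠ 0) (hn : 2 ≤ n) (i : ZMod n) (l : ℤ) (x : Fock q n (m - 1)) :
    fockF hq hn m i (wedge q n m (Finsupp.single l 1) x) =
      (if (l : ZMod n) = i then wedge q n m (Finsupp.single (l + 1) 1) x else 0) +
      q ^ (-wt n i l) • wedge q n m (Finsupp.single l 1) (fockF hq hn (m - 1) i x) := by
  rw [fockF_wedge, evF_single, evKinv_single, map_smul, LinearMap.smul_apply]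
  congr 1
  split_ifs
  · rfl
  · rw [map_zero, LinearMap.zero_apply]

theorem wedge_wedge_self (hn : 2 ≤ n) (l : ℤ) (x : Fock q n (m - 1 - 1)) :
    wedge q n m (Finsupp.single l 1) (wedge q n (m - 1) (Finsupp.single l 1) x) = 0 := by
  have h : (wedge q n m (Finsupp.single l 1)).comp (wedge q n (m - 1) (Finsupp.single l 1)) = 0 := by
    refine Fock.hom_ext fun s => ?_
    rw [LinearMap.comp_apply, wedge_single_pureWedge, wedge_single_pureWedge, LinearMap.zero_apply]
    exact pureWedge_eq_zero q (by omega) (k := 0) rfl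
  exact LinearMap.congr_fun h x

theorem fockK_mul_fockK (hq : q ≠ 0) (hn : 2 ≤ n) (i : ZMod n) (e e' : ℤ) :
    fockK q hn m i e * fockK q hn m i e' = fockK q hn m i (e + e') := by
  refine Fock.hom_ext fun s => ?_
  obtain ⟨N, hN⟩ := s.2
  rw [Module.End.mul_apply, fockK_pureWedge hn i _ hN, map_smul, fockK_pureWedge hn i _ hN,
    fockK_pureWedge hn i _ hN, smul_smul, ← zpow_add₀ hq]
  congr 2
  ring

theorem fockK_zero (hn : 2 ≤ n) (i : ZMod n) : fockK q hn m i 0 = 1 := by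
  refine Fock.hom_ext fun s => ?_
  obtain ⟨N, hN⟩ := s.2
  rw [fockK_pureWedge hn i _ hN, zero_mul, zpow_zero, one_smul, Module.End.one_apply]

theorem fockK_comm (hn : 2 ≤ n) (i j : ZMod n) (e e' : ℤ) :
    fockK q hn m i e * fockK q hn m j e' = fockK q hn m j e' * fockK q hn m i e := by
  refine Fock.hom_ext fun s => ?_
  obtain ⟨N, hN⟩ := s.2
  rw [Module.End.mul_apply, Module.End.mul_apply, fockK_pureWedge hn i _ hN, map_smul,
    fockK_pureWedge hn j _ hN, map_smul, fockK_pureWedge hn i _ hN, smul_comm]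

/-- An identity of operators on the wedge spaces follows from the vacua by wedge induction. -/
theorem Fock.end_ext {f g : ∀ m, Module.End 𝕜 (Fock q n m)}
    (hvac : ∀ m, f m (vacuum q n m) = g m (vacuum q n m))
    (hwedge : ∀ m l (x : Fock q n (m - 1)), f (m - 1) x = g (m - 1) x →
      f m (wedge q n m (Finsupp.single l 1) x) = g m (wedge q n m (Finsupp.single l 1) x)) (m : ℤ) :
    f m = g m :=
  LinearMap.ext fun x => sub_eq_zero.1 <| LinearMap.congr_fun
    (Fock.hom_eq_zero (M := fun m => Fock q n m) (fun m => f m - g m)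
      (fun m => sub_eq_zero.2 (hvac m))
      (fun m l x h => sub_eq_zero.2 (hwedge m l x (sub_eq_zero.1 h))) m) x

theorem fockK_mul_fockE (hq : q ≠ 0) (hn : 2 ≤ n) (i j : ZMod n) :
    fockK q hn m i 1 * fockE hq hn m j =
      q ^ cartan n i j • (fockE hq hn m j * fockK q hn m i 1) := by
  refine Fock.end_ext (f := fun m => fockK q hn m i 1 * fockE hq hn m j)
    (g := fun m => q ^ cartan n i j • (fockE hq hn m j * fockK q hn m i 1))
    (fun m => ?_) (fun m l x h => ?_) m
  · simp only [LinearMap.smul_apply, Module.End.mul_apply, fockE_vacuum, fockK_vacuum, map_zero,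
      map_smul, smul_zero]
  · have hc := LinearMap.congr_fun (fockK_comm (q := q) (m := m - 1) hn i j 1 1) x
    have hv := LinearMap.congr_fun (evK_mul_evE hq hn i j) (Finsupp.single l 1)
    simp only [LinearMap.smul_apply, Module.End.mul_apply] at h hc hv ⊢
    rw [fockE_wedge, map_add, fockK_wedge hq, fockK_wedge hq, fockK_wedge hq, fockE_wedge, h, hc, hv,
      evK_single]
    simp only [map_smul, LinearMap.smul_apply, smul_add]

theorem fockK_mul_fockF (hq : q ≠ 0) (hn : 2 ≤ n) (i j : ZMod n) :
    fockK q hn m i 1 * fockF hq hn m j =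
      q ^ (-cartan n i j) • (fockF hq hn m j * fockK q hn m i 1) := by
  refine Fock.end_ext (f := fun m => fockK q hn m i 1 * fockF hq hn m j)
    (g := fun m => q ^ (-cartan n i j) • (fockF hq hn m j * fockK q hn m i 1))
    (fun m => ?_) (fun m l x h => ?_) m
  · simp only [LinearMap.smul_apply, Module.End.mul_apply, fockF_vacuum, fockK_vacuum, map_smul]
    split_ifs with h
    · rw [fockK_wedge_single hq, fockK_vacuum, map_smul, smul_smul, smul_smul, ← zpow_add₀ hq,
        ← zpow_add₀ hq]
      congr 2
      have := kron_second_difference hn i m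
      rw [h] at this
      rw [wt_eq, add_sub_cancel_right]
      omega
    · rw [map_zero, smul_zero, smul_zero]
  · have hv := LinearMap.congr_fun (evK_mul_evF hq hn i j) (Finsupp.single l 1)
    have hc := LinearMap.congr_fun (evK_mul_evKinv q i j) (Finsupp.single l 1)
    simp only [LinearMap.smul_apply, Module.End.mul_apply] at h hc hv ⊢
    rw [fockF_wedge, map_add, fockK_wedge hq, fockK_wedge hq, fockK_wedge hq, fockF_wedge, h, hc, hv]
    simp only [map_smul, LinearMap.smul_apply, smul_add]

theorem fockK_neg_wedge (hq : q ≠ 0) (hn : 2 ≤ n) (i : ZMod n) (v : V 𝕜) (x : Fock q n (m - 1)) :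
    fockK q hn m i (-1) (wedge q n m v x) =
      wedge q n m (evKinv q n i v) (fockK q hn (m - 1) i (-1) x) := by
  refine LinearMap.congr_fun (LinearMap.congr_fun (wedge_hom_ext
    (f := (wedge q n m).compr₂ (fockK q hn m i (-1)))
    (g := (wedge q n m).compl₁₂ (evKinv q n i) (fockK q hn (m - 1) i (-1))) fun l s => ?_) v) x
  simp only [LinearMap.compr₂_apply, LinearMap.compl₁₂_apply]
  rw [fockK_wedge_single hq, evKinv_single, map_smul, LinearMap.smul_apply, neg_one_mul]

theorem cartan_symm (i j : ZMod n) : cartan n i j = cartan n j i := by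
  have e : (j = i + 1 ∨ j = i - 1) ↔ (i = j + 1 ∨ i = j - 1) := by
    rw [eq_sub_iff_add_eq, eq_sub_iff_add_eq, @eq_comm _ j, @eq_comm _ (j + 1), or_comm]
  rw [cartan, cartan, if_congr e rfl rfl, if_congr (@eq_comm _ i j) rfl rfl]

/-- The mixed terms `E_i K_j⁻¹ v ∧ K_i F_j x` and `K_j⁻¹ E_i v ∧ F_j K_i x` cancel: reordering costs
`q ^ cartan n j i` on the left and `q ^ (-cartan n i j)` on the right, and the Cartan matrix is
symmetric. -/
theorem fockE_fockF_wedge (hq : q ≠ 0) (hn : 2 ≤ n) (i j : ZMod n) (v : V 𝕜)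
    (x : Fock q n (m - 1)) :
    (fockE hq hn m i * fockF hq hn m j - fockF hq hn m j * fockE hq hn m i) (wedge q n m v x) =
      wedge q n m ((evE n i * evF n j - evF n j * evE n i : Module.End 𝕜 (V 𝕜)) v) (fockK q hn (m - 1) i 1 x) +
      wedge q n m (evKinv q n j v)
        ((fockE hq hn (m - 1) i * fockF hq hn (m - 1) j -
          fockF hq hn (m - 1) j * fockE hq hn (m - 1) i) x) := by
  have h1 := LinearMap.congr_fun (evE_mul_evKinv hq hn j i) v
  have h2 := LinearMap.congr_fun (fockK_mul_fockF (m := m - 1) hq hn i j) x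
  have h3 := cartan_symm j i
  simp only [LinearMap.smul_apply, Module.End.mul_apply, LinearMap.sub_apply] at h1 h2 ⊢
  rw [fockF_wedge, fockE_wedge, map_add, map_add, fockE_wedge, fockE_wedge, fockF_wedge, fockF_wedge,
    h1, h2, h3]
  simp only [map_smul, LinearMap.smul_apply, map_sub, LinearMap.sub_apply, smul_smul]
  rw [← zpow_add₀ hq, neg_add_cancel, zpow_zero, one_smul]
  abel

theorem fockE_fockF (hq : q ≠ 0) (hqq : q - q⁻¹ ≠ 0) (hn : 2 ≤ n) (i j : ZMod n) :
    fockE hq hn m i * fockF hq hn m j - fockF hq hn m j * fockE hq hn m i =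
      if i = j then (q - q⁻¹)⁻¹ • (fockK q hn m i 1 - fockK q hn m i (-1)) else 0 := by
  refine Fock.end_ext
    (f := fun m => fockE hq hn m i * fockF hq hn m j - fockF hq hn m j * fockE hq hn m i)
    (g := fun m => if i = j then (q - q⁻¹)⁻¹ • (fockK q hn m i 1 - fockK q hn m i (-1)) else 0)
    (fun m => ?_) (fun m l x h => ?_) m
  · have h1 := one_ne_zero_zmod hn
    rw [LinearMap.sub_apply, Module.End.mul_apply, Module.End.mul_apply, fockE_vacuum, map_zero,
      sub_zero, fockF_vacuum]
    by_cases hij : i = j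
    · subst hij
      rw [if_pos rfl, LinearMap.smul_apply, LinearMap.sub_apply, fockK_vacuum, fockK_vacuum]
      split_ifs with hm
      · have h2 : ¬ ((m : ZMod n) - 1 = m) := by simpa using h1
        rw [fockE_wedge_single, fockE_vacuum, map_zero, add_zero, add_sub_cancel_right, if_pos hm,
          fockK_vacuum, map_smul, ← vacuum_eq_wedge]
        simp only [kron, ← hm, Int.cast_sub, Int.cast_one, h2, if_true, if_false, mul_zero, zpow_zero,
          one_smul, mul_one, zpow_one, zpow_neg_one]
        rw [← sub_smul, smul_smul, inv_mul_cancel₀ hqq, one_smul]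
      · simp only [kron, hm, if_false, mul_zero, zpow_zero, sub_self, smul_zero, map_zero]
    · rw [if_neg hij, LinearMap.zero_apply]
      split_ifs with hm
      · rw [fockE_wedge_single, fockE_vacuum, map_zero, add_zero, add_sub_cancel_right, if_neg]
        rw [hm]
        exact fun e => hij e.symm
      · rw [map_zero]
  · rw [fockE_fockF_wedge, h, evE_evF_sub_evF_evE hqq hn]
    split_ifs with hij
    · subst hij
      -- The identity used is `(K - K⁻¹) ⊗ K + K⁻¹ ⊗ (K - K⁻¹) = K ⊗ K - K⁻¹ ⊗ K⁻¹`.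
      simp only [LinearMap.smul_apply, LinearMap.sub_apply, fockK_wedge hq, fockK_neg_wedge hq,
        map_smul, map_sub]
      rw [← smul_add]
      congr 1
      abel
    · simp only [LinearMap.zero_apply, map_zero, add_zero]

theorem fockE_comm (hq : q ≠ 0) (hn : 2 ≤ n) (i j : ZMod n) (h₁ : i ≠ j + 1) (h₂ : i ≠ j - 1) :
    fockE hq hn m i * fockE hq hn m j = fockE hq hn m j * fockE hq hn m i := by
  by_cases hij : i = j
  · rw [hij]
  have h₃ : j ≠ i + 1 := fun h => h₂ (by rw [h, add_sub_cancel_right])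
  have h₄ : j ≠ i - 1 := fun h => h₁ (by rw [h, sub_add_cancel])
  -- Modulo `2` distinct nodes are adjacent, which the hypotheses exclude.
  have hn2 : n ≠ 2 := by
    rintro rfl
    revert h₁ h₂ hij
    clear h₃ h₄
    revert i j
    decide
  have c1 : cartan n i j = 0 := by
    rw [cartan, if_neg hij, if_neg hn2, if_neg (by tauto)]
  have c2 : cartan n j i = 0 := by
    rw [cartan, if_neg fun h => hij h.symm, if_neg hn2, if_neg (by tauto)]
  refine Fock.end_ext (f := fun m => fockE hq hn m i * fockE hq hn m j)
    (g := fun m => fockE hq hn m j * fockE hq hn m i) (fun m => ?_) (fun m l x h => ?_) m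
  · simp only [Module.End.mul_apply, fockE_vacuum, map_zero]
  · have e1 := LinearMap.congr_fun (evE_mul_evE (𝕜 := 𝕜) h₃) (Finsupp.single l 1)
    have e2 := LinearMap.congr_fun (evE_mul_evE (𝕜 := 𝕜) h₁) (Finsupp.single l 1)
    have k1 := LinearMap.congr_fun (fockK_mul_fockE (m := m - 1) hq hn i j) x
    have k2 := LinearMap.congr_fun (fockK_mul_fockE (m := m - 1) hq hn j i) x
    rw [c1, zpow_zero, one_smul] at k1
    rw [c2, zpow_zero, one_smul] at k2
    simp only [Module.End.mul_apply, LinearMap.zero_apply] at e1 e2 k1 k2 h ⊢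
    simp only [fockE_wedge, map_add, e1, e2, k1, k2, h, map_zero, LinearMap.zero_apply, zero_add]
    abel

theorem fockF_comm (hq : q ≠ 0) (hn : 2 ≤ n) (i j : ZMod n) (h₁ : i ≠ j + 1) (h₂ : i ≠ j - 1) :
    fockF hq hn m i * fockF hq hn m j = fockF hq hn m j * fockF hq hn m i := by
  by_cases hij : i = j
  · rw [hij]
  have h₃ : j ≠ i + 1 := fun h => h₂ (by rw [h, add_sub_cancel_right])
  have h₄ : j ≠ i - 1 := fun h => h₁ (by rw [h, sub_add_cancel])
  have hn2 : n ≠ 2 := by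
    rintro rfl
    revert h₁ h₂ hij
    clear h₃ h₄
    revert i j
    decide
  have c1 : cartan n i j = 0 := by
    rw [cartan, if_neg hij, if_neg hn2, if_neg (by tauto)]
  have c2 : cartan n j i = 0 := by
    rw [cartan, if_neg fun h => hij h.symm, if_neg hn2, if_neg (by tauto)]
  -- Unlike `E_i`, a single `F_j` need not kill the vacuum; the product does, since after `F_j` the
  -- vacuum admits moves only in the residues `j + 1` and `j - 1`.
  have hvac : ∀ (i j : ZMod n), i ≠ j + 1 → i ≠ j - 1 → ∀ m,
      fockF hq hn m i (fockF hq hn m j (vacuum q n m)) = 0 := by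
    intro i j h1 h2 m
    rw [fockF_vacuum]
    split_ifs with hm
    · rw [fockF_wedge_single, fockF_vacuum, if_neg, if_neg, map_zero, smul_zero, add_zero]
      · push_cast
        rw [hm]
        exact h2.symm
      · push_cast
        rw [hm]
        exact h1.symm
    · rw [map_zero]
  refine Fock.end_ext (f := fun m => fockF hq hn m i * fockF hq hn m j)
    (g := fun m => fockF hq hn m j * fockF hq hn m i) (fun m => ?_) (fun m l x h => ?_) m
  · rw [Module.End.mul_apply, Module.End.mul_apply, hvac i j h₁ h₂, hvac j i h₃ h₄]
  · have e1 := LinearMap.congr_fun (evF_mul_evF (𝕜 := 𝕜) h₁) (Finsupp.single l 1)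
    have e2 := LinearMap.congr_fun (evF_mul_evF (𝕜 := 𝕜) h₃) (Finsupp.single l 1)
    have k1 := LinearMap.congr_fun (evKinv_mul_evF hq hn i j) (Finsupp.single l 1)
    have k2 := LinearMap.congr_fun (evKinv_mul_evF hq hn j i) (Finsupp.single l 1)
    have k3 := LinearMap.congr_fun (evKinv_mul_evKinv (q := q) i j) (Finsupp.single l 1)
    rw [c1, zpow_zero, one_smul] at k1
    rw [c2, zpow_zero, one_smul] at k2
    simp only [Module.End.mul_apply, LinearMap.zero_apply] at e1 e2 k1 k2 k3 h ⊢
    simp only [fockF_wedge, map_add, e1, e2, k1, k2, k3, h, map_zero, LinearMap.zero_apply, zero_add]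
    abel

end WedgeRelations

/-! ### The `q`-Serre relations, carried along the coproduct -/

section SerreRelations

open TensorProduct

variable {𝕜 : Type*} [Field 𝕜]

section Tensor

variable {M N : Type*} [AddCommGroup M] [Module 𝕜 M] [AddCommGroup N] [Module 𝕜 N]

/-- Used with `W` the wedging map from `V(z) ⊗ F_(m-1)` to `F_(m)`, so that the Serre expression can
be computed on the tensor product. Injectivity of `W` plays no role. -/
theorem serre2_apply_of_intertwine (q : 𝕜) (W : M →ₗ[𝕜] N) {X Y : Module.End 𝕜 N}
    {X' Y' : Module.End 𝕜 M} (hX : ∀ t, X (W t) = W (X' t)) (hY : ∀ t, Y (W t) = W (Y' t)) (t : M) :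
    serre2 q X Y (W t) = W (serre2 q X' Y' t) := by
  simp only [serre2, pow_two, LinearMap.add_apply, LinearMap.sub_apply, LinearMap.smul_apply,
    Module.End.mul_apply, hX, hY, map_add, map_sub, map_smul]

theorem serre3_apply_of_intertwine (q : 𝕜) (W : M →ₗ[𝕜] N) {X Y : Module.End 𝕜 N}
    {X' Y' : Module.End 𝕜 M} (hX : ∀ t, X (W t) = W (X' t)) (hY : ∀ t, Y (W t) = W (Y' t)) (t : M) :
    serre3 q X Y (W t) = W (serre3 q X' Y' t) := by
  simp only [serre3, pow_three, pow_two, LinearMap.add_apply, LinearMap.sub_apply,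
    LinearMap.smul_apply, Module.End.mul_apply, hX, hY, map_add, map_sub, map_smul]

theorem serre2_map_of_commute (q : 𝕜) {c d : Module.End 𝕜 M} (h : c * d = d * c)
    (X Y : Module.End 𝕜 N) : serre2 q (TensorProduct.map c X) (TensorProduct.map d Y) =
      TensorProduct.map (c ^ 2 * d) (serre2 q X Y) := by
  have h' : ∀ v, d (c v) = c (d v) := fun v => (LinearMap.congr_fun h v).symm
  refine TensorProduct.ext' fun v x => ?_
  simp only [serre2, pow_two, LinearMap.add_apply, LinearMap.sub_apply, LinearMap.smul_apply,
    Module.End.mul_apply, map_tmul, h', tmul_add, tmul_sub, tmul_smul]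

theorem serre3_map_of_commute (q : 𝕜) {c d : Module.End 𝕜 M} (h : c * d = d * c)
    (X Y : Module.End 𝕜 N) : serre3 q (TensorProduct.map c X) (TensorProduct.map d Y) =
      TensorProduct.map (c ^ 3 * d) (serre3 q X Y) := by
  have h' : ∀ v, d (c v) = c (d v) := fun v => (LinearMap.congr_fun h v).symm
  refine TensorProduct.ext' fun v x => ?_
  simp only [serre3, pow_two, pow_three, LinearMap.add_apply, LinearMap.sub_apply,
    LinearMap.smul_apply, Module.End.mul_apply, map_tmul, h', tmul_add, tmul_sub, tmul_smul]

theorem serre2_map_eq_zero (q : 𝕜) {c d : Module.End 𝕜 M} (h1 : c * c = 0) (h2 : c * d * c = 0)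
    (X Y : Module.End 𝕜 N) : serre2 q (TensorProduct.map c X) (TensorProduct.map d Y) = 0 := by
  rw [serre2, pow_two, ← TensorProduct.map_mul c c, ← TensorProduct.map_mul c d,
    ← TensorProduct.map_mul (c * d) c, h1, h2, TensorProduct.map_zero_left, TensorProduct.map_zero_left,
    zero_mul, mul_zero, smul_zero, sub_zero, add_zero]

/-- All four monomials contain the first argument twice in a row, so `c * c = 0` is enough; the
quadratic case also has the word `c * d * c`. -/
theorem serre3_map_eq_zero (q : 𝕜) {c : Module.End 𝕜 M} (d : Module.End 𝕜 M) (h1 : c * c = 0)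
    (X Y : Module.End 𝕜 N) : serre3 q (TensorProduct.map c X) (TensorProduct.map d Y) = 0 := by
  rw [serre3, pow_succ _ 2, pow_two, ← TensorProduct.map_mul c c, h1, TensorProduct.map_zero_left]
  simp only [zero_mul, mul_zero, smul_zero, sub_zero, add_zero]

theorem map_mul_map_of_smul {c d : Module.End 𝕜 M} {X Y : Module.End 𝕜 N} {a b : 𝕜}
    (h1 : d * c = a • (c * d)) (h2 : Y * X = b • (X * Y)) :
    TensorProduct.map d Y * TensorProduct.map c X =
      (a * b) • (TensorProduct.map c X * TensorProduct.map d Y) := by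
  rw [← TensorProduct.map_mul, ← TensorProduct.map_mul, h1, h2, TensorProduct.map_smul_left,
    TensorProduct.map_smul_right, smul_smul]

/-- The two halves of the coproduct `q`-commute, so the Serre expression splits. The half acting
through `c₁`, `c₂` vanishes already on the first tensor factor, and the other reduces to the Serre
expression on the second factor. -/
theorem serre2_tensor {q : 𝕜} (hq : q ≠ 0) {c₁ c₂ d₁ d₂ : Module.End 𝕜 M}
    {k₁ k₂ X₁ X₂ : Module.End 𝕜 N} (h1 : c₁ * c₁ = 0) (h2 : c₁ * c₂ * c₁ = 0) (hd : d₁ * d₂ = d₂ * d₁)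
    (h11 : TensorProduct.map d₁ X₁ * TensorProduct.map c₁ k₁ =
      (q⁻¹) ^ 2 • (TensorProduct.map c₁ k₁ * TensorProduct.map d₁ X₁))
    (h12 : TensorProduct.map d₁ X₁ * TensorProduct.map c₂ k₂ =
      q • (TensorProduct.map c₂ k₂ * TensorProduct.map d₁ X₁))
    (h21 : TensorProduct.map d₂ X₂ * TensorProduct.map c₁ k₁ =
      q • (TensorProduct.map c₁ k₁ * TensorProduct.map d₂ X₂)) :
    serre2 q (TensorProduct.map c₁ k₁ + TensorProduct.map d₁ X₁)
      (TensorProduct.map c₂ k₂ + TensorProduct.map d₂ X₂) =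
      TensorProduct.map (d₁ ^ 2 * d₂) (serre2 q X₁ X₂) := by
  rw [serre2_add hq h11 h12 h21, serre2_map_eq_zero q h1 h2, serre2_map_of_commute q hd, zero_add]

theorem serre3_tensor {q : 𝕜} (hq : q ≠ 0) (hqq : q - q⁻¹ ≠ 0) {c₁ c₂ d₁ d₂ : Module.End 𝕜 M}
    {k₁ k₂ X₁ X₂ : Module.End 𝕜 N} (h1 : c₁ * c₁ = 0) (hd : d₁ * d₂ = d₂ * d₁)
    (h11 : TensorProduct.map d₁ X₁ * TensorProduct.map c₁ k₁ =
      (q⁻¹) ^ 2 • (TensorProduct.map c₁ k₁ * TensorProduct.map d₁ X₁))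
    (h12 : TensorProduct.map d₁ X₁ * TensorProduct.map c₂ k₂ =
      q ^ 2 • (TensorProduct.map c₂ k₂ * TensorProduct.map d₁ X₁))
    (h21 : TensorProduct.map d₂ X₂ * TensorProduct.map c₁ k₁ =
      q ^ 2 • (TensorProduct.map c₁ k₁ * TensorProduct.map d₂ X₂)) :
    serre3 q (TensorProduct.map c₁ k₁ + TensorProduct.map d₁ X₁)
      (TensorProduct.map c₂ k₂ + TensorProduct.map d₂ X₂) =
      TensorProduct.map (d₁ ^ 3 * d₂) (serre3 q X₁ X₂) := by
  rw [serre3_add hq hqq h11 h12 h21, serre3_map_eq_zero q c₂ h1, serre3_map_of_commute q hd,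
    zero_add]

end Tensor

variable {q : 𝕜} {n : ℕ} {m : ℤ}

theorem fockE_lift_wedge (hq : q ≠ 0) (hn : 2 ≤ n) (i : ZMod n) (t : V 𝕜 ⊗[𝕜] Fock q n (m - 1)) :
    fockE hq hn m i (TensorProduct.lift (wedge q n m) t) =
      TensorProduct.lift (wedge q n m)
        ((TensorProduct.map (evE n i) (fockK q hn (m - 1) i 1) +
          TensorProduct.map (1 : Module.End 𝕜 (V 𝕜)) (fockE hq hn (m - 1) i)) t) := by
  induction t with
  | zero => simp only [map_zero]
  | add s t hs ht => simp only [map_add, hs, ht]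
  | tmul v x =>
    rw [lift.tmul, fockE_wedge, LinearMap.add_apply, map_add, map_tmul, map_tmul, lift.tmul,
      lift.tmul, Module.End.one_apply]

theorem fockF_lift_wedge (hq : q ≠ 0) (hn : 2 ≤ n) (i : ZMod n) (t : V 𝕜 ⊗[𝕜] Fock q n (m - 1)) :
    fockF hq hn m i (TensorProduct.lift (wedge q n m) t) =
      TensorProduct.lift (wedge q n m)
        ((TensorProduct.map (evF n i) (1 : Module.End 𝕜 (Fock q n (m - 1))) +
          TensorProduct.map (evKinv q n i) (fockF hq hn (m - 1) i)) t) := by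
  induction t with
  | zero => simp only [map_zero]
  | add s t hs ht => simp only [map_add, hs, ht]
  | tmul v x =>
    rw [lift.tmul, fockF_wedge, LinearMap.add_apply, map_add, map_tmul, map_tmul, lift.tmul,
      lift.tmul, Module.End.one_apply]

theorem mapE_mul_mapE (hq : q ≠ 0) (hn : 2 ≤ n) (i j : ZMod n) :
    TensorProduct.map (1 : Module.End 𝕜 (V 𝕜)) (fockE hq hn m j) *
        TensorProduct.map (evE n i) (fockK q hn m i 1) =
      q ^ (-cartan n i j) • (TensorProduct.map (evE n i) (fockK q hn m i 1) *
        TensorProduct.map (1 : Module.End 𝕜 (V 𝕜)) (fockE hq hn m j)) := by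
  have h := map_mul_map_of_smul (c := evE n i) (d := (1 : Module.End 𝕜 (V 𝕜)))
    (X := fockK q hn m i 1) (Y := fockE hq hn m j) (a := 1) (b := q ^ (-cartan n i j))
    (by rw [one_mul, mul_one, one_smul])
    (by rw [fockK_mul_fockE, smul_smul, ← zpow_add₀ hq, neg_add_cancel, zpow_zero, one_smul])
  rwa [one_mul] at h

theorem mapF_mul_mapF (hq : q ≠ 0) (hn : 2 ≤ n) (i j : ZMod n) :
    TensorProduct.map (evKinv q n j) (fockF hq hn m j) *
        TensorProduct.map (evF n i) (1 : Module.End 𝕜 (Fock q n m)) =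
      q ^ cartan n i j • (TensorProduct.map (evF n i) (1 : Module.End 𝕜 (Fock q n m)) *
        TensorProduct.map (evKinv q n j) (fockF hq hn m j)) := by
  have h := map_mul_map_of_smul (c := evF n i) (d := evKinv q n j)
    (X := (1 : Module.End 𝕜 (Fock q n m))) (Y := fockF hq hn m j) (a := q ^ cartan n j i) (b := 1)
    (evKinv_mul_evF hq hn j i) (by rw [one_mul, mul_one, one_smul])
  rwa [mul_one, cartan_symm] at h

theorem cartan_self (i : ZMod n) : cartan n i i = 2 := if_pos rfl

theorem add_one_ne_self_zmod (hn : 2 ≤ n) (i : ZMod n) : i + 1 ≠ i := by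
  simpa using one_ne_zero_zmod hn

theorem ne_of_adjacent (hn : 2 ≤ n) {i j : ZMod n} (h : j = i + 1 ∨ j = i - 1) : i ≠ j := by
  rintro rfl
  have h1 := one_ne_zero_zmod hn
  rcases h with h | h
  · simp [h1] at h
  · rw [eq_sub_iff_add_eq] at h
    simp [h1] at h

theorem cartan_of_adjacent (hn : 2 < n) {i j : ZMod n} (h : j = i + 1 ∨ j = i - 1) :
    cartan n i j = -1 := by
  rw [cartan_symm, cartan, if_neg (ne_of_adjacent (by omega) h).symm, if_neg (by omega), if_pos h]

theorem cartan_two {i j : ZMod 2} (h : i ≠ j) : cartan 2 i j = -2 := by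
  rw [cartan, if_neg h, if_pos rfl]

theorem not_adjacent_both (hn : 2 < n) {i j : ZMod n} (h : j = i + 1) : ¬ i = j + 1 := by
  rintro h'
  apply two_ne_zero_zmod hn
  linear_combination -h - h'

theorem evE_mul_evE_mul_evE (hn : 2 < n) {i j : ZMod n} :
    (evE n i * evE n j * evE n i : Module.End 𝕜 (V 𝕜)) = 0 := by
  by_cases h : j = i + 1
  · rw [mul_assoc, evE_mul_evE (not_adjacent_both hn h), mul_zero]
  · rw [evE_mul_evE h, zero_mul]

theorem evF_mul_evF_mul_evF (hn : 2 < n) {i j : ZMod n} :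
    (evF n i * evF n j * evF n i : Module.End 𝕜 (V 𝕜)) = 0 := by
  by_cases h : j = i + 1
  · rw [evF_mul_evF (not_adjacent_both hn h), zero_mul]
  · rw [mul_assoc, evF_mul_evF h, mul_zero]

theorem evE_mul_self (hn : 2 ≤ n) (i : ZMod n) : (evE n i * evE n i : Module.End 𝕜 (V 𝕜)) = 0 :=
  evE_mul_evE (add_one_ne_self_zmod hn i).symm

theorem evF_mul_self (hn : 2 ≤ n) (i : ZMod n) : (evF n i * evF n i : Module.End 𝕜 (V 𝕜)) = 0 :=
  evF_mul_evF (add_one_ne_self_zmod hn i).symm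

theorem serre2_fockE (hq : q ≠ 0) (hn : 2 < n) {i j : ZMod n} (h : j = i + 1 ∨ j = i - 1) :
    serre2 q (fockE hq hn.le m i) (fockE hq hn.le m j) = 0 := by
  refine Fock.end_ext (f := fun m => serre2 q (fockE hq hn.le m i) (fockE hq hn.le m j))
    (g := fun _ => 0) (fun m => ?_) (fun m l x hx => ?_) m
  · simp only [serre2, pow_two, LinearMap.add_apply, LinearMap.sub_apply, LinearMap.smul_apply,
      Module.End.mul_apply, fockE_vacuum, map_zero, smul_zero, sub_zero, add_zero,
      LinearMap.zero_apply]
  · have c1 := cartan_of_adjacent hn h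
    have c2 := (cartan_symm j i).trans c1
    have key := serre2_apply_of_intertwine q (TensorProduct.lift (wedge q n m))
      (fockE_lift_wedge hq hn.le i) (fockE_lift_wedge hq hn.le j)
      ((Finsupp.single l 1 : V 𝕜) ⊗ₜ[𝕜] x)
    rw [lift.tmul, serre2_tensor hq (evE_mul_self hn.le i) (evE_mul_evE_mul_evE hn) rfl
      (by rw [mapE_mul_mapE, cartan_self, zpow_neg, inv_pow, zpow_ofNat])
      (by rw [mapE_mul_mapE, c2, neg_neg, zpow_one])
      (by rw [mapE_mul_mapE, c1, neg_neg, zpow_one]), map_tmul, hx, LinearMap.zero_apply, tmul_zero,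
      map_zero] at key
    rw [key, LinearMap.zero_apply]

theorem serre3_fockE {q : 𝕜} (hq : q ≠ 0) (hqq : q - q⁻¹ ≠ 0) {i j : ZMod 2} (h : i ≠ j) :
    serre3 q (fockE hq le_rfl m i) (fockE hq le_rfl m j) = 0 := by
  refine Fock.end_ext (f := fun m => serre3 q (fockE hq le_rfl m i) (fockE hq le_rfl m j))
    (g := fun _ => 0) (fun m => ?_) (fun m l x hx => ?_) m
  · simp only [serre3, pow_three, pow_two, LinearMap.add_apply, LinearMap.sub_apply,
      LinearMap.smul_apply, Module.End.mul_apply, fockE_vacuum, map_zero, smul_zero, sub_zero,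
      add_zero, LinearMap.zero_apply]
  · have key := serre3_apply_of_intertwine q (TensorProduct.lift (wedge q 2 m))
      (fockE_lift_wedge hq le_rfl i) (fockE_lift_wedge hq le_rfl j)
      ((Finsupp.single l 1 : V 𝕜) ⊗ₜ[𝕜] x)
    rw [lift.tmul, serre3_tensor hq hqq (evE_mul_self le_rfl i) rfl
      (by rw [mapE_mul_mapE, cartan_self, zpow_neg, inv_pow, zpow_ofNat])
      (by rw [mapE_mul_mapE, cartan_two h.symm, neg_neg, zpow_ofNat])
      (by rw [mapE_mul_mapE, cartan_two h, neg_neg, zpow_ofNat]), map_tmul, hx,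
      LinearMap.zero_apply, tmul_zero, map_zero] at key
    rw [key, LinearMap.zero_apply]

/-- Each monomial kills the vacuum separately. From a vacuum with `m ≡ i` or `m ≡ j` only a few
moves are possible, and every path ends in a residue that cannot be moved or in a repeated entry. -/
theorem serre2_fockF_vacuum (hq : q ≠ 0) (hn : 2 < n) {i j : ZMod n} (h : j = i + 1 ∨ j = i - 1) :
    serre2 q (fockF hq hn.le m i) (fockF hq hn.le m j) (vacuum q n m) = 0 := by
  have e1 := one_ne_zero_zmod hn.le
  have e2 := two_ne_zero_zmod hn
  have d1 : ∀ a : ZMod n, ¬ a + 1 = a := fun a h => e1 (by linear_combination h)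
  have d1' : ∀ a : ZMod n, ¬ a = a + 1 := fun a h => e1 (by linear_combination -h)
  have d2 : ∀ a : ZMod n, ¬ a - 1 = a := fun a h => e1 (by linear_combination -h)
  have d2' : ∀ a : ZMod n, ¬ a = a - 1 := fun a h => e1 (by linear_combination h)
  have d3 : ∀ a : ZMod n, ¬ a + 1 + 1 = a := fun a h => e2 (by linear_combination h)
  have d4 : ∀ a : ZMod n, ¬ a - 1 - 1 = a := fun a h => e2 (by linear_combination -h)
  have d5 : ∀ a : ZMod n, ¬ a + 1 = a - 1 := fun a h => e2 (by linear_combination h)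
  have d6 : ∀ a : ZMod n, ¬ a - 1 = a + 1 := fun a h => e2 (by linear_combination -h)
  have hw := fun m l x => wedge_wedge_self (q := q) (m := m) hn.le l x
  simp only [serre2, pow_two, LinearMap.add_apply, LinearMap.sub_apply, LinearMap.smul_apply,
    Module.End.mul_apply, fockF_vacuum]
  by_cases h1 : (m : ZMod n) = i
  · rcases h with rfl | rfl <;>
    simp only [h1, fockF_vacuum, fockF_wedge_single, map_smul, Int.cast_add, Int.cast_sub,
      Int.cast_one, sub_add_cancel, d1, d1', d2, d2', d3, d4, d5, d6, hw,
      if_true, if_false, map_zero, smul_zero, add_zero, zero_add, sub_zero]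
  · by_cases h2 : (m : ZMod n) = j
    · have hi : i = j - 1 ∨ i = j + 1 := by
        rcases h with rfl | rfl <;> simp
      have h3 : ¬ j = i := fun e => h1 (h2.trans e)
      clear h
      rcases hi with rfl | rfl <;>
      simp only [h2, h3, fockF_vacuum, fockF_wedge_single, map_smul, Int.cast_add,
        Int.cast_sub, Int.cast_one, sub_add_cancel, d1, d2,
        d5, d6, if_true, if_false, map_zero, smul_zero, add_zero, zero_add, sub_zero]
    · simp only [h1, h2, if_false, map_zero, smul_zero, sub_zero, add_zero]

theorem serre3_fockF_vacuum {q : 𝕜} (hq : q ≠ 0) {i j : ZMod 2} (h : j = i + 1) :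
    serre3 q (fockF hq le_rfl m i) (fockF hq le_rfl m j) (vacuum q 2 m) = 0 := by
  have d1 : ∀ a : ZMod 2, ¬ a + 1 = a := by decide
  have d1' : ∀ a : ZMod 2, ¬ a = a + 1 := by decide
  have d2 : ∀ a : ZMod 2, a - 1 = a + 1 := by decide
  have d3 : ∀ a : ZMod 2, a + 1 + 1 = a := by decide
  have hw := fun m l x => wedge_wedge_self (q := q) (m := m) le_rfl l x
  simp only [serre3, pow_two, pow_three, LinearMap.add_apply, LinearMap.sub_apply,
    LinearMap.smul_apply, Module.End.mul_apply, fockF_vacuum]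
  subst h
  have h1 : (m : ZMod 2) = i ∨ (m : ZMod 2) = i + 1 := by
    generalize (m : ZMod 2) = a
    revert a i
    decide
  rcases h1 with h1 | h1
  · simp only [h1, fockF_vacuum, fockF_wedge_single, map_add, map_smul, Int.cast_add, Int.cast_sub,
      Int.cast_one, sub_add_cancel, d1, d1', d2, d3, hw,
      if_true, if_false, map_zero, smul_zero, add_zero, zero_add, sub_zero]
  · simp only [h1, fockF_vacuum, fockF_wedge_single, map_add, map_smul, Int.cast_add, Int.cast_sub,
      Int.cast_one, sub_add_cancel, d1, d2, d3,
      if_true, if_false, map_zero, smul_zero, add_zero, zero_add, sub_zero]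

/-- For `F` the halves of the coproduct commute with powers of `q` inverse to those for `E`. Since
the Serre expressions do not change under `q ↦ q⁻¹`, additivity is applied with parameter `q⁻¹`. -/
theorem serre2_fockF (hq : q ≠ 0) (hn : 2 < n) {i j : ZMod n} (h : j = i + 1 ∨ j = i - 1) :
    serre2 q (fockF hq hn.le m i) (fockF hq hn.le m j) = 0 := by
  refine Fock.end_ext (f := fun m => serre2 q (fockF hq hn.le m i) (fockF hq hn.le m j))
    (g := fun _ => 0) (fun m => serre2_fockF_vacuum hq hn h) (fun m l x hx => ?_) m
  have c1 := cartan_of_adjacent hn h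
  have c2 := (cartan_symm j i).trans c1
  have key := serre2_apply_of_intertwine q⁻¹ (TensorProduct.lift (wedge q n m))
    (fockF_lift_wedge hq hn.le i) (fockF_lift_wedge hq hn.le j)
    ((Finsupp.single l 1 : V 𝕜) ⊗ₜ[𝕜] x)
  rw [lift.tmul, serre2_tensor (inv_ne_zero hq) (evF_mul_self hn.le i) (evF_mul_evF_mul_evF hn)
    (evKinv_mul_evKinv i j)
    (by rw [mapF_mul_mapF, cartan_self, inv_inv, zpow_ofNat])
    (by rw [mapF_mul_mapF, c2, zpow_neg_one])
    (by rw [mapF_mul_mapF, c1, zpow_neg_one]), map_tmul, serre2_inv, serre2_inv, hx,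
    LinearMap.zero_apply, tmul_zero, map_zero] at key
  rw [key, LinearMap.zero_apply]

theorem serre3_fockF {q : 𝕜} (hq : q ≠ 0) (hqq : q - q⁻¹ ≠ 0) {i j : ZMod 2} (h : j = i + 1) :
    serre3 q (fockF hq le_rfl m i) (fockF hq le_rfl m j) = 0 := by
  refine Fock.end_ext (f := fun m => serre3 q (fockF hq le_rfl m i) (fockF hq le_rfl m j))
    (g := fun _ => 0) (fun m => serre3_fockF_vacuum hq h) (fun m l x hx => ?_) m
  have hij : i ≠ j := by
    rw [h]
    exact (add_one_ne_self_zmod le_rfl i).symm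
  have hqq' : q⁻¹ - q⁻¹⁻¹ ≠ 0 := by
    rw [inv_inv, ← neg_sub]
    exact neg_ne_zero.2 hqq
  have key := serre3_apply_of_intertwine q⁻¹ (TensorProduct.lift (wedge q 2 m))
    (fockF_lift_wedge hq le_rfl i) (fockF_lift_wedge hq le_rfl j)
    ((Finsupp.single l 1 : V 𝕜) ⊗ₜ[𝕜] x)
  rw [lift.tmul, serre3_tensor (inv_ne_zero hq) hqq' (evF_mul_self le_rfl i)
    (evKinv_mul_evKinv i j)
    (by rw [mapF_mul_mapF, cartan_self, inv_inv, zpow_ofNat])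
    (by rw [mapF_mul_mapF, cartan_two hij.symm, zpow_neg, zpow_ofNat, inv_pow])
    (by rw [mapF_mul_mapF, cartan_two hij, zpow_neg, zpow_ofNat, inv_pow]), map_tmul, serre3_inv,
    serre3_inv, hx, LinearMap.zero_apply, tmul_zero, map_zero] at key
  rw [key, LinearMap.zero_apply]

end SerreRelations

/-! ### Existence and uniqueness of the action on the wedge spaces -/

section Action

variable {𝕜 : Type*} [Field 𝕜] {q : 𝕜} {n : ℕ}

/-- The operators on `F_(m)` by which the Chevalley generators act. -/
def fockGen (hq : q ≠ 0) (hn : 2 ≤ n) (m : ℤ) : Gen n → Module.End 𝕜 (Fock q n m)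
  | Gen.E i => fockE hq hn m i
  | Gen.F i => fockF hq hn m i
  | Gen.K i => fockK q hn m i 1
  | Gen.Kinv i => fockK q hn m i (-1)

theorem lift_fockGen_eq_of_rel (hq : q ≠ 0) (hqq : q - q⁻¹ ≠ 0) (hn : 2 ≤ n) (m : ℤ)
    ⦃x y : FreeAlgebra 𝕜 (Gen n)⦄ (h : Rel q n x y) :
    FreeAlgebra.lift 𝕜 (fockGen hq hn m) x = FreeAlgebra.lift 𝕜 (fockGen hq hn m) y := by
  have hE : ∀ i, FreeAlgebra.lift 𝕜 (fockGen hq hn m) (fE i) = fockE hq hn m i :=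
    fun i => FreeAlgebra.lift_ι_apply _ _
  have hF : ∀ i, FreeAlgebra.lift 𝕜 (fockGen hq hn m) (fF i) = fockF hq hn m i :=
    fun i => FreeAlgebra.lift_ι_apply _ _
  have hK : ∀ i, FreeAlgebra.lift 𝕜 (fockGen hq hn m) (fK i) = fockK q hn m i 1 :=
    fun i => FreeAlgebra.lift_ι_apply _ _
  have hKinv : ∀ i, FreeAlgebra.lift 𝕜 (fockGen hq hn m) (fKinv i) = fockK q hn m i (-1) :=
    fun i => FreeAlgebra.lift_ι_apply _ _
  cases h with
  | K_mul_Kinv i => rw [map_mul, hK, hKinv, fockK_mul_fockK hq, map_one, add_neg_cancel, fockK_zero]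
  | Kinv_mul_K i => rw [map_mul, hK, hKinv, fockK_mul_fockK hq, map_one, neg_add_cancel, fockK_zero]
  | K_comm i j => rw [map_mul, map_mul, hK, hK, fockK_comm]
  | K_E i j => rw [map_smul, map_mul, map_mul, hK, hE, fockK_mul_fockE]
  | K_F i j => rw [map_smul, map_mul, map_mul, hK, hF, fockK_mul_fockF]
  | E_F_self i =>
    rw [map_smul, map_sub, map_sub, map_mul, map_mul, hE, hF, hK, hKinv, fockE_fockF hq hqq,
      if_pos rfl]
  | E_F_ne i j hij => rw [map_sub, map_mul, map_mul, hE, hF, fockE_fockF hq hqq, if_neg hij, map_zero]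
  | E_comm i j h₁ h₂ => rw [map_mul, map_mul, hE, hE, fockE_comm hq hn i j h₁ h₂]
  | F_comm i j h₁ h₂ => rw [map_mul, map_mul, hF, hF, fockF_comm hq hn i j h₁ h₂]
  | E_serre2 i j h2 hij => rw [map_serre2, hE, hE, serre2_fockE hq h2 hij, map_zero]
  | F_serre2 i j h2 hij => rw [map_serre2, hF, hF, serre2_fockF hq h2 hij, map_zero]
  | E_serre3 i j h2 hij =>
    subst h2
    have hij' : j = i + 1 := by
      revert i j
      decide
    rw [map_serre3, hE, hE, serre3_fockE hq hqq (ne_of_adjacent le_rfl hij), map_zero]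
  | F_serre3 i j h2 hij =>
    subst h2
    -- Modulo `2` the neighbours `i + 1` and `i - 1` coincide.
    have hij' : j = i + 1 := by
      revert i j
      decide
    rw [map_serre3, hF, hF, serre3_fockF hq hqq hij', map_zero]

/-- The action of `U'_q(sl_n^)` on `F_(m)`. -/
def fockAction (hq : q ≠ 0) (hqq : q - q⁻¹ ≠ 0) (hn : 2 ≤ n) (m : ℤ) :
    U q n →ₐ[𝕜] Module.End 𝕜 (Fock q n m) :=
  RingQuot.liftAlgHom 𝕜 ⟨FreeAlgebra.lift 𝕜 (fockGen hq hn m), lift_fockGen_eq_of_rel hq hqq hn m⟩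

theorem fockAction_gen (hq : q ≠ 0) (hqq : q - q⁻¹ ≠ 0) (hn : 2 ≤ n) (m : ℤ) (g : Gen n) :
    fockAction hq hqq hn m (gen q n g) = fockGen hq hn m g := by
  rw [fockAction, gen, RingQuot.liftAlgHom_mkAlgHom_apply, FreeAlgebra.lift_ι_apply]

theorem isWedgeAction_fockAction (hq : q ≠ 0) (hqq : q - q⁻¹ ≠ 0) (hn : 2 ≤ n) :
    IsWedgeAction q n (fockAction hq hqq hn) where
  E_vacuum m i := by rw [fockAction_gen]; exact fockE_vacuum hq hn m i
  F_vacuum m i := by rw [fockAction_gen]; exact fockF_vacuum hq hn m i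
  K_vacuum m i := by
    rw [fockAction_gen]
    refine (fockK_vacuum hn m i 1).trans ?_
    rw [kron, one_mul]
    split_ifs
    · rw [zpow_one]
    · rw [zpow_zero, one_smul]
  E_wedge m i v x := by
    simp only [fockAction_gen]
    exact fockE_wedge hq hn i v x
  F_wedge m i v x := by
    simp only [fockAction_gen]
    exact fockF_wedge hq hn i v x
  K_wedge m i v x := by
    simp only [fockAction_gen]
    exact fockK_wedge hq hn i v x

theorem gen_Kinv_mul_gen_K (q : 𝕜) (n : ℕ) (i : ZMod n) :
    gen q n (Gen.Kinv i) * gen q n (Gen.K i) = 1 := by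
  have h := RingQuot.mkAlgHom_rel 𝕜 (Rel.Kinv_mul_K (q := q) i)
  rwa [map_mul, map_one] at h

theorem gen_K_mul_gen_Kinv (q : 𝕜) (n : ℕ) (i : ZMod n) :
    gen q n (Gen.K i) * gen q n (Gen.Kinv i) = 1 := by
  have h := RingQuot.mkAlgHom_rel 𝕜 (Rel.K_mul_Kinv (q := q) i)
  rwa [map_mul, map_one] at h

/-- A representation of `U'_q(sl_n^)` is determined by the action of `E_i`, `F_i` and `K_i`. -/
theorem U_hom_ext {A : Type*} [Semiring A] [Algebra 𝕜 A] {f g : U q n →ₐ[𝕜] A}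
    (hE : ∀ i, f (gen q n (Gen.E i)) = g (gen q n (Gen.E i)))
    (hF : ∀ i, f (gen q n (Gen.F i)) = g (gen q n (Gen.F i)))
    (hK : ∀ i, f (gen q n (Gen.K i)) = g (gen q n (Gen.K i))) : f = g := by
  refine RingQuot.ringQuot_ext' 𝕜 _ _ (FreeAlgebra.hom_ext (funext fun x => ?_))
  change f (gen q n x) = g (gen q n x)
  cases x with
  | E i => exact hE i
  | F i => exact hF i
  | K i => exact hK i
  | Kinv i =>
    refine left_inv_eq_right_inv (a := f (gen q n (Gen.K i))) ?_ ?_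
    · rw [← map_mul, gen_Kinv_mul_gen_K, map_one]
    · rw [hK, ← map_mul, gen_K_mul_gen_Kinv, map_one]

/-- Wedge induction determines each generator; `K_i` comes before `E_i` because the coproduct of
`E_i` involves `K_i` on the tail. -/
theorem IsWedgeAction.unique {ρ ρ' : ∀ m : ℤ, U q n →ₐ[𝕜] Module.End 𝕜 (Fock q n m)}
    (h : IsWedgeAction q n ρ) (h' : IsWedgeAction q n ρ') : ρ = ρ' := by
  have hK : ∀ i m, ρ m (gen q n (Gen.K i)) = ρ' m (gen q n (Gen.K i)) := fun i =>
    Fock.end_ext (fun m => by rw [h.K_vacuum, h'.K_vacuum])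
      fun m l x hx => by rw [h.K_wedge, h'.K_wedge, hx]
  have hE : ∀ i m, ρ m (gen q n (Gen.E i)) = ρ' m (gen q n (Gen.E i)) := fun i =>
    Fock.end_ext (fun m => by rw [h.E_vacuum, h'.E_vacuum])
      fun m l x hx => by rw [h.E_wedge, h'.E_wedge, hx, hK]
  have hF : ∀ i m, ρ m (gen q n (Gen.F i)) = ρ' m (gen q n (Gen.F i)) := fun i =>
    Fock.end_ext (fun m => by rw [h.F_vacuum, h'.F_vacuum])
      fun m l x hx => by rw [h.F_wedge, h'.F_wedge, hx]
  exact funext fun m => U_hom_ext (hE · m) (hF · m) (hK · m)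

end Action

/-! ### Young diagrams and normally ordered wedges -/

section Diagrams

variable {m : ℤ}

theorem rowLen_eq_of_forall {μ : YoungDiagram} {k a : ℕ} (h : ∀ j, (k, j) ∈ μ ↔ j < a) :
    μ.rowLen k = a :=
  eq_of_forall_lt_iff fun j => by rw [← h, YoungDiagram.mem_iff_lt_rowLen]

theorem rowLen_ext {μ ν : YoungDiagram} (h : ∀ k, μ.rowLen k = ν.rowLen k) : μ = ν := by
  refine YoungDiagram.ext (Finset.ext fun c => ?_)
  rw [YoungDiagram.mem_cells, YoungDiagram.mem_cells, YoungDiagram.mem_iff_lt_rowLen,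
    YoungDiagram.mem_iff_lt_rowLen, h]

theorem rowLen_pos_iff {μ : YoungDiagram} {k : ℕ} : 0 < μ.rowLen k ↔ k < μ.colLen 0 := by
  rw [← YoungDiagram.mem_iff_lt_rowLen, YoungDiagram.mem_iff_lt_colLen]

theorem rowLen_eq_zero {μ : YoungDiagram} {k : ℕ} (h : μ.colLen 0 ≤ k) : μ.rowLen k = 0 := by
  have := rowLen_pos_iff (μ := μ) (k := k)
  omega

/-- The sequence `s k = m - k + μ_k` attached to a Young diagram `μ`. -/
def diagramSeq (m : ℤ) (μ : YoungDiagram) : Seq m :=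
  ⟨fun k => m - k + μ.rowLen k, μ.colLen 0, fun k hk => by
    beta_reduce
    rw [rowLen_eq_zero hk, Nat.cast_zero, add_zero]⟩

theorem diagramSeq_apply (m : ℤ) (μ : YoungDiagram) (k : ℕ) :
    (diagramSeq m μ).1 k = m - k + μ.rowLen k := rfl

theorem diagramSeq_apply_of_le {μ : YoungDiagram} (k : ℕ) (h : μ.colLen 0 ≤ k) :
    (diagramSeq m μ).1 k = m - k := by
  rw [diagramSeq_apply, rowLen_eq_zero h, Nat.cast_zero, add_zero]

theorem strictAnti_diagramSeq (m : ℤ) (μ : YoungDiagram) : StrictAnti (diagramSeq m μ).1 :=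
  strictAnti_nat_of_succ_lt fun k => by
    have := μ.rowLen_anti k (k + 1) (Nat.le_succ k)
    rw [diagramSeq_apply, diagramSeq_apply]
    push_cast
    omega

/-- For a strictly decreasing integer sequence the excesses `s k - (m - k)` decrease weakly. They
vanish eventually, so they are nonnegative and are the row lengths of a diagram. -/
theorem exists_diagramSeq_eq {s : Seq m} (hs : StrictAnti s.1) : ∃ μ, diagramSeq m μ = s := by
  obtain ⟨N, hN⟩ := s.2
  have hanti : ∀ j k, j ≤ k → s.1 k - (m - k) ≤ s.1 j - (m - j) := by
    intro j k hjk
    induction k, hjk using Nat.le_induction with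
    | base => exact le_rfl
    | succ k _ ih =>
      have := hs (show k < k + 1 from Nat.lt_succ_self k)
      push_cast
      omega
  have hnonneg : ∀ k, 0 ≤ s.1 k - (m - k) := fun k => by
    have h1 := hanti k (max k N) (le_max_left _ _)
    rw [hN _ (le_max_right _ _)] at h1
    omega
  obtain ⟨S, hmem⟩ : ∃ S : Finset (ℕ × ℕ), ∀ c, c ∈ S ↔ (c.2 : ℤ) < s.1 c.1 - (m - c.1) := by
    refine ⟨(Finset.range N).biUnion fun k =>
      (Finset.range (s.1 k - (m - k)).toNat).map ⟨fun j => (k, j), Prod.mk_right_injective k⟩, ?_⟩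
    rintro ⟨k, j⟩
    simp only [Finset.mem_biUnion, Finset.mem_range, Finset.mem_map, Function.Embedding.coeFn_mk,
      Prod.mk.injEq]
    constructor
    · rintro ⟨k', -, j', hj, rfl, rfl⟩
      omega
    · intro h
      refine ⟨k, ?_, j, by omega, rfl, rfl⟩
      by_contra hk
      have := hN k (by omega)
      omega
  refine ⟨⟨S, fun c d hdc hc => ?_⟩, Seq.ext fun k => ?_⟩
  · rw [Finset.mem_coe, hmem] at hc ⊢
    have h1 := hanti d.1 c.1 hdc.1
    have h2 : d.2 ≤ c.2 := hdc.2
    omega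
  · rw [diagramSeq_apply, rowLen_eq_of_forall (a := (s.1 k - (m - k)).toNat)]
    · have := hnonneg k
      omega
    · intro j
      rw [← YoungDiagram.mem_cells, hmem]
      change (j : ℤ) < s.1 k - (m - k) ↔ _
      omega

theorem diagramSeq_injective (m : ℤ) : Function.Injective (diagramSeq m) := fun μ ν h =>
  rowLen_ext fun k => by
    have h1 : (diagramSeq m μ).1 k = (diagramSeq m ν).1 k := by rw [h]
    rw [diagramSeq_apply, diagramSeq_apply] at h1
    omega

/-- Young diagrams correspond to decreasing sequences. -/
def diagramEquiv (m : ℤ) : YoungDiagram ≃ {s : Seq m // StrictAnti s.1} :=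
  Equiv.ofBijective (fun μ => ⟨diagramSeq m μ, strictAnti_diagramSeq m μ⟩)
    ⟨fun _ _ h => diagramSeq_injective m (congrArg Subtype.val h), fun s => by
      obtain ⟨μ, hμ⟩ := exists_diagramSeq_eq s.2
      exact ⟨μ, Subtype.ext hμ⟩⟩

theorem diagramEquiv_apply (m : ℤ) (μ : YoungDiagram) :
    diagramEquiv m μ = ⟨diagramSeq m μ, strictAnti_diagramSeq m μ⟩ := rfl

/-! #### Addable and removable boxes -/

/-- A box can be added in row `r`. -/
def AddableRow (μ : YoungDiagram) (r : ℕ) : Prop := ∀ p, p + 1 = r → μ.rowLen r < μ.rowLen p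

theorem isAddable_iff {μ : YoungDiagram} {b : ℕ × ℕ} :
    IsAddable μ b ↔ b.2 = μ.rowLen b.1 ∧ AddableRow μ b.1 := by
  obtain ⟨r, c⟩ := b
  constructor
  · rintro ⟨h1, h2⟩
    rw [YoungDiagram.mem_iff_lt_rowLen] at h1
    have h3 : c = μ.rowLen r := by
      by_contra h3
      have := h2 (r, c - 1) (Prod.mk_lt_mk.2 (Or.inr ⟨le_rfl, by omega⟩))
      rw [YoungDiagram.mem_iff_lt_rowLen] at this
      omega
    refine ⟨h3, fun p hp => ?_⟩
    have := h2 (p, c) (Prod.mk_lt_mk.2 (Or.inl ⟨by change p + 1 = r at hp; omega, le_rfl⟩))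
    rw [YoungDiagram.mem_iff_lt_rowLen] at this
    rwa [← h3]
  · rintro ⟨h1, h2⟩
    change c = μ.rowLen r at h1
    refine ⟨by rw [YoungDiagram.mem_iff_lt_rowLen]; omega, fun d hd => ?_⟩
    obtain ⟨k, j⟩ := d
    rw [YoungDiagram.mem_iff_lt_rowLen]
    rcases Prod.mk_lt_mk.1 hd with ⟨h3, h4⟩ | ⟨h3, h4⟩
    · obtain ⟨p, rfl⟩ := Nat.exists_eq_add_of_lt h3
      have : μ.rowLen (k + p + 1) < μ.rowLen (k + p) := h2 _ rfl
      have := μ.rowLen_anti k (k + p) (by omega)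
      omega
    · have := μ.rowLen_anti k r h3
      omega

theorem isRemovable_iff {μ : YoungDiagram} {b : ℕ × ℕ} :
    IsRemovable μ b ↔ b.2 + 1 = μ.rowLen b.1 ∧ μ.rowLen (b.1 + 1) < μ.rowLen b.1 := by
  obtain ⟨r, c⟩ := b
  change _ ↔ c + 1 = μ.rowLen r ∧ μ.rowLen (r + 1) < μ.rowLen r
  constructor
  · rintro ⟨h1, h2⟩
    have h3 := h2 (r, c + 1) (Prod.mk_lt_mk.2 (Or.inr ⟨le_rfl, by omega⟩))
    have h4 := h2 (r + 1, c) (Prod.mk_lt_mk.2 (Or.inl ⟨by omega, le_rfl⟩))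
    rw [YoungDiagram.mem_iff_lt_rowLen] at h1 h3 h4
    omega
  · rintro ⟨h1, h2⟩
    refine ⟨by rw [YoungDiagram.mem_iff_lt_rowLen]; omega, fun d hd => ?_⟩
    obtain ⟨k, j⟩ := d
    rw [YoungDiagram.mem_iff_lt_rowLen]
    rcases Prod.mk_lt_mk.1 hd with ⟨h3, h4⟩ | ⟨h3, h4⟩
    · have := μ.rowLen_anti (r + 1) k h3
      omega
    · have := μ.rowLen_anti r k h3
      omega

theorem diagramSeq_addBox {μ : YoungDiagram} {r : ℕ} (h : AddableRow μ r) :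
    diagramSeq m (addBox μ (r, μ.rowLen r)) =
      (diagramSeq m μ).upd r ((diagramSeq m μ).1 r + 1) := by
  refine Seq.ext fun k => ?_
  have hr : (addBox μ (r, μ.rowLen r)).rowLen k = if k = r then μ.rowLen r + 1 else μ.rowLen k := by
    refine rowLen_eq_of_forall fun j => ?_
    rw [← YoungDiagram.mem_cells, cells_addBox (isAddable_iff.2 ⟨rfl, h⟩), Finset.mem_insert,
      YoungDiagram.mem_cells, YoungDiagram.mem_iff_lt_rowLen, Prod.mk.injEq]
    split_ifs with hk
    · subst hk
      omega
    · simp [hk]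
  rw [Seq.upd_apply, diagramSeq_apply, hr]
  split_ifs with hk
  · subst hk
    rw [diagramSeq_apply]
    push_cast
    ring
  · rfl

theorem diagramSeq_removeBox {μ : YoungDiagram} {r : ℕ} (h : μ.rowLen (r + 1) < μ.rowLen r) :
    diagramSeq m (removeBox μ (r, μ.rowLen r - 1)) =
      (diagramSeq m μ).upd r ((diagramSeq m μ).1 r - 1) := by
  refine Seq.ext fun k => ?_
  have hr : (removeBox μ (r, μ.rowLen r - 1)).rowLen k =
      if k = r then μ.rowLen r - 1 else μ.rowLen k := by
    refine rowLen_eq_of_forall fun j => ?_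
    rw [← YoungDiagram.mem_cells, cells_removeBox (isRemovable_iff.2
      ⟨Nat.sub_add_cancel (by omega), h⟩), Finset.mem_erase,
      YoungDiagram.mem_cells, YoungDiagram.mem_iff_lt_rowLen, Ne, Prod.mk.injEq]
    split_ifs with hk
    · subst hk
      omega
    · simp [hk]
  rw [Seq.upd_apply, diagramSeq_apply, hr]
  split_ifs with hk
  · subst hk
    rw [diagramSeq_apply]
    omega
  · rfl

variable {n : ℕ} {i : ZMod n} {μ : YoungDiagram}

-- There is at most one addable box per row, and the first empty row `μ.colLen 0` may receive one,
-- hence the `+ 1` in the range. The colour of the addable box of row `r` is the entry `s r`, that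
-- of a removable box is `s r - 1`.
open Classical in
theorem sum_addableC {M : Type*} [AddCommMonoid M] (f : ℕ × ℕ → M) :
    ∑ b ∈ addableC n m i μ, f b = ∑ r ∈ Finset.range (μ.colLen 0 + 1),
      if AddableRow μ r ∧ ((diagramSeq m μ).1 r : ZMod n) = i then f (r, μ.rowLen r) else 0 := by
  have hc : ∀ r, color n m (r, μ.rowLen r) = ((diagramSeq m μ).1 r : ZMod n) := fun r => by
    rw [color, diagramSeq_apply]
    congr 1
    ring
  rw [← Finset.sum_filter]
  refine Finset.sum_nbij' Prod.fst (fun r => (r, μ.rowLen r)) ?_ ?_ ?_ ?_ ?_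
  · rintro ⟨r, c⟩ hb
    rw [addableC, Finset.mem_filter, mem_addable, isAddable_iff] at hb
    obtain ⟨⟨h1, h2⟩, h3⟩ := hb
    change c = μ.rowLen r at h1
    subst h1
    rw [Finset.mem_filter, Finset.mem_range]
    refine ⟨?_, h2, (hc r).symm.trans h3⟩
    change r < _
    rcases r with _ | r
    · omega
    · have h4 := h2 r rfl
      have h5 := rowLen_pos_iff (μ := μ) (k := r)
      change μ.rowLen (r + 1) < μ.rowLen r at h4
      omega
  · intro r hr
    rw [Finset.mem_filter] at hr
    rw [addableC, Finset.mem_filter, mem_addable, isAddable_iff, hc]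
    exact ⟨⟨rfl, hr.2.1⟩, hr.2.2⟩
  · rintro ⟨r, c⟩ hb
    rw [addableC, Finset.mem_filter, mem_addable, isAddable_iff] at hb
    exact Prod.ext rfl hb.1.1.symm
  · intro r _
    rfl
  · rintro ⟨r, c⟩ hb
    rw [addableC, Finset.mem_filter, mem_addable, isAddable_iff] at hb
    exact congrArg f (Prod.ext rfl hb.1.1)

theorem sum_removableC {M : Type*} [AddCommMonoid M] (f : ℕ × ℕ → M) :
    ∑ b ∈ removableC n m i μ, f b = ∑ r ∈ Finset.range (μ.colLen 0 + 1),
      if μ.rowLen (r + 1) < μ.rowLen r ∧ (((diagramSeq m μ).1 r - 1 : ℤ) : ZMod n) = i then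
        f (r, μ.rowLen r - 1) else 0 := by
  have hc : ∀ r c, c + 1 = μ.rowLen r →
      color n m (r, c) = (((diagramSeq m μ).1 r - 1 : ℤ) : ZMod n) := fun r c h => by
    rw [color, diagramSeq_apply, ← h]
    congr 1
    push_cast
    ring
  rw [← Finset.sum_filter]
  refine Finset.sum_nbij' Prod.fst (fun r => (r, μ.rowLen r - 1)) ?_ ?_ ?_ ?_ ?_
  · rintro ⟨r, c⟩ hb
    rw [removableC, Finset.mem_filter, mem_removable, isRemovable_iff] at hb
    obtain ⟨⟨h1, h2⟩, h3⟩ := hb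
    rw [Finset.mem_filter, Finset.mem_range]
    refine ⟨?_, h2, (hc r c h1).symm.trans h3⟩
    change r < _
    have h5 := rowLen_pos_iff (μ := μ) (k := r)
    change μ.rowLen (r + 1) < μ.rowLen r at h2
    omega
  · intro r hr
    rw [Finset.mem_filter] at hr
    have h1 : μ.rowLen r - 1 + 1 = μ.rowLen r := by omega
    rw [removableC, Finset.mem_filter, mem_removable, isRemovable_iff, hc r _ h1]
    exact ⟨⟨h1, hr.2.1⟩, hr.2.2⟩
  · rintro ⟨r, c⟩ hb
    rw [removableC, Finset.mem_filter, mem_removable, isRemovable_iff] at hb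
    have h1 : c + 1 = μ.rowLen r := hb.1.1
    refine Prod.ext rfl ?_
    change μ.rowLen r - 1 = c
    omega
  · intro r _
    rfl
  · rintro ⟨r, c⟩ hb
    rw [removableC, Finset.mem_filter, mem_removable, isRemovable_iff] at hb
    have h1 : c + 1 = μ.rowLen r := hb.1.1
    refine congrArg f (Prod.ext rfl ?_)
    change c = μ.rowLen r - 1
    omega

/-- `1` if the corner between the rows `k - 1` and `k` is missing although `s k ≡ i`. -/
def blocked (n : ℕ) (m : ℤ) (i : ZMod n) (μ : YoungDiagram) : ℕ → ℤ
  | 0 => 0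
  | k + 1 => if μ.rowLen (k + 1) = μ.rowLen k then kron n i ((diagramSeq m μ).1 (k + 1)) else 0

theorem blocked_of_addableRow {r : ℕ} (h : AddableRow μ r) : blocked n m i μ r = 0 := by
  cases r with
  | zero => rfl
  | succ r => exact if_neg (h r rfl).ne

theorem blocked_succ_of_lt {r : ℕ} (h : μ.rowLen (r + 1) < μ.rowLen r) :
    blocked n m i μ (r + 1) = 0 := if_neg h.ne

theorem blocked_colLen : blocked n m i μ (μ.colLen 0 + 1) = kron n i (m - (μ.colLen 0 + 1 : ℕ)) := by
  rw [blocked, if_pos, diagramSeq_apply_of_le _ (by omega)]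
  rw [rowLen_eq_zero (by omega), rowLen_eq_zero le_rfl]

open Classical in
theorem ite_addableRow (r : ℕ) :
    (if AddableRow μ r ∧ ((diagramSeq m μ).1 r : ZMod n) = i then (1 : ℤ) else 0) =
      kron n i ((diagramSeq m μ).1 r) - blocked n m i μ r := by
  by_cases h : AddableRow μ r
  · rw [blocked_of_addableRow h, sub_zero, kron]
    simp only [h, true_and]
  · rw [if_neg fun h' => h h'.1]
    cases r with
    | zero => exact absurd (fun p hp => by omega) h
    | succ r =>
      rw [blocked, if_pos, sub_self]
      refine le_antisymm (μ.rowLen_anti r (r + 1) (Nat.le_succ r)) (not_lt.1 fun h1 => h ?_)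
      intro p hp
      obtain rfl : p = r := by omega
      exact h1

/-- If rows `r` and `r + 1` have equal length, then `s (r + 1) = s r - 1`: the missing removable box
of row `r` and the missing addable box of row `r + 1` would have the same colour, so one correction
serves both counts. -/
theorem ite_removableRow (r : ℕ) :
    (if μ.rowLen (r + 1) < μ.rowLen r ∧ (((diagramSeq m μ).1 r - 1 : ℤ) : ZMod n) = i then (1 : ℤ)
      else 0) = kron n i ((diagramSeq m μ).1 r - 1) - blocked n m i μ (r + 1) := by
  by_cases h : μ.rowLen (r + 1) < μ.rowLen r
  · rw [blocked_succ_of_lt h, sub_zero, kron]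
    simp only [h, true_and]
  · have h1 : μ.rowLen (r + 1) = μ.rowLen r :=
      le_antisymm (μ.rowLen_anti r (r + 1) (Nat.le_succ r)) (not_lt.1 h)
    rw [if_neg fun h' => h h'.1, blocked, if_pos h1, diagramSeq_apply, diagramSeq_apply, h1, eq_comm,
      sub_eq_zero]
    congr 1
    push_cast
    ring

/-- In each row, (addable minus removable) is the weight of the entry up to a difference of
consecutive corrections `blocked`. Over consecutive rows these differences telescope, leaving only
the two ends. -/
theorem card_filter_addableC_sub (P : ℕ → Prop) [DecidablePred P] :
    (({b ∈ addableC n m i μ | P b.1}).card : ℤ) - (({b ∈ removableC n m i μ | P b.1}).card : ℤ) =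
      ∑ r ∈ Finset.range (μ.colLen 0 + 1), if P r then
        wt n i ((diagramSeq m μ).1 r) - (blocked n m i μ r - blocked n m i μ (r + 1)) else 0 := by
  classical
  rw [Finset.card_filter, Finset.card_filter]
  push_cast
  rw [sum_addableC (fun b => if P b.1 then (1 : ℤ) else 0),
    sum_removableC (fun b => if P b.1 then (1 : ℤ) else 0), ← Finset.sum_sub_distrib]
  refine Finset.sum_congr rfl fun r _ => ?_
  by_cases h : P r
  · simp only [h, if_true]
    rw [ite_addableRow, ite_removableRow, wt_eq]
    ring
  · simp only [h, if_false, ite_self, sub_zero]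

/-- The correction just below a removable row vanishes, and the one beyond the last row is the
weight of the vacuum tail, precisely the extra exponent in `truncE`. -/
theorem diffBelow_eq {r : ℕ} (h : μ.rowLen (r + 1) < μ.rowLen r) :
    diffBelow n m i μ r = wtSum n i (Finset.Ico (r + 1) (μ.colLen 0 + 1)) (diagramSeq m μ) +
      kron n i (m - (μ.colLen 0 + 1 : ℕ)) := by
  have hr : r < μ.colLen 0 := rowLen_pos_iff.1 (by omega)
  have hf : ({j ∈ Finset.range (μ.colLen 0 + 1) | r < j}) = Finset.Ico (r + 1) (μ.colLen 0 + 1) := by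
    ext j
    simp only [Finset.mem_filter, Finset.mem_range, Finset.mem_Ico]
    omega
  rw [diffBelow, card_filter_addableC_sub fun j => r < j, ← Finset.sum_filter, hf,
    Finset.sum_sub_distrib, ← wtSum]
  have h1 := Finset.sum_Ico_sub (blocked n m i μ) (show r + 1 ≤ μ.colLen 0 + 1 by omega)
  rw [blocked_colLen, blocked_succ_of_lt h, sub_zero] at h1
  rw [← h1, ← sub_neg_eq_add, ← Finset.sum_neg_distrib]
  simp only [neg_sub]

/-- Both end corrections vanish, at row `0` by definition and at row `r` because it is addable. This
matches the absence of a vacuum weight in `truncF`. -/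
theorem diffAbove_eq {r : ℕ} (hr : r ≤ μ.colLen 0) (h : AddableRow μ r) :
    diffAbove n m i μ r = wtSum n i (Finset.range r) (diagramSeq m μ) := by
  have hf : ({j ∈ Finset.range (μ.colLen 0 + 1) | j < r}) = Finset.range r := by
    ext j
    simp only [Finset.mem_filter, Finset.mem_range]
    omega
  rw [diffAbove, card_filter_addableC_sub fun j => j < r, ← Finset.sum_filter, hf,
    Finset.sum_sub_distrib, ← wtSum, Finset.sum_range_sub', blocked_of_addableRow h]
  simp [blocked]

theorem diff_eq : diff n m i μ =
    wtSum n i (Finset.range (μ.colLen 0 + 1)) (diagramSeq m μ) +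
      kron n i (m - (μ.colLen 0 + 1 : ℕ)) := by
  have h := card_filter_addableC_sub (n := n) (m := m) (i := i) (μ := μ) fun _ => True
  simp only [Finset.filter_true, if_true] at h
  rw [diff, h, Finset.sum_sub_distrib, ← wtSum, Finset.sum_range_sub', blocked_colLen]
  simp [blocked]

end Diagrams

/-! ### The Fock space of Young diagrams -/

section YoungAction

variable {𝕜 : Type*} [Field 𝕜] {q : 𝕜} {n : ℕ} {m : ℤ}

/-- Term `r` of the truncated operator lowers the entry `r`. If row `r` is not removable, the entry
meets its right neighbour and the wedge is zero; otherwise the result is already normally ordered,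
so no straightening occurs. -/
theorem fockE_diagramSeq (hq : q ≠ 0) (hn : 2 ≤ n) (i : ZMod n) (μ : YoungDiagram) :
    fockE hq hn m i (pureWedge q n (diagramSeq m μ)) = ∑ b ∈ removableC n m i μ,
      q ^ diffBelow n m i μ b.1 • pureWedge q n (diagramSeq m (removeBox μ b)) := by
  rw [fockE_pureWedge hq hn i diagramSeq_apply_of_le, truncE_single, map_sum, sum_removableC]
  refine Finset.sum_congr rfl fun r _ => ?_
  rw [map_smul, posE_single]
  by_cases h1 : (((diagramSeq m μ).1 r - 1 : ℤ) : ZMod n) = i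
  · rw [if_pos h1]
    by_cases h2 : μ.rowLen (r + 1) < μ.rowLen r
    · rw [if_pos ⟨h2, h1⟩, diffBelow_eq h2, diagramSeq_removeBox h2, pureWedge]
    · rw [if_neg fun h => h2 h.1, mkQ_upd_eq_zero q (by omega), smul_zero]
      left
      have h3 := μ.rowLen_anti r (r + 1) (Nat.le_succ r)
      rw [Seq.upd_apply, Seq.upd_apply, if_pos rfl, if_neg (by omega), diagramSeq_apply,
        diagramSeq_apply]
      push_cast
      omega
  · rw [if_neg h1, if_neg fun h => h1 h.2, map_zero, smul_zero]

theorem fockF_diagramSeq (hq : q ≠ 0) (hn : 2 ≤ n) (i : ZMod n) (μ : YoungDiagram) :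
    fockF hq hn m i (pureWedge q n (diagramSeq m μ)) = ∑ b ∈ addableC n m i μ,
      q ^ (-diffAbove n m i μ b.1) • pureWedge q n (diagramSeq m (addBox μ b)) := by
  classical
  rw [fockF_pureWedge hq hn i diagramSeq_apply_of_le, truncF_single, map_sum, sum_addableC]
  refine Finset.sum_congr rfl fun r hr => ?_
  rw [Finset.mem_range] at hr
  rw [map_smul, posF_single]
  by_cases h1 : ((diagramSeq m μ).1 r : ZMod n) = i
  · rw [if_pos h1]
    by_cases h2 : AddableRow μ r
    · rw [if_pos ⟨h2, h1⟩, diffAbove_eq (by omega) h2, diagramSeq_addBox h2, pureWedge]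
    · rw [if_neg fun h => h2 h.1, mkQ_upd_eq_zero q (by omega), smul_zero]
      -- A row that is not addable has the length of the row above it, so the raised entry meets its
      -- left neighbour.
      right
      rw [AddableRow] at h2
      push Not at h2
      obtain ⟨p, rfl, h3⟩ := h2
      have h4 := μ.rowLen_anti p (p + 1) (Nat.le_succ p)
      refine ⟨p, rfl, ?_⟩
      rw [Seq.upd_apply, Seq.upd_apply, if_pos rfl, if_neg (by omega), diagramSeq_apply,
        diagramSeq_apply]
      push_cast
      omega
  · rw [if_neg h1, if_neg fun h => h1 h.2, map_zero, smul_zero]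

theorem fockK_diagramSeq (hn : 2 ≤ n) (i : ZMod n) (μ : YoungDiagram) :
    fockK q hn m i 1 (pureWedge q n (diagramSeq m μ)) =
      q ^ diff n m i μ • pureWedge q n (diagramSeq m μ) := by
  rw [fockK_pureWedge hn i 1 diagramSeq_apply_of_le, one_mul, diff_eq]

/-- The isomorphism of `F_(m)` with the space spanned by the Young diagrams. -/
def fockEquiv (hq : q ≠ 0) (hq2 : q ^ 2 + 1 ≠ 0) (hn : 0 < n) (m : ℤ) :
    Fock q n m ≃ₗ[𝕜] YFock 𝕜 :=
  (wedgeBasis hq hq2 hn m).repr.trans (Finsupp.domLCongr (diagramEquiv m).symm)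

theorem fockEquiv_pureWedge (hq : q ≠ 0) (hq2 : q ^ 2 + 1 ≠ 0) (hn : 0 < n)
    (s : {s : Seq m // StrictAnti s.1}) :
    fockEquiv hq hq2 hn m (pureWedge q n s.1) = Finsupp.single ((diagramEquiv m).symm s) 1 := by
  rw [← wedgeBasis_apply hq hq2 hn, fockEquiv, LinearEquiv.trans_apply, Module.Basis.repr_self,
    Finsupp.domLCongr_single]

theorem fockEquiv_diagramSeq (hq : q ≠ 0) (hq2 : q ^ 2 + 1 ≠ 0) (hn : 0 < n) (μ : YoungDiagram) :
    fockEquiv hq hq2 hn m (pureWedge q n (diagramSeq m μ)) = Finsupp.single μ 1 := by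
  have h := fockEquiv_pureWedge hq hq2 hn ⟨diagramSeq m μ, strictAnti_diagramSeq m μ⟩
  rwa [← diagramEquiv_apply, Equiv.symm_apply_apply] at h

theorem fockEquiv_symm_single (hq : q ≠ 0) (hq2 : q ^ 2 + 1 ≠ 0) (hn : 0 < n) (μ : YoungDiagram) :
    (fockEquiv hq hq2 hn m).symm (Finsupp.single μ 1) = pureWedge q n (diagramSeq m μ) := by
  rw [← fockEquiv_diagramSeq hq hq2 hn, LinearEquiv.symm_apply_apply]

theorem YFock_hom_ext {M : Type*} [AddCommGroup M] [Module 𝕜 M] {f g : YFock 𝕜 →ₗ[𝕜] M}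
    (h : ∀ μ, f (Finsupp.single μ 1) = g (Finsupp.single μ 1)) : f = g :=
  Finsupp.lhom_ext' fun μ => LinearMap.ext_ring (h μ)

theorem conj_fockE (hq : q ≠ 0) (hq2 : q ^ 2 + 1 ≠ 0) (hn : 2 ≤ n) (i : ZMod n) :
    (fockEquiv hq hq2 (by omega) m).conj (fockE hq hn m i) = youngE q n m i := by
  refine YFock_hom_ext fun μ => ?_
  rw [LinearEquiv.conj_apply_apply, fockEquiv_symm_single, fockE_diagramSeq, map_sum, youngE,
    Finsupp.linearCombination_single, one_smul]
  exact Finset.sum_congr rfl fun b _ => by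
    rw [map_smul, fockEquiv_diagramSeq, Finsupp.smul_single, smul_eq_mul, mul_one]

theorem conj_fockF (hq : q ≠ 0) (hq2 : q ^ 2 + 1 ≠ 0) (hn : 2 ≤ n) (i : ZMod n) :
    (fockEquiv hq hq2 (by omega) m).conj (fockF hq hn m i) = youngF q n m i := by
  refine YFock_hom_ext fun μ => ?_
  rw [LinearEquiv.conj_apply_apply, fockEquiv_symm_single, fockF_diagramSeq, map_sum, youngF,
    Finsupp.linearCombination_single, one_smul]
  exact Finset.sum_congr rfl fun b _ => by
    rw [map_smul, fockEquiv_diagramSeq, Finsupp.smul_single, smul_eq_mul, mul_one]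

theorem conj_fockK (hq : q ≠ 0) (hq2 : q ^ 2 + 1 ≠ 0) (hn : 2 ≤ n) (i : ZMod n) :
    (fockEquiv hq hq2 (by omega) m).conj (fockK q hn m i 1) = youngK q n m i := by
  refine YFock_hom_ext fun μ => ?_
  rw [LinearEquiv.conj_apply_apply, fockEquiv_symm_single, fockK_diagramSeq, youngK,
    Finsupp.linearCombination_single, one_smul, map_smul, fockEquiv_diagramSeq, Finsupp.smul_single,
    smul_eq_mul, mul_one]

/-- The action of `U'_q(sl_n^)` on the space spanned by the Young diagrams. -/
def youngAction (hq : q ≠ 0) (hqq : q - q⁻¹ ≠ 0) (hq2 : q ^ 2 + 1 ≠ 0) (hn : 2 ≤ n) (m : ℤ) :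
    U q n →ₐ[𝕜] Module.End 𝕜 (YFock 𝕜) :=
  ((fockEquiv hq hq2 (by omega) m).conjAlgEquiv 𝕜).toAlgHom.comp (fockAction hq hqq hn m)

theorem youngAction_apply (hq : q ≠ 0) (hqq : q - q⁻¹ ≠ 0) (hq2 : q ^ 2 + 1 ≠ 0) (hn : 2 ≤ n)
    (m : ℤ) (x : U q n) : youngAction hq hqq hq2 hn m x =
      (fockEquiv hq hq2 (by omega) m).conj (fockAction hq hqq hn m x) := rfl

theorem isYoungAction_youngAction (hq : q ≠ 0) (hqq : q - q⁻¹ ≠ 0) (hq2 : q ^ 2 + 1 ≠ 0)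
    (hn : 2 ≤ n) (m : ℤ) : IsYoungAction q n m (youngAction hq hqq hq2 hn m) where
  E_eq i := by
    rw [youngAction_apply, fockAction_gen]
    exact conj_fockE hq hq2 hn i
  F_eq i := by
    rw [youngAction_apply, fockAction_gen]
    exact conj_fockF hq hq2 hn i
  K_eq i := by
    rw [youngAction_apply, fockAction_gen]
    exact conj_fockK hq hq2 hn i

theorem IsYoungAction.unique {σ σ' : U q n →ₐ[𝕜] Module.End 𝕜 (YFock 𝕜)}
    (h : IsYoungAction q n m σ) (h' : IsYoungAction q n m σ') : σ = σ' :=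
  U_hom_ext (fun i => (h.E_eq i).trans (h'.E_eq i).symm) (fun i => (h.F_eq i).trans (h'.F_eq i).symm)
    fun i => (h.K_eq i).trans (h'.K_eq i).symm

end YoungAction

end

end QWedge

/-! ### Assembly of the theorem -/

theorem proposition1p4 {𝕜 : Type*} [Field 𝕜] [CharZero 𝕜] (n : ℕ) (hn : 2 ≤ n)
    (q : 𝕜) (hq0 : q ≠ 0) (hq : ∀ k : ℕ, 0 < k → q ^ k ≠ 1) :
    (∃! ρ : ∀ m : ℤ, QWedge.U q n →ₐ[𝕜] Module.End 𝕜 (QWedge.Fock q n m),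
      QWedge.IsWedgeAction q n ρ) ∧
    (∀ m : ℤ, ∃! σ : QWedge.U q n →ₐ[𝕜] Module.End 𝕜 (QWedge.YFock 𝕜),
      QWedge.IsYoungAction q n m σ) ∧
    ∀ (ρ : ∀ m : ℤ, QWedge.U q n →ₐ[𝕜] Module.End 𝕜 (QWedge.Fock q n m))
      (m : ℤ) (σ : QWedge.U q n →ₐ[𝕜] Module.End 𝕜 (QWedge.YFock 𝕜)),
      QWedge.IsWedgeAction q n ρ → QWedge.IsYoungAction q n m σ →
      ∃ (e : {s : QWedge.Seq m // StrictAnti s.1} ≃ YoungDiagram)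
        (φ : QWedge.Fock q n m ≃ₗ[𝕜] QWedge.YFock 𝕜),
        (∀ (s : {s : QWedge.Seq m // StrictAnti s.1}) (k : ℕ),
          s.1.1 k = m - k + ((e s).rowLen k : ℤ)) ∧
        (∀ s : {s : QWedge.Seq m // StrictAnti s.1},
          φ (QWedge.pureWedge q n s.1) = Finsupp.single (e s) 1) ∧
        (∀ (x : QWedge.U q n) (w : QWedge.Fock q n m), φ (ρ m x w) = σ x (φ w)) := by
  have hqq : q - q⁻¹ ≠ 0 := fun h => hq 2 (by norm_num) (by
    rw [sub_eq_zero] at h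
    rw [pow_two]
    nth_rw 2 [h]
    exact mul_inv_cancel₀ hq0)
  -- `(q ^ 2 - 1) (q ^ 2 + 1) = q ^ 4 - 1`, so `q ^ 2 = -1` would make `q` a fourth root of unity.
  have hq2 : q ^ 2 + 1 ≠ 0 := fun h => hq 4 (by norm_num) (by
    linear_combination (q ^ 2 - 1) * h)
  have hρ := QWedge.isWedgeAction_fockAction hq0 hqq hn
  have hσ := QWedge.isYoungAction_youngAction hq0 hqq hq2 hn
  refine ⟨⟨_, hρ, fun ρ h => h.unique hρ⟩, fun m => ⟨_, hσ m, fun σ h => h.unique (hσ m)⟩, ?_⟩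
  intro ρ m σ h h'
  -- By uniqueness the given actions are the constructed ones. The Young action was built by
  -- conjugating with `fockEquiv`, so this map intertwines them by construction.
  obtain rfl := h.unique hρ
  obtain rfl := h'.unique (hσ m)
  refine ⟨(QWedge.diagramEquiv m).symm, QWedge.fockEquiv hq0 hq2 (by omega) m, fun s k => ?_,
    QWedge.fockEquiv_pureWedge hq0 hq2 _, fun x w => ?_⟩
  · obtain ⟨μ, rfl⟩ := (QWedge.diagramEquiv m).surjective s
    rw [Equiv.symm_apply_apply]
    rfl
  · rw [QWedge.youngAction_apply, LinearEquiv.conj_apply_apply, LinearEquiv.symm_apply_apply]
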